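/- Let $\mathcal X,\mathcal Y$ be finite nonempty alphabets and let $W=(W(y|x))$ be a stochastic matrix from $\mathcal X$ to $\mathcal Y$ (a discrete memoryless channel). Logarithms are natural. For input distributions $Q$ on $\mathcal X$, let $I(Q;V)$ be the mutual information of $Q$ and a stochastic matrix $V$ from $\mathcal X$ to $\mathcal Y$, let $\mathrm D(V\|W|Q)=\sum_x Q(x)\,\mathrm D(V(\cdot|x)\|W(\cdot|x))\in[0,\infty]$ be the conditional relative entropy, let $C(W)=\max_Q I(Q;W)$, and for $R\ge 0$ put $$\mathrm E_{\mathrm{SP}}(R)=\max_Q\ \min_{V:\,I(Q;V)\le R}\mathrm D(V\|W|Q)\in[0,\infty],\qquad \mathrm E_{\mathrm r}(R)=\max_Q\max_{0\le\rho\le1}\Big\{-\ln\sum_{y}\Big(\sum_x Q(x)W(y|x)^{\frac1{1+\rho}}\Big)^{1+\rho}-\rho R\Big\}.$$ Let $R_\infty$ be the largest rate such that $\mathrm E_{\mathrm{SP}}=\infty$ at all rates below it, and let $R_{\mathrm{cr}}$ be the smallest rate $R\ge 0$ with $\mathrm E_{\mathrm r}(R)=\mathrm E_{\mathrm{SP}}(R)$.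 An $(N,R)$ code consists of an encoder $f:\mathcal M\to\mathcal X^N$ and a decoder $\varphi:\mathcal Y^N\to\mathcal M$, where $|\mathcal M|=\lceil e^{NR}\rceil$; $\mathrm P_{\mathrm e}(N,R)$ is the minimum over all $(N,R)$ codes of the maximal (over messages) error probability over $W$. In an $(N,R)$ code with ideal feedback the encoder consists of maps $f_n:\mathcal M\times\mathcal Y^{n-1}\to\mathcal X$, $1\le n\le N$, so that $\mathbf y^N$ is received with probability $\prod_{n=1}^N W(y_n|f_n(m,\mathbf y^{n-1}))$ when $m$ is sent; $\bar{\mathrm P}_{\mathrm{e,fb}}(N,R)$ is the minimum over all such codes of the average (over uniformly distributed messages) error probability. The channel $W$ is symmetric if $\mathcal Y$ can be partitioned into subsets such that, within each subset, the rows of the matrix of transition probabilities are permutations of each other and so are its columns. It is nonsingular if $W(y|x)\ne W(y|z)$ for some $x,z\in\mathcal X$, $y\in\mathcal Y$ with $W(y|x)W(y|z)>0$. **Theorem.** Let $W$ be symmetric and nonsingular with $R_{\mathrm{cr}}<C(W)$. (i) For every $R$ with $R_{\mathrm{cr}}<R<C(W)$, the function $\mathrm E_{\mathrm r}$ is differentiable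 at $R$ and there is a constant $K_1>0$, depending only on $W$ and $R$, such that for all $N\ge1$ $$\mathrm P_{\mathrm e}(N,R)\le \frac{K_1}{N^{\frac12(1+|\mathrm E_{\mathrm r}'(R)|)}}\,e^{-N\mathrm E_{\mathrm r}(R)}.$$ (ii) For every $R$ with $R_\infty<R<C(W)$, the function $\mathrm E_{\mathrm{SP}}$ is finite on $(R_\infty,\infty)$ and differentiable at $R$, and there is a constant $\tilde K_1>0$, depending only on $W$ and $R$, such that for all $N\ge1$ $$\bar{\mathrm P}_{\mathrm{e,fb}}(N,R)\ge \frac{\tilde K_1}{N^{\frac12(1+|\mathrm E_{\mathrm{SP}}'(R)|)}}\,e^{-N\mathrm E_{\mathrm{SP}}(R)}.$$ -/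

import Mathlib

noncomputable section

namespace ChannelCoding

/-- `W x y` is the transition probability `W(y|x)`. A channel is a stochastic matrix from `X` to `Y`. -/
def IsChannel {X Y : Type*} [Fintype Y] (W : X → Y → ℝ) : Prop :=
  ∀ x, W x ∈ stdSimplex ℝ Y

/-- Gallager symmetry: the outputs can be partitioned into blocks such that, within each block,
the rows of the matrix are permutations of each other and so are the columns. -/
def IsSymmetric {X Y : Type*} [Fintype Y] [DecidableEq Y] (W : X → Y → ℝ) : Prop :=
  ∃ P : Finpartition (Finset.univ : Finset Y), ∀ B ∈ P.parts,
    (∀ x x' : X, ∃ σ : Equiv.Perm B, ∀ y : B, W x y = W x' (σ y)) ∧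
    (∀ y ∈ B, ∀ y' ∈ B, ∃ τ : Equiv.Perm X, ∀ x : X, W x y = W (τ x) y')

/-- A channel is singular if all nonzero entries of each column are equal. -/
def IsSingular {X Y : Type*} (W : X → Y → ℝ) : Prop :=
  ∀ (x : X) (y : Y) (z : X), 0 < W x y * W z y → W x y = W z y

section Information

variable {X Y : Type*} [Fintype X] [Fintype Y]

/-- The output distribution of the channel `V` under the input distribution `Q`. -/
def outputDist (Q : X → ℝ) (V : X → Y → ℝ) (y : Y) : ℝ := ∑ x, Q x * V x y

/-- Mutual information `I(Q;V)` in nats (with `0 log 0 = 0`). -/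
def mutualInfo (Q : X → ℝ) (V : X → Y → ℝ) : ℝ :=
  ∑ x, ∑ y, Q x * V x y * Real.log (V x y / outputDist Q V y)

/-- Capacity: the maximum of the mutual information over input distributions. -/
def capacity (W : X → Y → ℝ) : ℝ :=
  sSup ((fun Q => mutualInfo Q W) '' stdSimplex ℝ X)

open Classical in
/-- Conditional relative entropy `D(V‖W|Q)`; it is infinite when, for some `x` with `Q x > 0`, the
row `V(·|x)` is not absolutely continuous with respect to `W(·|x)`. -/
def condDiv (V W : X → Y → ℝ) (Q : X → ℝ) : EReal :=
  if ∀ x, 0 < Q x → ∀ y, W x y = 0 → V x y = 0 then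
    ((∑ x, Q x * ∑ y, V x y * Real.log (V x y / W x y) : ℝ) : EReal)
  else ⊤

/-- `E_SP(R,Q)`. -/
def spherePackingExpOf (W : X → Y → ℝ) (R : ℝ) (Q : X → ℝ) : EReal :=
  ⨅ V ∈ {V : X → Y → ℝ | IsChannel V ∧ mutualInfo Q V ≤ R}, condDiv V W Q

/-- The sphere-packing exponent `E_SP(R)`, which can be infinite. -/
def spherePackingExp (W : X → Y → ℝ) (R : ℝ) : EReal :=
  ⨆ Q ∈ stdSimplex ℝ X, spherePackingExpOf W R Q

/-- Gallager's function `E_o(ρ,Q)`. -/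
def gallagerFun (W : X → Y → ℝ) (ρ : ℝ) (Q : X → ℝ) : ℝ :=
  -Real.log (∑ y, (∑ x, Q x * W x y ^ (1 / (1 + ρ))) ^ (1 + ρ))

/-- `E_r(R,Q)`. -/
def randomCodingExpOf (W : X → Y → ℝ) (R : ℝ) (Q : X → ℝ) : ℝ :=
  sSup ((fun ρ : ℝ => gallagerFun W ρ Q - ρ * R) '' Set.Icc 0 1)

/-- The random coding exponent `E_r(R)`. -/
def randomCodingExp (W : X → Y → ℝ) (R : ℝ) : ℝ :=
  sSup ((fun Q => randomCodingExpOf W R Q) '' stdSimplex ℝ X)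

/-- `R_∞`: the largest rate such that the sphere-packing exponent is infinite at all rates
below it. -/
def rateInfty (W : X → Y → ℝ) : ℝ :=
  sSup {R : ℝ | 0 ≤ R ∧ ∀ r, 0 ≤ r → r < R → spherePackingExp W r = ⊤}

/-- The critical rate: the rate from which on the random coding and the sphere-packing exponents
agree. -/
def criticalRate (W : X → Y → ℝ) : ℝ :=
  sInf {R : ℝ | 0 ≤ R ∧ (randomCodingExp W R : EReal) = spherePackingExp W R}

/-- `E_r'(R)`. -/
def randomCodingSlope (W : X → Y → ℝ) (R : ℝ) : ℝ :=
  deriv (fun r => randomCodingExp W r) R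

/-- `E_SP'(R)`. -/
def spherePackingSlope (W : X → Y → ℝ) (R : ℝ) : ℝ :=
  deriv (fun r => (spherePackingExp W r).toReal) R

end Information

/-- The number of messages of a code with blocklength `N` and rate `R` (in nats). -/
def numMessages (N : ℕ) (R : ℝ) : ℕ := ⌈Real.exp (N * R)⌉₊

/-- A (deterministic) block code with blocklength `N` and `M` messages, without feedback. -/
structure Code (X Y : Type*) (N M : ℕ) where
  enc : Fin M → Fin N → X
  dec : (Fin N → Y) → Fin M

/-- A (deterministic) block code with ideal feedback: the channel input at each time is a function
of the message and of all previous channel outputs. -/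
structure FeedbackCode (X Y : Type*) (N M : ℕ) where
  enc : (n : Fin N) → Fin M → (Fin (n : ℕ) → Y) → X
  dec : (Fin N → Y) → Fin M

section ErrorProbability

variable {X Y : Type*} [Fintype Y] {N M : ℕ}

/-- Error probability of a code without feedback when message `m` is sent over the memoryless
channel `W`. -/
def Code.errorProb (c : Code X Y N M) (W : X → Y → ℝ) (m : Fin M) : ℝ :=
  ∑ y : Fin N → Y with c.dec y ≠ m, ∏ n, W (c.enc m n) (y n)

/-- The probability of the output sequence `y` when message `m` is sent with feedback. -/
def FeedbackCode.outputProb (c : FeedbackCode X Y N M) (W : X → Y → ℝ) (m : Fin M)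
    (y : Fin N → Y) : ℝ :=
  ∏ n : Fin N, W (c.enc n m (fun i => y (Fin.castLE n.isLt.le i))) (y n)

/-- Average error probability of a code with ideal feedback. -/
def FeedbackCode.avgErrorProb (c : FeedbackCode X Y N M) (W : X → Y → ℝ) : ℝ :=
  (1 / (M : ℝ)) * ∑ m : Fin M, ∑ y : Fin N → Y with c.dec y ≠ m, c.outputProb W m y

end ErrorProbability

/-- `P_e(N,R)`: the minimum over all `(N,R)` codes of the maximal error probability. -/
def minMaxError {X Y : Type*} [Fintype Y] (W : X → Y → ℝ) (N : ℕ) (R : ℝ) : ℝ :=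
  ⨅ c : Code X Y N (numMessages N R), ⨆ m : Fin (numMessages N R), c.errorProb W m

/-- The minimum over all `(N,R)` codes with ideal feedback of the average error probability. -/
def minAvgErrorFeedback {X Y : Type*} [Fintype Y] (W : X → Y → ℝ) (N : ℕ) (R : ℝ) : ℝ :=
  ⨅ c : FeedbackCode X Y N (numMessages N R), c.avgErrorProb W

end ChannelCoding

end

open ChannelCoding

/-! Write `E₀(ρ)` for `gallagerFun` at the uniform input, `V_ρ` for `tiltedChannel`, `q_ρ` for its
output law `tiltedLaw` and `r(ρ)` for `tiltedRate`.

Exponents. By symmetry every row of `V_ρ` has the same divergence `E₀(ρ) - ρ r(ρ)` from `W`, and its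
mutual information under any input is at most `r(ρ)`. So `V_ρ` is feasible at rate `r(ρ)` for all
inputs at once, and weak duality (`gallagerFun_le`) gives the tangent inequality `E₀(ρ',Q) ≤ E₀(ρ) +
(ρ' - ρ) r(ρ)`. Hence both exponents at `r(ρ)` equal `E₀(ρ) - ρ r(ρ)` (the random coding one for `ρ
≤ 1`). Nonsingularity makes `r` strictly decreasing, so the slope there is `-ρ`
(`hasDerivAt_of_legendre`). It remains to find the power `N^(-(1+ρ)/2)`.

Achievability. Draw words uniformly and use the bound `E min(1, M p)`, where `p` is the pairwise
error probability. Tilting the uniform law to `backwardLaw` leaves in `p` a factor `E exp(-s|L -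
t|)` for a log-likelihood sum `L`. For a nonsingular channel `L` has concentration function of order
`N^(-1/2)`, and `p` enters through its power `ρ`. The refinement `min(1,u) ≤ u^ρ exp(-a|log u|)`
gives one more such factor, so the total is `N^(-(1+ρ)/2)` (`exists_unionBound_le`). Expurgation
passes to the maximal error.

Converse. The error is at least the value of a binary test between the law of the output given a
message and the product of `q_ρ`. Permuting outputs along the rows shows that feedback does not
change this value (`sum_min_outputProb_eq`). Changing measure to `V_ρ` places the threshold near the
mean of the log-likelihood ratio, where a window of fixed length has probability of order at least
`N^(-1/2)` (`exists_window_ge`). The threshold is moved by `((1+ρ)/2) log N` to offset this, and the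
move becomes the prefactor.

Both local estimates come from one device: each coordinate is split so that with a fixed probability
it is a fair coin between two atoms. Given which coordinates are coins, the sum is an affine
function of a symmetric binomial variable. -/

set_option linter.unusedSectionVars false

noncomputable section

/-! ### Product laws: moments and the splitting of coordinates into fair coins. -/

namespace ProductLaw

open Finset

variable {ι Z : Type*} [Fintype ι] [DecidableEq ι] [Fintype Z]

/-- Factorization of the expectation of a product under a product weight. -/
theorem sum_prod_mul_prod (p ψ : ι → Z → ℝ) :
    ∑ z : ι → Z, (∏ i, p i (z i)) * ∏ i, ψ i (z i) = ∏ i, ∑ c, p i c * ψ i c := by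
  rw [Fintype.prod_sum]
  exact sum_congr rfl fun z _ => prod_mul_distrib.symm

theorem sum_prod_eq_one {p : ι → Z → ℝ} (hp : ∀ i, ∑ c, p i c = 1) :
    ∑ z : ι → Z, ∏ i, p i (z i) = 1 := by
  rw [← Fintype.prod_sum]
  exact prod_eq_one fun i _ => hp i

/-- Two-coordinate marginals of a product law. -/
theorem sum_prod_mul_pair {p : ι → Z → ℝ} (hp : ∀ i, ∑ c, p i c = 1) {a b : ι} (hab : a ≠ b)
    (φ : Z → Z → ℝ) :
    ∑ z : ι → Z, (∏ i, p i (z i)) * φ (z a) (z b) = ∑ u, ∑ v, p a u * p b v * φ u v := by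
  classical
  have key : ∀ u v, ∑ z : ι → Z, (∏ i, p i (z i)) *
      ((if z a = u then (1 : ℝ) else 0) * (if z b = v then 1 else 0)) = p a u * p b v := by
    intro u v
    have h1 : ∀ z : ι → Z, ((if z a = u then (1 : ℝ) else 0) * (if z b = v then 1 else 0))
        = ∏ i, (if i = a then (if z i = u then (1 : ℝ) else 0) else
            if i = b then (if z i = v then 1 else 0) else 1) := by
      intro z
      rw [← prod_subset (subset_univ {a, b}), prod_pair hab]
      · simp [hab.symm]
      · intro i _ hi
        simp only [mem_insert, mem_singleton, not_or] at hi
        simp [hi.1, hi.2]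
    simp_rw [h1]
    rw [sum_prod_mul_prod p (fun i c => if i = a then (if c = u then (1 : ℝ) else 0) else
            if i = b then (if c = v then 1 else 0) else 1)]
    rw [← prod_subset (subset_univ {a, b}), prod_pair hab]
    · simp [hab.symm]
    · intro i _ hi
      simp only [mem_insert, mem_singleton, not_or] at hi
      simp [hi.1, hi.2, hp]
  have h2 : ∀ z : ι → Z, φ (z a) (z b) = ∑ u, ∑ v,
      ((if z a = u then (1 : ℝ) else 0) * (if z b = v then 1 else 0)) * φ u v := by
    intro z; simp
  simp_rw [h2, mul_sum]
  rw [sum_comm]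
  refine sum_congr rfl fun u _ => ?_
  rw [sum_comm]
  refine sum_congr rfl fun v _ => ?_
  rw [← key u v, sum_mul]
  exact sum_congr rfl fun z _ => by ring

/-- One-coordinate marginals of a product law. -/
theorem sum_prod_mul_single {p : ι → Z → ℝ} (hp : ∀ i, ∑ c, p i c = 1) (a : ι) (φ : Z → ℝ) :
    ∑ z : ι → Z, (∏ i, p i (z i)) * φ (z a) = ∑ u, p a u * φ u := by
  have h1 : ∀ z : ι → Z, φ (z a) = ∏ i, (if i = a then φ (z i) else 1) := by
    intro z; simp
  simp_rw [h1]
  rw [sum_prod_mul_prod p (fun i c => if i = a then φ c else 1)]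
  rw [← prod_subset (subset_univ {a})]
  · simp
  · intro i _ hi
    simp only [mem_singleton] at hi
    simp [hi, hp]

/-- The variance of a sum of independent centred variables is the sum of the variances. -/
theorem sum_prod_mul_sq {p : ι → Z → ℝ} (hp : ∀ i, ∑ c, p i c = 1) {ψ : ι → Z → ℝ}
    (hψ : ∀ i, ∑ c, p i c * ψ i c = 0) :
    ∑ z : ι → Z, (∏ i, p i (z i)) * (∑ i, ψ i (z i)) ^ 2 = ∑ i, ∑ c, p i c * ψ i c ^ 2 := by
  simp_rw [sq (∑ i, ψ i _), sum_mul_sum, mul_sum]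
  rw [sum_comm]
  refine sum_congr rfl fun a _ => ?_
  rw [sum_comm, sum_eq_single a]
  · rw [sum_prod_mul_single hp a (fun c => ψ a c * ψ a c)]
    simp_rw [← sq]
  · intro b _ hb
    rw [sum_prod_mul_pair hp hb.symm (fun u v => ψ a u * ψ b v)]
    have : ∀ u v, p a u * p b v * (ψ a u * ψ b v) = (p a u * ψ a u) * (p b v * ψ b v) := by
      intro u v; ring
    simp_rw [this, ← sum_mul_sum, hψ, zero_mul]
  · simp

theorem sum_prod_mul_sq_sub_le {p : ι → Z → ℝ} (hp : ∀ i, ∑ c, p i c = 1)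
    (φ : ι → Z → ℝ) :
    ∑ z : ι → Z, (∏ i, p i (z i)) * (∑ i, φ i (z i) - ∑ i, ∑ c, p i c * φ i c) ^ 2 ≤
      ∑ i, ∑ c, p i c * φ i c ^ 2 := by
  have h := sum_prod_mul_sq hp (ψ := fun i c => φ i c - ∑ c, p i c * φ i c) (by
    intro i
    simp_rw [mul_sub]
    rw [sum_sub_distrib, ← sum_mul, hp, one_mul, sub_self])
  simp_rw [sum_sub_distrib] at h
  rw [h]
  refine sum_le_sum fun i _ => ?_
  have : ∀ c, p i c * (φ i c - ∑ c, p i c * φ i c) ^ 2 = p i c * φ i c ^ 2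
      - 2 * (∑ c, p i c * φ i c) * (p i c * φ i c) + p i c * (∑ c, p i c * φ i c) ^ 2 := by
    intro c; ring
  simp_rw [this]
  rw [sum_add_distrib, sum_sub_distrib, ← mul_sum, ← sum_mul, hp]
  nlinarith [sq_nonneg (∑ c, p i c * φ i c)]

/-- The inverse moment of one plus a sum of independent `[0,1]`-valued variables. -/
theorem sum_prod_mul_inv_le {p : ι → Z → ℝ} (hp0 : ∀ i c, 0 ≤ p i c)
    (hp : ∀ i, ∑ c, p i c = 1) {χ : ι → Z → ℝ} (h0 : ∀ i c, 0 ≤ χ i c) (h1 : ∀ i c, χ i c ≤ 1) :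
    ∑ z : ι → Z, (∏ i, p i (z i)) * (1 + ∑ i, χ i (z i))⁻¹ ≤
      6 / (1 + ∑ i, ∑ c, p i c * χ i c) := by
  set m := ∑ i, ∑ c, p i c * χ i c with hm
  have hm0 : 0 ≤ m := sum_nonneg fun i _ => sum_nonneg fun c _ => mul_nonneg (hp0 i c) (h0 i c)
  -- A Chebyshev argument in pointwise form: either `1 + k` is at least half of `1 + m`, or `k` lies
  -- more than `(1 + m) / 2` below its mean and the quadratic term exceeds `1`. The variance is at
  -- most `m`, which gives `2 + 4 = 6`.
  have hpt : ∀ z : ι → Z, (1 + ∑ i, χ i (z i))⁻¹ ≤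
      2 / (1 + m) + 4 / (1 + m) ^ 2 * (∑ i, χ i (z i) - m) ^ 2 := by
    intro z
    have hk : 0 ≤ ∑ i, χ i (z i) := sum_nonneg fun i _ => h0 i _
    set k := ∑ i, χ i (z i)
    by_cases hc : (1 + m) / 2 ≤ 1 + k
    · have : (1 + k)⁻¹ ≤ 2 / (1 + m) := by
        rw [inv_eq_one_div, div_le_div_iff₀ (by linarith) (by linarith)]; linarith
      have : 0 ≤ 4 / (1 + m) ^ 2 * (k - m) ^ 2 := by positivity
      linarith
    · push Not at hc
      have h3 : (1 + k)⁻¹ ≤ 1 := inv_le_one_of_one_le₀ (by linarith)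
      have h4 : 1 ≤ 4 / (1 + m) ^ 2 * (k - m) ^ 2 := by
        rw [div_mul_eq_mul_div, le_div_iff₀ (by positivity)]
        nlinarith
      have : 0 ≤ 2 / (1 + m) := by positivity
      linarith
  have hvar := sum_prod_mul_sq_sub_le hp χ
  have hvar2 : ∑ i, ∑ c, p i c * χ i c ^ 2 ≤ m :=
    sum_le_sum fun i _ => sum_le_sum fun c _ => mul_le_mul_of_nonneg_left
      (by nlinarith [h0 i c, h1 i c]) (hp0 i c)
  calc _ ≤ ∑ z : ι → Z, (∏ i, p i (z i)) *
        (2 / (1 + m) + 4 / (1 + m) ^ 2 * (∑ i, χ i (z i) - m) ^ 2) :=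
        sum_le_sum fun z _ => mul_le_mul_of_nonneg_left (hpt z) (prod_nonneg fun i _ => hp0 i _)
    _ = 2 / (1 + m) + 4 / (1 + m) ^ 2 *
        ∑ z : ι → Z, (∏ i, p i (z i)) * (∑ i, χ i (z i) - m) ^ 2 := by
        simp_rw [mul_add]
        rw [sum_add_distrib, ← sum_mul, sum_prod_eq_one hp, one_mul, mul_sum]
        congr 1
        exact sum_congr rfl fun z _ => by ring
    _ ≤ 2 / (1 + m) + 4 / (1 + m) ^ 2 * (1 + m) := by
        gcongr; linarith
    _ = _ := by field_simp; norm_num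

/-- Jensen's inequality for the concave power `θ ≤ 1` reduces this to the inverse moment. -/
theorem sum_prod_mul_rpow_neg_le {p : ι → Z → ℝ} (hp0 : ∀ i c, 0 ≤ p i c)
    (hp : ∀ i, ∑ c, p i c = 1) {χ : ι → Z → ℝ} (h0 : ∀ i c, 0 ≤ χ i c) (h1 : ∀ i c, χ i c ≤ 1)
    {θ : ℝ} (hθ0 : 0 ≤ θ) (hθ1 : θ ≤ 1) :
    ∑ z : ι → Z, (∏ i, p i (z i)) * (1 + ∑ i, χ i (z i)) ^ (-θ) ≤
      (6 / (1 + ∑ i, ∑ c, p i c * χ i c)) ^ θ := by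
  have hk : ∀ z : ι → Z, 0 ≤ ∑ i, χ i (z i) := fun z => sum_nonneg fun i _ => h0 i _
  have hJ := (Real.concaveOn_rpow hθ0 hθ1).le_map_sum (t := univ)
    (w := fun z : ι → Z => ∏ i, p i (z i)) (p := fun z => (1 + ∑ i, χ i (z i))⁻¹)
    (fun z _ => prod_nonneg fun i _ => hp0 i _) (sum_prod_eq_one hp)
    (fun z _ => by simp only [Set.mem_Ici]; have := hk z; positivity)
  simp only [smul_eq_mul] at hJ
  calc _ = ∑ z : ι → Z, (∏ i, p i (z i)) * ((1 + ∑ i, χ i (z i))⁻¹) ^ θ :=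
        sum_congr rfl fun z _ => by
          rw [Real.inv_rpow (by have := hk z; positivity), Real.rpow_neg (by have := hk z; positivity)]
    _ ≤ _ := hJ
    _ ≤ _ := Real.rpow_le_rpow (sum_nonneg fun z _ => mul_nonneg (prod_nonneg fun i _ => hp0 i _)
        (by have := hk z; positivity)) (sum_prod_mul_inv_le hp0 hp h0 h1) hθ0

/-- The image of a product weight under a coordinatewise map. -/
theorem sum_prod_comp {Ω : Type*} [Fintype Ω] [DecidableEq Z] (q : ι → Ω → ℝ) (π : Ω → Z)
    (h : (ι → Z) → ℝ) :
    ∑ ω : ι → Ω, (∏ i, q i (ω i)) * h (fun i => π (ω i)) =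
      ∑ z : ι → Z, (∏ i, ∑ c, if π c = z i then q i c else 0) * h z := by
  rw [← sum_fiberwise univ (fun ω : ι → Ω => fun i => π (ω i))]
  refine sum_congr rfl fun z _ => ?_
  rw [Fintype.prod_sum, sum_mul, sum_filter]
  refine sum_congr rfl fun ω _ => ?_
  split_ifs with hz
  · subst hz; simp
  · have : ∃ i, π (ω i) ≠ z i := by
      by_contra hcon; push Not at hcon; exact hz (funext hcon)
    obtain ⟨i, hi⟩ := this
    rw [prod_eq_zero (mem_univ i) (by simp [hi]), zero_mul]

/-- The law obtained from `p` by splitting off, on each coordinate `i`, a fair coin between `z₁`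
and `z₂` with probability `2 * δ i`; the second component tells whether the coin is used. -/
def splitLaw [DecidableEq Z] (p : ι → Z → ℝ) (δ : ι → ℝ) (z₁ z₂ : Z) (i : ι) (ω : Z × Bool) : ℝ :=
  -- When the coin is used the first component is ignored; drawing it from `p` only supplies the
  -- total mass `2 * δ i`.
  if ω.2 then 2 * δ i * p i ω.1
  else p i ω.1 - δ i * ((if ω.1 = z₁ then 1 else 0) + (if ω.1 = z₂ then 1 else 0))

def splitMap (z₁ z₂ : Z) (ω : (Z × Bool) × Bool) : Z :=
  if ω.1.2 then (if ω.2 then z₂ else z₁) else ω.1.1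

/-- The mass `δ i` removed from each of the two atoms is returned by the fair coin, so `splitMap`
carries the split law times independent coin flips back to `p`. The inner sum is the conditional
expectation given which coordinates are coins. -/
theorem sum_prod_eq_splitLaw [DecidableEq Z] {p : ι → Z → ℝ} (hp : ∀ i, ∑ c, p i c = 1)
    (δ : ι → ℝ) (z₁ z₂ : Z) (h : (ι → Z) → ℝ) :
    ∑ z : ι → Z, (∏ i, p i (z i)) * h z =
      ∑ ω : ι → Z × Bool, (∏ i, splitLaw p δ z₁ z₂ i (ω i)) *
        ((1 / 2 : ℝ) ^ Fintype.card ι *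
          ∑ ε : ι → Bool, h (fun i => splitMap z₁ z₂ (ω i, ε i))) := by
  have h1 := sum_prod_comp (fun i (c : (Z × Bool) × Bool) => splitLaw p δ z₁ z₂ i c.1 * (1 / 2))
    (splitMap z₁ z₂) h
  have h2 : ∀ i z, (∑ c : (Z × Bool) × Bool,
      if splitMap z₁ z₂ c = z then splitLaw p δ z₁ z₂ i c.1 * (1 / 2) else 0) = p i z := by
    intro i z
    simp only [Fintype.sum_prod_type, Fintype.sum_bool, splitMap, splitLaw, sum_add_distrib]
    simp only [if_true, Bool.false_eq_true, if_false, sum_ite_eq', mem_univ]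
    have e1 : ∀ w : Z, (∑ x, if w = z then 2 * δ i * p i x * (1 / 2) else 0)
        = δ i * if w = z then 1 else 0 := by
      intro w
      split_ifs
      · rw [← sum_mul, ← mul_sum, hp]; ring
      · simp
    rw [e1, e1]
    simp only [eq_comm (a := z)]
    ring
  simp_rw [h2] at h1
  rw [← h1, ← (Equiv.arrowProdEquivProdArrow ι (fun _ => Z × Bool) (fun _ => Bool)).symm.sum_comp,
    Fintype.sum_prod_type]
  refine sum_congr rfl fun ω _ => ?_
  rw [mul_sum, mul_sum]
  refine sum_congr rfl fun ε _ => ?_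
  simp only [Equiv.arrowProdEquivProdArrow, Equiv.coe_fn_symm_mk, prod_mul_distrib, prod_const,
    card_univ]
  ring

theorem splitLaw_nonneg [DecidableEq Z] {p : ι → Z → ℝ} (hp0 : ∀ i c, 0 ≤ p i c) {δ : ι → ℝ}
    (hδ : ∀ i, 0 ≤ δ i) {z₁ z₂ : Z} (hz : z₁ ≠ z₂) (h₁ : ∀ i, δ i ≤ p i z₁)
    (h₂ : ∀ i, δ i ≤ p i z₂) (i : ι) (ω : Z × Bool) : 0 ≤ splitLaw p δ z₁ z₂ i ω := by
  obtain ⟨c, b⟩ := ω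
  cases b
  · simp only [splitLaw, Bool.false_eq_true, if_false]
    by_cases e1 : c = z₁
    · subst e1; simp [hz, h₁ i]
    · by_cases e2 : c = z₂
      · subst e2; simp [hz.symm, h₂ i]
      · simp [e1, e2, hp0]
  · simp only [splitLaw, if_true]
    exact mul_nonneg (mul_nonneg two_pos.le (hδ i)) (hp0 i c)

theorem sum_splitLaw [DecidableEq Z] {p : ι → Z → ℝ} (hp : ∀ i, ∑ c, p i c = 1) (δ : ι → ℝ)
    (z₁ z₂ : Z) (i : ι) : ∑ ω, splitLaw p δ z₁ z₂ i ω = 1 := by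
  simp only [Fintype.sum_prod_type, Fintype.sum_bool, splitLaw, sum_add_distrib, if_true,
    Bool.false_eq_true, if_false, sum_sub_distrib, ← mul_sum, hp, sum_ite_eq', mem_univ]
  ring

/-- The number of coin sequences with a given number of successes on a subset. -/
theorem card_filter_coins (T : Finset ι) (j : ℕ) :
    #{ε : ι → Bool | #{i ∈ T | ε i} = j} = (#T).choose j * 2 ^ (Fintype.card ι - #T) := by
  have e : #{ε : ι → Bool | #{i ∈ T | ε i} = j} = #(T.powersetCard j ×ˢ Tᶜ.powerset) := by
    refine card_bij' (fun ε _ => ({i ∈ T | ε i}, {i ∈ Tᶜ | ε i}))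
      (fun A _ => fun i => decide (i ∈ A.1 ∪ A.2)) ?_ ?_ ?_ ?_
    · intro ε hε
      simp only [mem_filter, mem_univ, true_and] at hε
      simp [mem_powersetCard, hε]
    · rintro ⟨A, B⟩ hAB
      simp only [mem_product, mem_powersetCard, mem_powerset] at hAB
      obtain ⟨⟨hA, rfl⟩, hB⟩ := hAB
      simp only [mem_filter, mem_univ, true_and]
      congr 1
      ext i
      simp only [mem_filter, mem_union, decide_eq_true_eq]
      constructor
      · rintro ⟨hi, h | h⟩
        · exact h
        · exact absurd hi (mem_compl.1 (hB h))
      · exact fun h => ⟨hA h, Or.inl h⟩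
    · intro ε _
      funext i
      simp only [mem_union, mem_filter, mem_compl]
      by_cases hi : i ∈ T <;> simp [hi]
    · rintro ⟨A, B⟩ hAB
      simp only [mem_product, mem_powersetCard, mem_powerset] at hAB
      obtain ⟨⟨hA, rfl⟩, hB⟩ := hAB
      ext i
      · simp only [mem_filter, mem_union, decide_eq_true_eq]
        constructor
        · rintro ⟨hi, h | h⟩
          · exact h
          · exact absurd hi (mem_compl.1 (hB h))
        · exact fun h => ⟨hA h, Or.inl h⟩
      · simp only [mem_filter, mem_union, decide_eq_true_eq]
        constructor
        · rintro ⟨hi, h | h⟩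
          · exact absurd (hA h) (mem_compl.1 hi)
          · exact h
        · exact fun h => ⟨hB h, Or.inr h⟩
  rw [e, card_product, card_powersetCard, card_powerset, card_compl]

theorem coin_prob (T : Finset ι) (j : ℕ) :
    (1 / 2 : ℝ) ^ Fintype.card ι * #{ε : ι → Bool | #{i ∈ T | ε i} = j} =
      (#T).choose j / 2 ^ #T := by
  rw [card_filter_coins]
  have h : #T ≤ Fintype.card ι := card_le_univ T
  obtain ⟨d, hd⟩ := Nat.exists_eq_add_of_le h
  rw [hd, Nat.add_sub_cancel_left]
  push_cast
  rw [pow_add, one_div, inv_pow, inv_pow]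
  field_simp

/-- A sum along a split sequence: a base value plus the step times the number of successes. -/
theorem sum_splitMap (f : ι → Z → ℝ) {z₁ z₂ : Z} {Δ : ℝ} (ω : ι → Z × Bool)
    (hf : ∀ i, (ω i).2 = true → f i z₂ = f i z₁ + Δ) (ε : ι → Bool) :
    ∑ i, f i (splitMap z₁ z₂ (ω i, ε i)) =
      (∑ i, f i (if (ω i).2 then z₁ else (ω i).1)) +
        Δ * #{i ∈ ({i | (ω i).2 = true} : Finset ι) | ε i} := by
  rw [filter_filter, card_filter]
  push_cast
  rw [mul_sum, ← sum_add_distrib]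
  refine sum_congr rfl fun i _ => ?_
  simp only [splitMap]
  by_cases hb : (ω i).2 = true
  · cases hε : ε i <;> simp [hb, hf i hb]
  · simp [hb]

end ProductLaw

/-! ### Central binomial estimates and upper bounds on concentration functions. -/

namespace ProductLaw

open Finset

/-- The squared form stays in the integers, and the recursion for central binomial coefficients
reduces the induction to `(2m+1)(2m+3) ≤ 4(m+1)²`. -/
theorem centralBinom_sq_mul_le (m : ℕ) : m.centralBinom ^ 2 * (2 * m + 1) ≤ 16 ^ m := by
  induction m with
  | zero => simp
  | succ m ih =>
    have h := Nat.succ_mul_centralBinom_succ m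
    have h2 : (m + 1) ^ 2 * ((m + 1).centralBinom ^ 2 * (2 * (m + 1) + 1)) ≤
        (m + 1) ^ 2 * 16 ^ (m + 1) := by
      calc (m + 1) ^ 2 * ((m + 1).centralBinom ^ 2 * (2 * (m + 1) + 1))
          = ((m + 1) * (m + 1).centralBinom) ^ 2 * (2 * m + 3) := by ring
        _ = 4 * ((2 * m + 1) * (2 * m + 3)) * (m.centralBinom ^ 2 * (2 * m + 1)) := by rw [h]; ring
        _ ≤ 4 * (4 * (m + 1) ^ 2) * 16 ^ m :=
            Nat.mul_le_mul (Nat.mul_le_mul_left _ (by nlinarith)) ih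
        _ = _ := by ring
    exact Nat.le_of_mul_le_mul_left h2 (by positivity)

theorem le_centralBinom_sq_mul (m : ℕ) : 16 ^ m ≤ m.centralBinom ^ 2 * (4 * m + 1) := by
  induction m with
  | zero => simp
  | succ m ih =>
    have h := Nat.succ_mul_centralBinom_succ m
    have h2 : (m + 1) ^ 2 * (4 * m + 1) * 16 ^ (m + 1) ≤
        (m + 1) ^ 2 * (4 * m + 1) * ((m + 1).centralBinom ^ 2 * (4 * (m + 1) + 1)) := by
      calc (m + 1) ^ 2 * (4 * m + 1) * 16 ^ (m + 1)
          = 16 * (m + 1) ^ 2 * (4 * m + 1) * 16 ^ m := by ring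
        _ ≤ 4 * ((2 * m + 1) ^ 2 * (4 * m + 5)) * (m.centralBinom ^ 2 * (4 * m + 1)) := by
            exact Nat.mul_le_mul (by nlinarith) ih
        _ = (2 * (2 * m + 1) * m.centralBinom) ^ 2 * (4 * m + 5) * (4 * m + 1) := by ring
        _ = _ := by rw [← h]; ring
    exact Nat.le_of_mul_le_mul_left h2 (by positivity)

theorem two_mul_choose_middle_odd (m : ℕ) :
    2 * (2 * m + 1).choose m = (m + 1).centralBinom := by
  rw [Nat.centralBinom, show 2 * (m + 1) = 2 * m + 1 + 1 by ring, Nat.choose_succ_succ,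
    ← Nat.choose_symm_half m]
  ring

theorem choose_middle_sq_mul_le (n : ℕ) : n.choose (n / 2) ^ 2 * (n + 1) ≤ 4 ^ n := by
  rcases Nat.even_or_odd' n with ⟨m, rfl | rfl⟩
  · have := centralBinom_sq_mul_le m
    rw [Nat.mul_div_cancel_left m two_pos, pow_mul]
    exact this
  · have h := centralBinom_sq_mul_le (m + 1)
    rw [← two_mul_choose_middle_odd] at h
    rw [show (2 * m + 1) / 2 = m by omega]
    have e : (4 : ℕ) ^ (2 * m + 1) = 4 * 16 ^ m := by rw [pow_succ, pow_mul]; norm_num; ring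
    rw [e]
    rw [pow_succ 16] at h
    nlinarith

theorem le_choose_middle_sq_mul (n : ℕ) : 4 ^ n ≤ n.choose (n / 2) ^ 2 * (2 * n + 3) := by
  rcases Nat.even_or_odd' n with ⟨m, rfl | rfl⟩
  · have := le_centralBinom_sq_mul m
    rw [Nat.mul_div_cancel_left m two_pos, pow_mul]
    refine this.trans ?_
    exact Nat.mul_le_mul_left _ (by omega)
  · have h := le_centralBinom_sq_mul (m + 1)
    rw [← two_mul_choose_middle_odd] at h
    rw [show (2 * m + 1) / 2 = m by omega]
    have e : (4 : ℕ) ^ (2 * m + 1) = 4 * 16 ^ m := by rw [pow_succ, pow_mul]; norm_num; ring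
    rw [e]
    rw [pow_succ 16] at h
    nlinarith

theorem choose_div_two_pow_le (n j : ℕ) :
    (n.choose j : ℝ) / 2 ^ n ≤ (1 + (n : ℝ)) ^ (-(1 / 2) : ℝ) := by
  have h1 : (n.choose j : ℝ) ≤ n.choose (n / 2) := by exact_mod_cast Nat.choose_le_middle j n
  have h2 : (n.choose (n / 2) : ℝ) ^ 2 * (n + 1) ≤ 4 ^ n := by
    exact_mod_cast choose_middle_sq_mul_le n
  rw [Real.rpow_neg (by positivity), ← Real.sqrt_eq_rpow, div_le_iff₀ (by positivity),
    inv_mul_eq_div, le_div_iff₀ (by positivity)]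
  refine le_of_sq_le_sq ?_ (by positivity)
  rw [mul_pow, Real.sq_sqrt (by positivity), ← pow_mul, mul_comm n 2, pow_mul]
  norm_num
  calc (n.choose j : ℝ) ^ 2 * (1 + n) ≤ (n.choose (n / 2) : ℝ) ^ 2 * (n + 1) := by
        rw [add_comm]; gcongr
    _ ≤ _ := h2

/-- Moving one step away from the middle multiplies the coefficient by `(j+1)/(n-j)`, which is at
least `1 - 2D/(m+2)` with `m = n / 2` as long as the distance stays below `D`. Fixing `D` gives
every step the same factor. -/
theorem choose_middle_sub_ge (n d : ℕ) (hd : d ≤ n / 2) (D : ℝ) (hD : (d : ℝ) ≤ D)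
    (hD2 : 2 * D ≤ (n / 2 : ℕ) + 2) :
    (n.choose (n / 2) : ℝ) * (1 - 2 * D / ((n / 2 : ℕ) + 2)) ^ d ≤ n.choose (n / 2 - d) := by
  have hx0 : 0 ≤ 1 - 2 * D / ((n / 2 : ℕ) + 2 : ℝ) := by
    rw [sub_nonneg, div_le_one (by positivity)]; exact hD2
  induction d with
  | zero => simp
  | succ d ih =>
    have ih' := ih (by omega) (by push_cast at hD; linarith)
    obtain ⟨j, hj⟩ : ∃ j, n / 2 - d = j + 1 := ⟨n / 2 - d - 1, by omega⟩
    have hj2 : n / 2 - (d + 1) = j := by omega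
    rw [hj] at ih'
    rw [hj2]
    have hrec : (n.choose (j + 1) : ℝ) * (j + 1) = n.choose j * (n - j) := by
      have h := Nat.choose_succ_right_eq n j
      have hjn : j ≤ n := by omega
      rw [← Nat.cast_sub hjn]
      exact_mod_cast h
    set m : ℝ := ((n / 2 : ℕ) : ℝ) with hm
    have hmj : (j : ℝ) + 1 = m - d := by
      have : j + 1 + d = n / 2 := by omega
      rw [hm, ← this]; push_cast; ring
    have hnm : (n : ℝ) ≤ 2 * m + 1 := by
      have : n ≤ 2 * (n / 2) + 1 := by omega
      rw [hm]; exact_mod_cast this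
    have hm0 : 0 ≤ m := by positivity
    push_cast at hD
    have hd0 : (0 : ℝ) ≤ d := by positivity
    have hpos : (0 : ℝ) < n - j := by
      have : j < n := by omega
      rw [sub_pos]; exact_mod_cast this
    have hratio : (1 - 2 * D / (m + 2)) * (n - j) ≤ j + 1 := by
      have h1 : (n : ℝ) - j ≤ m + 2 + d := by linarith
      have hj0 : (0 : ℝ) ≤ j := by positivity
      calc (1 - 2 * D / (m + 2)) * (n - j) ≤ (1 - 2 * D / (m + 2)) * (m + 2 + d) := by gcongr
        _ ≤ m - d := by
          have e : (1 - 2 * D / (m + 2)) * (m + 2 + d) = m + 2 + d - 2 * D - 2 * D * d / (m + 2) := by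
            field_simp; ring
          have : 0 ≤ 2 * D * d / (m + 2) := by
            have : 0 ≤ D := by linarith
            positivity
          rw [e]; linarith
        _ = _ := hmj.symm
    have h3 : (n.choose (j + 1) : ℝ) * (1 - 2 * D / (m + 2)) * (n - j) ≤ n.choose j * (n - j) := by
      rw [← hrec, mul_assoc]
      gcongr
    have h4 := le_of_mul_le_mul_right h3 hpos
    calc _ = (n.choose (n / 2) : ℝ) * (1 - 2 * D / (m + 2)) ^ d * (1 - 2 * D / (m + 2)) := by
          rw [pow_succ]; ring
      _ ≤ _ := (mul_le_mul_of_nonneg_right ih' hx0).trans h4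

/-- A local lower bound for symmetric binomial probabilities. -/
theorem le_choose_div_two_pow {B : ℝ} (hB : 0 ≤ B) {n j : ℕ} (hn : 16 * (B + 1) ≤ √n)
    (hj : |(j : ℝ) - n / 2| ≤ B * √n) :
    Real.exp (-(16 * (B + 1) ^ 2)) / 3 / √n ≤ n.choose j / 2 ^ n := by
  have hs : 1 ≤ √(n : ℝ) := by linarith
  have hsq : √(n : ℝ) ^ 2 = n := Real.sq_sqrt (by positivity)
  set s := √(n : ℝ) with hsdef
  have hm1 : (n : ℝ) ≤ 2 * ((n / 2 : ℕ) : ℝ) + 1 := by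
    have : n ≤ 2 * (n / 2) + 1 := by omega
    exact_mod_cast this
  have hm2 : 2 * ((n / 2 : ℕ) : ℝ) ≤ n := by
    have : 2 * (n / 2) ≤ n := by omega
    exact_mod_cast this
  obtain ⟨hj1, hj2⟩ := abs_le.1 hj
  have hjn : j ≤ n := by
    have : (j : ℝ) ≤ n := by nlinarith
    exact_mod_cast this
  -- Symmetry of the binomial coefficients brings `j` to the left of the middle.
  obtain ⟨d, hd, hdD, hch⟩ : ∃ d, d ≤ n / 2 ∧ (d : ℝ) ≤ (B + 1) * s ∧
      n.choose j = n.choose (n / 2 - d) := by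
    by_cases hc : j ≤ n / 2
    · refine ⟨n / 2 - j, by omega, ?_, by congr 1; omega⟩
      rw [Nat.cast_sub hc]; nlinarith
    · refine ⟨n / 2 - (n - j), by omega, ?_, ?_⟩
      · rw [Nat.cast_sub (by omega), Nat.cast_sub hjn]; nlinarith
      · rw [← Nat.choose_symm hjn]; congr 1; omega
  have hD0 : 0 ≤ (B + 1) * s := by positivity
  have hx : 2 * ((B + 1) * s) / ((n / 2 : ℕ) + 2) ≤ 4 * (B + 1) / s := by
    rw [div_le_div_iff₀ (by positivity) (by positivity)]
    nlinarith
  have hx2 : 4 * (B + 1) / s ≤ 1 / 4 := by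
    rw [div_le_div_iff₀ (by positivity) (by positivity)]; linarith
  have hlow := choose_middle_sub_ge n d hd ((B + 1) * s) hdD (by
    have := hx.trans (hx2.trans (by norm_num : (1 / 4 : ℝ) ≤ 1))
    rwa [div_le_one (by positivity)] at this)
  set x := 2 * ((B + 1) * s) / (((n / 2 : ℕ) : ℝ) + 2)
  have hx0 : 0 ≤ x := by positivity
  have hexp : Real.exp (-(2 * x)) ≤ 1 - x := by
    have h1 : 1 + 2 * x ≤ Real.exp (2 * x) := by linarith [Real.add_one_le_exp (2 * x)]
    rw [Real.exp_neg, inv_le_comm₀ (Real.exp_pos _) (by linarith)]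
    refine le_trans ?_ h1
    rw [inv_le_iff_one_le_mul₀ (by linarith)]
    nlinarith
  have hpow : Real.exp (-(16 * (B + 1) ^ 2)) ≤ (1 - x) ^ d := by
    calc Real.exp (-(16 * (B + 1) ^ 2)) ≤ Real.exp (-(2 * x)) ^ d := by
          rw [← Real.exp_nat_mul]
          apply Real.exp_le_exp.2
          have : (d : ℝ) * (2 * x) ≤ (B + 1) * s * (2 * (4 * (B + 1) / s)) := by gcongr
          have e : (B + 1) * s * (2 * (4 * (B + 1) / s)) = 8 * (B + 1) ^ 2 := by field_simp; ring
          nlinarith [sq_nonneg (B + 1)]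
      _ ≤ _ := by gcongr
  have hmid : 2 ^ n / (3 * s) ≤ (n.choose (n / 2) : ℝ) := by
    have h := le_choose_middle_sq_mul n
    have h' : (4 : ℝ) ^ n ≤ (n.choose (n / 2) : ℝ) ^ 2 * (2 * n + 3) := by exact_mod_cast h
    rw [div_le_iff₀ (by positivity)]
    refine le_of_sq_le_sq ?_ (by positivity)
    rw [← pow_mul, mul_comm n 2, pow_mul, mul_pow, mul_pow, hsq]
    norm_num
    refine h'.trans ?_
    gcongr
    nlinarith
  rw [le_div_iff₀ (by positivity), hch]
  refine le_trans ?_ hlow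
  calc _ = 2 ^ n / (3 * s) * Real.exp (-(16 * (B + 1) ^ 2)) := by field_simp
    _ ≤ _ := by gcongr

variable {ι Z : Type*} [Fintype ι] [DecidableEq ι] [Fintype Z] [DecidableEq Z]

open Classical in
/-- Concentration function bound for sums of independent variables, those indexed by `S` having
two atoms at distance `Δ`. -/
theorem sum_prod_window_le {p : ι → Z → ℝ} (hp0 : ∀ i c, 0 ≤ p i c)
    (hp : ∀ i, ∑ c, p i c = 1) (f : ι → Z → ℝ) {z₁ z₂ : Z} (hz : z₁ ≠ z₂) {Δ : ℝ} (hΔ : 0 < Δ)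
    {δ : ℝ} (hδ : 0 < δ) (hδ2 : δ ≤ 1 / 2) (S : Finset ι)
    (h₁ : ∀ i ∈ S, δ ≤ p i z₁) (h₂ : ∀ i ∈ S, δ ≤ p i z₂)
    (hf : ∀ i ∈ S, f i z₂ = f i z₁ + Δ) (t : ℝ) :
    ∑ z : ι → Z, (∏ i, p i (z i)) *
        (if t ≤ ∑ i, f i (z i) ∧ ∑ i, f i (z i) < t + Δ then 1 else 0) ≤
      (3 / δ) ^ (1 / 2 : ℝ) * (1 + (#S : ℝ)) ^ (-(1 / 2) : ℝ) := by
  -- Coins are split off only on `S`; a pattern with a coin outside `S` has weight zero.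
  set δ' : ι → ℝ := fun i => if i ∈ S then δ else 0 with hδ'
  have hδ'0 : ∀ i, 0 ≤ δ' i := fun i => by simp only [hδ']; split_ifs <;> linarith
  have hq0 := splitLaw_nonneg hp0 hδ'0 hz
    (fun i => by simp only [hδ']; split_ifs with h; exacts [h₁ i h, hp0 i _])
    (fun i => by simp only [hδ']; split_ifs with h; exacts [h₂ i h, hp0 i _])
  have hq := sum_splitLaw hp δ' z₁ z₂
  rw [sum_prod_eq_splitLaw hp δ' z₁ z₂]
  have hmom := sum_prod_mul_rpow_neg_le hq0 hq (χ := fun _ ω => if ω.2 then 1 else 0)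
    (fun i c => by split_ifs <;> norm_num) (fun i c => by split_ifs <;> norm_num)
    (θ := 1 / 2) (by norm_num) (by norm_num)
  have hmean : ∀ i, ∑ c : Z × Bool, splitLaw p δ' z₁ z₂ i c * (if c.2 then 1 else 0) = 2 * δ' i := by
    intro i
    simp [Fintype.sum_prod_type, splitLaw, ← mul_sum, hp]
  simp_rw [hmean] at hmom
  have hS : ∑ i, 2 * δ' i = 2 * δ * #S := by
    rw [← mul_sum, ← sum_filter]; simp; ring
  rw [hS] at hmom
  -- The assumption `δ ≤ 1 / 2` enters here.
  have hfin : (6 / (1 + 2 * δ * (#S : ℝ))) ^ (1 / 2 : ℝ) ≤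
      (3 / δ) ^ (1 / 2 : ℝ) * (1 + (#S : ℝ)) ^ (-(1 / 2) : ℝ) := by
    rw [Real.rpow_neg (by positivity), ← Real.inv_rpow (by positivity),
      ← Real.mul_rpow (by positivity) (by positivity)]
    refine Real.rpow_le_rpow (by positivity) ?_ (by norm_num)
    rw [← div_eq_mul_inv, div_div, div_le_div_iff₀ (by positivity) (by positivity)]
    nlinarith
  refine le_trans (sum_le_sum fun ω _ => ?_) (hmom.trans hfin)
  by_cases hω : ∀ i, (ω i).2 = true → i ∈ S
  · refine mul_le_mul_of_nonneg_left ?_ (prod_nonneg fun i _ => hq0 i _)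
    set T : Finset ι := {i | (ω i).2 = true} with hT
    have hk : (∑ i, if (ω i).2 = true then (1 : ℝ) else 0) = #T := by
      rw [hT, card_filter]; push_cast; rfl
    rw [hk]
    simp_rw [sum_splitMap f ω (fun i hi => hf i (hω i hi))]
    set c := ∑ i, f i (if (ω i).2 then z₁ else (ω i).1)
    -- A half-open window of length `Δ` contains at most one point of the lattice `c + Δ ℤ`, so a
    -- single binomial probability bounds the conditional probability.
    by_cases hex : ∃ ε : ι → Bool, t ≤ c + Δ * #{i ∈ T | ε i} ∧ c + Δ * #{i ∈ T | ε i} < t + Δ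
    · obtain ⟨ε₀, h01, h02⟩ := hex
      refine le_trans ?_ (choose_div_two_pow_le (#T) (#{i ∈ T | ε₀ i}))
      rw [← coin_prob, sum_boole]
      gcongr with ε _
      rintro ⟨h1, h2⟩
      have e1 : ((#{i ∈ T | ε i} : ℕ) : ℝ) < #{i ∈ T | ε₀ i} + 1 := by
        nlinarith
      have e2 : ((#{i ∈ T | ε₀ i} : ℕ) : ℝ) < #{i ∈ T | ε i} + 1 := by
        nlinarith
      norm_cast at e1 e2
      omega
    · push Not at hex
      rw [sum_eq_zero]
      · rw [mul_zero]; positivity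
      · intro ε _
        rw [if_neg]
        rintro ⟨h1, h2⟩
        exact absurd h2 (not_lt.2 (hex ε h1))
  · push Not at hω
    obtain ⟨i, hi, hiS⟩ := hω
    rw [prod_eq_zero (mem_univ i) (by simp [splitLaw, hi, hδ', hiS]), zero_mul, zero_mul]

theorem summable_exp_neg_abs {a : ℝ} (ha : 0 < a) :
    Summable fun j : ℤ => Real.exp (-a * |(j : ℝ)|) := by
  have h : Summable fun n : ℕ => Real.exp (-a * n) := by
    simpa [mul_comm] using Real.summable_exp_nat_mul_iff.2 (neg_lt_zero.2 ha)
  refine Summable.of_nat_of_neg ?_ ?_ <;> simpa using h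

open Classical in
/-- A window bound controls two-sided exponential moments. -/
theorem sum_mul_exp_neg_abs_le {Ω : Type*} [Fintype Ω] {p : Ω → ℝ} (hp : ∀ z, 0 ≤ p z)
    (L : Ω → ℝ) {Δ κ a : ℝ} (hΔ : 0 < Δ) (ha : 0 < a)
    (hκ : ∀ t, ∑ z, p z * (if t ≤ L z ∧ L z < t + Δ then 1 else 0) ≤ κ) (t : ℝ) :
    ∑ z, p z * Real.exp (-a * |L z - t|) ≤
      κ * (Real.exp (a * Δ) * ∑' j : ℤ, Real.exp (-(a * Δ) * |(j : ℝ)|)) := by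
  -- The line is cut into windows of length `Δ`, each of mass at most `κ`; the exponential weights
  -- then sum as a geometric series. Rounding to the window costs the factor `exp (a * Δ)`.
  set j : Ω → ℤ := fun z => ⌊(L z - t) / Δ⌋ with hj
  have hκ0 : 0 ≤ κ := le_trans (sum_nonneg fun z _ => mul_nonneg (hp z) (by split_ifs <;> norm_num))
    (hκ 0)
  have hpt : ∀ z, Real.exp (-a * |L z - t|) ≤
      Real.exp (a * Δ) * Real.exp (-(a * Δ) * |(j z : ℝ)|) := by
    intro z
    rw [← Real.exp_add]
    apply Real.exp_le_exp.2
    have h1 : |(j z : ℝ)| ≤ |(L z - t) / Δ| + 1 := by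
      have h3 := Int.floor_le ((L z - t) / Δ)
      have h4 := Int.lt_floor_add_one ((L z - t) / Δ)
      rw [abs_le]
      constructor
      · have := neg_abs_le ((L z - t) / Δ); linarith
      · have := le_abs_self ((L z - t) / Δ); linarith
    rw [abs_div, abs_of_pos hΔ, div_add_one hΔ.ne', le_div_iff₀ hΔ] at h1
    nlinarith
  have hwin : ∀ k : ℤ, ∑ z with j z = k, p z ≤ κ := by
    intro k
    refine le_trans (le_of_eq ?_) (hκ (t + k * Δ))
    rw [sum_filter]
    refine sum_congr rfl fun z _ => ?_
    have : j z = k ↔ t + k * Δ ≤ L z ∧ L z < t + k * Δ + Δ := by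
      rw [hj, Int.floor_eq_iff, le_div_iff₀ hΔ, div_lt_iff₀ hΔ]
      constructor <;> rintro ⟨h1, h2⟩ <;> constructor <;> linarith
    simp [this]
  calc ∑ z, p z * Real.exp (-a * |L z - t|)
      ≤ ∑ z, p z * (Real.exp (a * Δ) * Real.exp (-(a * Δ) * |(j z : ℝ)|)) :=
        sum_le_sum fun z _ => mul_le_mul_of_nonneg_left (hpt z) (hp z)
    _ = ∑ k ∈ univ.image j, ∑ z with j z = k,
          p z * (Real.exp (a * Δ) * Real.exp (-(a * Δ) * |(j z : ℝ)|)) := by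
        rw [sum_fiberwise_of_maps_to]
        exact fun z _ => mem_image_of_mem _ (mem_univ z)
    _ = ∑ k ∈ univ.image j, (∑ z with j z = k, p z) *
          (Real.exp (a * Δ) * Real.exp (-(a * Δ) * |(k : ℝ)|)) := by
        refine sum_congr rfl fun k _ => ?_
        rw [sum_mul]
        refine sum_congr rfl fun z hz => ?_
        rw [(mem_filter.1 hz).2]
    _ ≤ ∑ k ∈ univ.image j, κ * (Real.exp (a * Δ) * Real.exp (-(a * Δ) * |(k : ℝ)|)) :=
        sum_le_sum fun k _ => mul_le_mul_of_nonneg_right (hwin k) (by positivity)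
    _ = κ * (Real.exp (a * Δ) * ∑ k ∈ univ.image j, Real.exp (-(a * Δ) * |(k : ℝ)|)) := by
        rw [mul_sum, mul_sum]
    _ ≤ _ := by
        gcongr
        exact (summable_exp_neg_abs (mul_pos ha hΔ)).sum_le_tsum _ fun _ _ => (Real.exp_pos _).le

end ProductLaw

/-! ### Local lower bounds for i.i.d. sums near the mean. -/

namespace ProductLaw

open Finset

variable {ι Z : Type*} [Fintype ι] [DecidableEq ι] [Fintype Z] [DecidableEq Z]

open Classical in
/-- Coin flips realize a window of length `Δ` near the centre with probability at least of the
order of the inverse square root of the number of coins. -/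
theorem coin_window_ge {T : Finset ι} {B Δ b t : ℝ} (hB : 0 ≤ B) (hΔ : 0 < Δ)
    (hT : 16 * ((B / Δ + 1) + 1) ≤ √(#T : ℝ)) (ht : |t - (b + Δ * #T / 2)| ≤ B * √(#T : ℝ)) :
    Real.exp (-(16 * ((B / Δ + 1) + 1) ^ 2)) / 3 / √(#T : ℝ) ≤
      (1 / 2 : ℝ) ^ Fintype.card ι * ∑ ε : ι → Bool,
        (if t < b + Δ * #{i ∈ T | ε i} ∧ b + Δ * #{i ∈ T | ε i} ≤ t + Δ then 1 else 0) := by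
  set k : ℝ := (#T : ℝ) with hk
  -- The only integer with `t < b + Δ j' ≤ t + Δ`. The rounding is absorbed by the `+ 1` in `B / Δ +
  -- 1`.
  set j' : ℤ := ⌊(t - b) / Δ⌋ + 1 with hj'
  have h1 := Int.floor_le ((t - b) / Δ)
  have h2 := Int.lt_floor_add_one ((t - b) / Δ)
  have hB1 : 0 ≤ B / Δ := by positivity
  have hs1 : 1 ≤ √k := by linarith
  have hsq : √k ^ 2 = k := Real.sq_sqrt (by positivity)
  have ht' : |(t - b) / Δ - k / 2| ≤ B / Δ * √k := by
    have : (t - b) / Δ - k / 2 = (t - (b + Δ * k / 2)) / Δ := by field_simp; ring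
    rw [this, abs_div, abs_of_pos hΔ, div_mul_eq_mul_div]
    gcongr
  obtain ⟨h3, h4⟩ := abs_le.1 ht'
  have hjr : ((j' : ℤ) : ℝ) = ⌊(t - b) / Δ⌋ + 1 := by rw [hj']; push_cast; ring
  have hjabs : |(j' : ℝ) - k / 2| ≤ (B / Δ + 1) * √k := by
    rw [hjr, abs_le]
    constructor <;> nlinarith
  have hj0 : 0 ≤ j' := by
    have : (0 : ℝ) ≤ j' := by
      have := (abs_le.1 hjabs).1
      nlinarith
    exact_mod_cast this
  obtain ⟨j, hj⟩ := Int.eq_ofNat_of_zero_le hj0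
  rw [hj, Int.cast_natCast] at hjr hjabs
  refine (le_choose_div_two_pow (by positivity) hT hjabs).trans ?_
  rw [← coin_prob, sum_boole]
  gcongr with ε _
  intro hε
  rw [hε]
  have h5 : (j : ℝ) * Δ ≤ (t - b) + Δ := by
    rw [hjr, add_mul, one_mul]
    have := (le_div_iff₀ hΔ).1 h1
    linarith
  have h6 : (t - b) < j * Δ := by
    rw [hjr]; exact (div_lt_iff₀ hΔ).1 h2
  constructor <;> linarith

theorem sum_mul_affine {Ω : Type*} [Fintype Ω] {P : Ω → ℝ} (hP : ∑ ω, P ω = 1) (A A' : Ω → ℝ)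
    (K u v : ℝ) : ∑ ω, P ω * (K * (1 - A ω / u - A' ω / v)) =
      K * (1 - (∑ ω, P ω * A ω) / u - (∑ ω, P ω * A' ω) / v) := by
  have : ∀ ω, P ω * (K * (1 - A ω / u - A' ω / v)) =
      K * (P ω - P ω * A ω / u - P ω * A' ω / v) := fun ω => by ring
  simp_rw [this]
  rw [← mul_sum, sum_sub_distrib, sum_sub_distrib, hP, sum_div, sum_div]

set_option maxHeartbeats 800000 in
open Classical in
/-- A local lower bound for sums of i.i.d. variables having two atoms at distance `Δ`: every
half-open window of length `Δ` within `O(√N)` of the mean has probability of order at least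
`1 / √N`. -/
theorem exists_window_ge {p : Z → ℝ} (hp0 : ∀ c, 0 ≤ p c) (hp : ∑ c, p c = 1) (f : Z → ℝ)
    {z₁ z₂ : Z} {Δ : ℝ} (hΔ : 0 < Δ) (hf : f z₂ = f z₁ + Δ)
    (h₁ : 0 < p z₁) (h₂ : 0 < p z₂) {B : ℝ} (hB : 0 ≤ B) :
    ∃ c : ℝ, 0 < c ∧ ∃ N₀ : ℕ, ∀ N : ℕ, N₀ ≤ N → ∀ t : ℝ, |t - N * ∑ z, p z * f z| ≤ B * √N →
      c / √N ≤ ∑ z : Fin N → Z, (∏ i, p (z i)) *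
        (if t < ∑ i, f (z i) ∧ ∑ i, f (z i) ≤ t + Δ then 1 else 0) := by
  have hz : z₁ ≠ z₂ := by rintro rfl; linarith
  set μ := ∑ z, p z * f z with hμ
  set δ := min (p z₁) (p z₂) with hδ
  have hδ0 : 0 < δ := lt_min h₁ h₂
  set q := splitLaw (fun _ : Unit => p) (fun _ => δ) z₁ z₂ () with hqdef
  have hq0 : ∀ ω, 0 ≤ q ω := splitLaw_nonneg (fun _ => hp0) (fun _ => hδ0.le) hz
    (fun _ => min_le_left _ _) (fun _ => min_le_right _ _) ()
  have hq : ∑ ω, q ω = 1 := sum_splitLaw (fun _ => hp) _ z₁ z₂ ()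
  set χ : Z × Bool → ℝ := fun ω => if ω.2 then 1 else 0 with hχ
  -- The conditional mean of `f` given the split coordinate. The sum of these is the centre of the
  -- conditional binomial law.
  set φ : Z × Bool → ℝ := fun ω => if ω.2 then f z₁ + Δ / 2 else f ω.1 with hφ
  have hmχ : ∑ ω, q ω * χ ω = 2 * δ := by
    simp [hχ, hqdef, Fintype.sum_prod_type, splitLaw, ← mul_sum, hp]
  have hmφ : ∑ ω, q ω * φ ω = μ := by
    simp only [hφ, hqdef, Fintype.sum_prod_type, Fintype.sum_bool, splitLaw, if_true,
      Bool.false_eq_true, if_false, sum_add_distrib, sub_mul, sum_sub_distrib, ← sum_mul,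
      ← mul_sum, hp, mul_add, add_mul, mul_ite, ite_mul, mul_one, mul_zero, zero_mul,
      sum_ite_eq', mem_univ]
    rw [hf]; ring
  set σ := ∑ ω, q ω * φ ω ^ 2 with hσ
  have hσ0 : 0 ≤ σ := sum_nonneg fun ω _ => mul_nonneg (hq0 ω) (sq_nonneg _)
  -- Chosen so that the centre misses its mean by `B' √N` with probability at most `1 / 4`.
  set B' := 2 * √(σ + 1) with hB'
  have hB'0 : 0 < B' := by positivity
  have hB'sq : B' ^ 2 = 4 * (σ + 1) := by
    rw [hB', mul_pow, Real.sq_sqrt (by positivity)]; norm_num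
  clear_value B'
  -- Deviations of order `√N` are re-expressed in units of the square root of the number of coins,
  -- which is at least `√(δ N)` on the good event.
  set B'' := (B + B') / √δ with hB''
  have hB''0 : 0 ≤ B'' := by positivity
  clear_value B''
  set c₀ := Real.exp (-(16 * ((B'' / Δ + 1) + 1) ^ 2)) / 3 with hc₀
  have hc₀0 : 0 < c₀ := by positivity
  clear_value c₀
  refine ⟨c₀ / 2, by positivity,
    ⌈8 / δ⌉₊ + ⌈(16 * ((B'' / Δ + 1) + 1)) ^ 2 / δ⌉₊ + 1, fun N hN t ht => ?_⟩
  have hN1 : 8 / δ ≤ N := by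
    refine (Nat.le_ceil _).trans ?_
    exact_mod_cast (by omega : ⌈8 / δ⌉₊ ≤ N)
  have hN2 : (16 * ((B'' / Δ + 1) + 1)) ^ 2 / δ ≤ N := by
    refine (Nat.le_ceil _).trans ?_
    exact_mod_cast (by omega : ⌈(16 * ((B'' / Δ + 1) + 1)) ^ 2 / δ⌉₊ ≤ N)
  have hN3 : (1 : ℝ) ≤ N := by exact_mod_cast (by omega : 1 ≤ N)
  rw [div_le_iff₀ hδ0] at hN1 hN2
  have hq' : splitLaw (fun _ : Fin N => p) (fun _ => δ) z₁ z₂ = fun _ => q := by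
    funext i ω; simp [hqdef, splitLaw]
  rw [sum_prod_eq_splitLaw (p := fun _ : Fin N => p) (fun _ => hp) (fun _ => δ) z₁ z₂, hq']
  have hv1 := sum_prod_mul_sq_sub_le (ι := Fin N) (p := fun _ => q) (fun _ => hq) (fun _ => χ)
  have hv2 := sum_prod_mul_sq_sub_le (ι := Fin N) (p := fun _ => q) (fun _ => hq) (fun _ => φ)
  have hχ2 : ∑ ω, q ω * χ ω ^ 2 = 2 * δ := by
    rw [← hmχ]
    refine sum_congr rfl fun ω _ => ?_
    simp only [hχ]; split_ifs <;> simp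
  simp only [hmχ, hmφ, hχ2, ← hσ, sum_const, card_univ, Fintype.card_fin, nsmul_eq_mul] at hv1 hv2
  -- The good event asks for at least `δ N` coins, half of the expected number, and a centre within
  -- `B' √N` of its mean. Off it one of the subtracted squares is at least `1`, so the left side is
  -- nonpositive. In expectation each square costs at most `1 / 4`, which leaves `c₀ / 2`.
  have hpt : ∀ ω : Fin N → Z × Bool,
      c₀ / √N * (1 - (∑ i, χ (ω i) - N * (2 * δ)) ^ 2 / (δ * N) ^ 2
        - (∑ i, φ (ω i) - N * μ) ^ 2 / (B' ^ 2 * N)) ≤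
      (1 / 2 : ℝ) ^ Fintype.card (Fin N) * ∑ ε : Fin N → Bool,
        (if t < ∑ i, f (splitMap z₁ z₂ (ω i, ε i)) ∧
          ∑ i, f (splitMap z₁ z₂ (ω i, ε i)) ≤ t + Δ then 1 else 0) := by
    intro ω
    by_cases hG : δ * N ≤ ∑ i, χ (ω i) ∧ |∑ i, φ (ω i) - N * μ| ≤ B' * √N
    · obtain ⟨hG1, hG2⟩ := hG
      set T : Finset (Fin N) := {i | (ω i).2 = true} with hT
      have hk : ∑ i, χ (ω i) = #T := by
        rw [hT, card_filter]; push_cast; rfl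
      rw [hk] at hG1
      have hkN : (#T : ℝ) ≤ N := by
        have := card_le_univ T
        rw [Fintype.card_fin] at this
        exact_mod_cast this
      have hsplit := sum_splitMap (fun _ : Fin N => f) (z₁ := z₁) (z₂ := z₂) ω (fun i _ => hf)
      simp_rw [hsplit]
      set b := ∑ i, f (if (ω i).2 then z₁ else (ω i).1) with hb
      have hbφ : b + Δ * #T / 2 = ∑ i, φ (ω i) := by
        rw [← hk, hb, mul_div_right_comm, mul_sum, ← sum_add_distrib]
        refine sum_congr rfl fun i _ => ?_
        simp only [hχ, hφ]
        split_ifs <;> ring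
      have hsk : √δ * √N ≤ √(#T : ℝ) := by
        rw [← Real.sqrt_mul hδ0.le]; exact Real.sqrt_le_sqrt hG1
      have hkpos : (0 : ℝ) < √(#T : ℝ) := by
        refine lt_of_lt_of_le (by positivity) hsk
      have hcond : 16 * ((B'' / Δ + 1) + 1) ≤ √(#T : ℝ) := by
        refine Real.le_sqrt_of_sq_le ?_
        linarith
      have hcent : |t - (b + Δ * #T / 2)| ≤ B'' * √(#T : ℝ) := by
        rw [hbφ]
        calc |t - ∑ i, φ (ω i)| ≤ |t - N * μ| + |∑ i, φ (ω i) - N * μ| := by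
              have := abs_sub (t - N * μ) (∑ i, φ (ω i) - N * μ)
              simpa using this
          _ ≤ B * √N + B' * √N := add_le_add ht hG2
          _ = B'' * (√δ * √N) := by rw [hB'']; field_simp
          _ ≤ _ := by gcongr
      refine le_trans ?_ (coin_window_ge hB''0 hΔ hcond hcent)
      rw [← hc₀]
      calc _ ≤ c₀ / √N * 1 := by
            gcongr
            have : 0 ≤ (∑ i, χ (ω i) - N * (2 * δ)) ^ 2 / (δ * N) ^ 2 := by positivity
            have : 0 ≤ (∑ i, φ (ω i) - N * μ) ^ 2 / (B' ^ 2 * N) := by positivity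
            linarith
        _ = c₀ / √N := mul_one _
        _ ≤ c₀ / √(#T : ℝ) := by gcongr
    · refine le_trans (mul_nonpos_of_nonneg_of_nonpos (by positivity) ?_)
        (mul_nonneg (by positivity) (sum_nonneg fun _ _ => by split_ifs <;> norm_num))
      have h1 : 0 ≤ (∑ i, χ (ω i) - N * (2 * δ)) ^ 2 / (δ * N) ^ 2 := by positivity
      have h2 : 0 ≤ (∑ i, φ (ω i) - N * μ) ^ 2 / (B' ^ 2 * N) := by positivity
      rw [not_and_or] at hG
      rcases hG with hG | hG
      · push Not at hG
        have : 1 ≤ (∑ i, χ (ω i) - N * (2 * δ)) ^ 2 / (δ * N) ^ 2 := by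
          rw [one_le_div (by positivity)]
          have : 0 < δ * N := by positivity
          nlinarith
        linarith
      · push Not at hG
        have : 1 ≤ (∑ i, φ (ω i) - N * μ) ^ 2 / (B' ^ 2 * N) := by
          rw [one_le_div (by positivity), ← sq_abs (∑ i, φ (ω i) - N * μ)]
          have e : B' ^ 2 * N = (B' * √N) ^ 2 := by
            rw [mul_pow B', Real.sq_sqrt (Nat.cast_nonneg N)]
          rw [e]
          gcongr
        linarith
  refine le_trans ?_ (sum_le_sum fun ω _ =>
    mul_le_mul_of_nonneg_left (hpt ω) (prod_nonneg fun i _ => hq0 _))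
  rw [sum_mul_affine (sum_prod_eq_one (ι := Fin N) (p := fun _ => q) (fun _ => hq))]
  have hb1 : (∑ ω : Fin N → Z × Bool, (∏ i, q (ω i)) * (∑ i, χ (ω i) - N * (2 * δ)) ^ 2)
        / (δ * N) ^ 2 ≤ 1 / 4 := by
    rw [div_le_iff₀ (by positivity)]
    refine hv1.trans ?_
    nlinarith [mul_pos hδ0 (by linarith : (0 : ℝ) < N)]
  have hb2 : (∑ ω : Fin N → Z × Bool, (∏ i, q (ω i)) * (∑ i, φ (ω i) - N * μ) ^ 2)
        / (B' ^ 2 * N) ≤ 1 / 4 := by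
    rw [div_le_iff₀ (by positivity), hB'sq]
    refine hv2.trans ?_
    nlinarith
  calc c₀ / 2 / √N = c₀ / √N * (1 / 2) := by ring
    _ ≤ _ := by gcongr; linarith

end ProductLaw

/-! ### Gibbs' inequality, weak duality and the permutations given by symmetry. -/

namespace ChannelCoding

open Finset

section Gibbs

variable {ι : Type*} [Fintype ι]

theorem sub_lt_mul_log_div {p t : ℝ} (hp : 0 ≤ p) (ht : 0 ≤ t) (hpt : 0 < p → 0 < t)
    (hne : p ≠ t) : p - t < p * Real.log (p / t) := by
  rcases hp.eq_or_lt with rfl | hp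
  · simp; exact lt_of_le_of_ne ht hne
  · have ht' := hpt hp
    have h := Real.log_lt_sub_one_of_pos (div_pos ht' hp)
      (fun h => hne (by rw [div_eq_one_iff_eq hp.ne'] at h; exact h.symm))
    have e : Real.log (p / t) = -Real.log (t / p) := by rw [← Real.log_inv, inv_div]
    rw [e]
    have h2 := mul_lt_mul_of_pos_left h hp
    have e2 : p * (t / p - 1) = t - p := by field_simp
    linarith

theorem sub_le_mul_log_div {p t : ℝ} (hp : 0 ≤ p) (ht : 0 ≤ t) (hpt : 0 < p → 0 < t) :
    p - t ≤ p * Real.log (p / t) := by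
  by_cases h : p = t
  · subst h
    by_cases h0 : p = 0 <;> simp [h0]
  · exact (sub_lt_mul_log_div hp ht hpt h).le

/-- Gibbs' inequality. -/
theorem sum_mul_log_div_nonneg {p t : ι → ℝ} (hp : ∀ i, 0 ≤ p i) (ht : ∀ i, 0 ≤ t i)
    (hpt : ∀ i, 0 < p i → 0 < t i) (hle : ∑ i, t i ≤ ∑ i, p i) :
    0 ≤ ∑ i, p i * Real.log (p i / t i) := by
  have h := sum_le_sum fun i (_ : i ∈ univ) => sub_le_mul_log_div (hp i) (ht i) (hpt i)
  rw [sum_sub_distrib] at h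
  linarith

theorem sum_mul_log_div_pos {p t : ι → ℝ} (hp : ∀ i, 0 ≤ p i) (ht : ∀ i, 0 ≤ t i)
    (hpt : ∀ i, 0 < p i → 0 < t i) (hle : ∑ i, t i ≤ ∑ i, p i) (hne : ∃ i, p i ≠ t i) :
    0 < ∑ i, p i * Real.log (p i / t i) := by
  obtain ⟨i, hi⟩ := hne
  have h := sum_lt_sum (fun i (_ : i ∈ univ) => sub_le_mul_log_div (hp i) (ht i) (hpt i))
    ⟨i, mem_univ i, sub_lt_mul_log_div (hp i) (ht i) (hpt i) hi⟩
  rw [sum_sub_distrib] at h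
  linarith

end Gibbs

variable {X Y : Type*} [Fintype X] [Fintype Y]

theorem IsChannel.nonneg {W : X → Y → ℝ} (hW : IsChannel W) (x : X) (y : Y) : 0 ≤ W x y :=
  (hW x).1 y

theorem IsChannel.sum_eq_one {W : X → Y → ℝ} (hW : IsChannel W) (x : X) : ∑ y, W x y = 1 :=
  (hW x).2

/-- The quantity `∑ x, Q x * W x y ^ (1 / (1 + ρ))` in Gallager's function. -/
def tiltedOutput (W : X → Y → ℝ) (ρ : ℝ) (Q : X → ℝ) (y : Y) : ℝ :=
  ∑ x, Q x * W x y ^ (1 / (1 + ρ))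

/-- The sum whose negative logarithm is Gallager's function. -/
def gallagerSum (W : X → Y → ℝ) (ρ : ℝ) (Q : X → ℝ) : ℝ :=
  ∑ y, tiltedOutput W ρ Q y ^ (1 + ρ)

theorem gallagerFun_eq (W : X → Y → ℝ) (ρ : ℝ) (Q : X → ℝ) :
    gallagerFun W ρ Q = -Real.log (gallagerSum W ρ Q) := rfl

theorem tiltedOutput_nonneg {W : X → Y → ℝ} (hW : IsChannel W) (ρ : ℝ) {Q : X → ℝ}
    (hQ : ∀ x, 0 ≤ Q x) (y : Y) : 0 ≤ tiltedOutput W ρ Q y :=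
  sum_nonneg fun x _ => mul_nonneg (hQ x) (Real.rpow_nonneg (hW.nonneg x y) _)

theorem tiltedOutput_pos {W : X → Y → ℝ} (hW : IsChannel W) (ρ : ℝ) {Q : X → ℝ}
    (hQ : ∀ x, 0 ≤ Q x) {x : X} {y : Y} (hx : 0 < Q x) (hy : 0 < W x y) :
    0 < tiltedOutput W ρ Q y :=
  sum_pos' (fun x _ => mul_nonneg (hQ x) (Real.rpow_nonneg (hW.nonneg x y) _))
    ⟨x, mem_univ x, mul_pos hx (Real.rpow_pos_of_pos hy _)⟩

theorem IsChannel.exists_pos {W : X → Y → ℝ} (hW : IsChannel W) (x : X) : ∃ y, 0 < W x y := by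
  by_contra h
  push Not at h
  have h1 := hW.sum_eq_one x
  have : ∑ y, W x y ≤ 0 := sum_nonpos fun y _ => h y
  linarith

theorem gallagerSum_pos {W : X → Y → ℝ} (hW : IsChannel W) (ρ : ℝ) {Q : X → ℝ}
    (hQ : Q ∈ stdSimplex ℝ X) : 0 < gallagerSum W ρ Q := by
  obtain ⟨x, hx⟩ : ∃ x, 0 < Q x := by
    by_contra h
    push Not at h
    have : ∑ x, Q x ≤ 0 := sum_nonpos fun x _ => h x
    linarith [hQ.2]
  obtain ⟨y, hy⟩ := hW.exists_pos x
  exact sum_pos' (fun y _ => Real.rpow_nonneg (tiltedOutput_nonneg hW ρ hQ.1 y) _)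
    ⟨y, mem_univ y, Real.rpow_pos_of_pos (tiltedOutput_pos hW ρ hQ.1 hx hy) _⟩

theorem outputDist_pos {V : X → Y → ℝ} (hV : IsChannel V) {Q : X → ℝ} (hQ : ∀ x, 0 ≤ Q x)
    {x : X} {y : Y} (h : 0 < Q x * V x y) : 0 < outputDist Q V y :=
  sum_pos' (fun z _ => mul_nonneg (hQ z) (hV.nonneg z y)) ⟨x, mem_univ x, h⟩

/-- The joint law minimizing the Gallager functional. -/
def tiltedJoint (W : X → Y → ℝ) (ρ : ℝ) (Q : X → ℝ) (x : X) (y : Y) : ℝ :=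
  Q x * W x y ^ (1 / (1 + ρ)) * tiltedOutput W ρ Q y ^ ρ / gallagerSum W ρ Q

theorem rpow_mul_self {a ρ : ℝ} (ha : 0 ≤ a) (hρ : 0 ≤ ρ) : a * a ^ ρ = a ^ (1 + ρ) := by
  rw [Real.rpow_add' ha (by linarith), Real.rpow_one]

theorem sum_tiltedJoint (W : X → Y → ℝ) (hW : IsChannel W) {ρ : ℝ} (hρ : 0 ≤ ρ) {Q : X → ℝ}
    (hQ : Q ∈ stdSimplex ℝ X) : ∑ x, ∑ y, tiltedJoint W ρ Q x y = 1 := by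
  rw [sum_comm]
  have : ∀ y, ∑ x, tiltedJoint W ρ Q x y = tiltedOutput W ρ Q y ^ (1 + ρ) / gallagerSum W ρ Q := by
    intro y
    simp only [tiltedJoint]
    rw [← sum_div, ← sum_mul, ← rpow_mul_self (tiltedOutput_nonneg hW ρ hQ.1 y) hρ]
    rfl
  simp_rw [this]
  rw [← sum_div]
  exact div_self (gallagerSum_pos hW ρ hQ).ne'

theorem sum_sum_mul_channel {V : X → Y → ℝ} (hV : IsChannel V) {Q : X → ℝ}
    (hQ : Q ∈ stdSimplex ℝ X) : ∑ x, ∑ y, Q x * V x y = 1 := by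
  simp_rw [← mul_sum, hV.sum_eq_one, mul_one]
  exact hQ.2

/-- The gap in weak duality is a sum of two divergences of the joint law `Q V`: one from
`tiltedJoint`, and `ρ` times one from the law with the same output marginal and the tilted backward
channel. Terms of zero mass vanish; on the others all logarithms can be expanded. -/
theorem gallagerFun_decomp {W V : X → Y → ℝ} (hW : IsChannel W) (hV : IsChannel V) {Q : X → ℝ}
    (hQ : Q ∈ stdSimplex ℝ X) (hac : ∀ x, 0 < Q x → ∀ y, W x y = 0 → V x y = 0)
    {ρ : ℝ} (hρ : 0 ≤ ρ) :
    (∑ x, Q x * ∑ y, V x y * Real.log (V x y / W x y)) + ρ * mutualInfo Q V - gallagerFun W ρ Q =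
      ∑ i : X × Y, Q i.1 * V i.1 i.2 * Real.log (Q i.1 * V i.1 i.2 / tiltedJoint W ρ Q i.1 i.2) +
      ρ * ∑ i : X × Y, Q i.1 * V i.1 i.2 * Real.log (Q i.1 * V i.1 i.2 /
        (outputDist Q V i.2 * (Q i.1 * W i.1 i.2 ^ (1 / (1 + ρ))) / tiltedOutput W ρ Q i.2)) := by
  have h1 : gallagerFun W ρ Q = ∑ x, ∑ y, Q x * V x y * gallagerFun W ρ Q := by
    simp_rw [← sum_mul, sum_sum_mul_channel hV hQ, one_mul]
  rw [h1, mutualInfo, Fintype.sum_prod_type, Fintype.sum_prod_type, mul_sum, mul_sum,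
    ← sum_add_distrib, ← sum_sub_distrib, ← sum_add_distrib]
  refine sum_congr rfl fun x _ => ?_
  rw [mul_sum, mul_sum, mul_sum, ← sum_add_distrib, ← sum_sub_distrib, ← sum_add_distrib]
  refine sum_congr rfl fun y _ => ?_
  rcases (mul_nonneg (hQ.1 x) (hV.nonneg x y)).eq_or_lt with h0 | h0
  · rw [← h0, ← mul_assoc, ← h0]; ring
  · have hQx : 0 < Q x := pos_of_mul_pos_left h0 (hV.nonneg x y)
    have hVx : 0 < V x y := pos_of_mul_pos_right h0 (hQ.1 x)
    have hWx : 0 < W x y := lt_of_le_of_ne (hW.nonneg x y) fun h => hVx.ne' (hac x hQx y h.symm)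
    have hα := tiltedOutput_pos hW ρ hQ.1 hQx hWx
    have hq := outputDist_pos hV hQ.1 h0
    have hF := gallagerSum_pos hW ρ hQ
    have hWs := Real.rpow_pos_of_pos hWx (1 / (1 + ρ))
    have hαs := Real.rpow_pos_of_pos hα ρ
    rw [gallagerFun_eq, tiltedJoint, Real.log_div hVx.ne' hWx.ne', Real.log_div hVx.ne' hq.ne',
      Real.log_div h0.ne' (by positivity), Real.log_div h0.ne' (by positivity),
      Real.log_div (by positivity) hF.ne', Real.log_div (by positivity) hα.ne',
      Real.log_mul (by positivity) hαs.ne', Real.log_mul hq.ne' (by positivity),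
      Real.log_mul hQx.ne' hWs.ne', Real.log_mul hQx.ne' hVx.ne', Real.log_rpow hWx,
      Real.log_rpow hα]
    have : 1 + ρ ≠ 0 := by linarith
    field_simp
    ring

theorem cond_gibbs {W V : X → Y → ℝ} (hW : IsChannel W) (hV : IsChannel V) {Q : X → ℝ}
    (hQ : Q ∈ stdSimplex ℝ X) (hac : ∀ x, 0 < Q x → ∀ y, W x y = 0 → V x y = 0) (ρ : ℝ) :
    0 ≤ ∑ i : X × Y, Q i.1 * V i.1 i.2 * Real.log (Q i.1 * V i.1 i.2 /
        (outputDist Q V i.2 * (Q i.1 * W i.1 i.2 ^ (1 / (1 + ρ))) / tiltedOutput W ρ Q i.2)) := by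
  have hq0 : ∀ y, 0 ≤ outputDist Q V y :=
    fun y => sum_nonneg fun z _ => mul_nonneg (hQ.1 z) (hV.nonneg z y)
  refine sum_mul_log_div_nonneg (p := fun i : X × Y => Q i.1 * V i.1 i.2)
    (fun i => mul_nonneg (hQ.1 _) (hV.nonneg _ _))
    (fun i => div_nonneg (mul_nonneg (hq0 _) (mul_nonneg (hQ.1 _)
      (Real.rpow_nonneg (hW.nonneg _ _) _))) (tiltedOutput_nonneg hW ρ hQ.1 _)) ?_ ?_
  · rintro ⟨x, y⟩ h0
    dsimp only at h0 ⊢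
    have hQx : 0 < Q x := pos_of_mul_pos_left h0 (hV.nonneg x y)
    have hVx : 0 < V x y := pos_of_mul_pos_right h0 (hQ.1 x)
    have hWx : 0 < W x y := lt_of_le_of_ne (hW.nonneg x y) fun h => hVx.ne' (hac x hQx y h.symm)
    have hα := tiltedOutput_pos hW ρ hQ.1 hQx hWx
    have hq := outputDist_pos hV hQ.1 h0
    have hWs := Real.rpow_pos_of_pos hWx (1 / (1 + ρ))
    positivity
  · rw [Fintype.sum_prod_type, Fintype.sum_prod_type, sum_comm, sum_comm (γ := X)]
    refine sum_le_sum fun y _ => ?_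
    dsimp only
    rw [← sum_div, ← mul_sum]
    change outputDist Q V y * tiltedOutput W ρ Q y / tiltedOutput W ρ Q y ≤ outputDist Q V y
    -- Division by zero returns zero, so such a column drops out of the reference measure; a total
    -- mass at most one is all that Gibbs' inequality needs.
    by_cases h : tiltedOutput W ρ Q y = 0
    · rw [h, div_zero]; exact hq0 y
    · rw [mul_div_cancel_right₀ _ h]

/-- Weak duality between Gallager's function and the sphere-packing functional. -/
theorem gallagerFun_le {W V : X → Y → ℝ} (hW : IsChannel W) (hV : IsChannel V) {Q : X → ℝ}
    (hQ : Q ∈ stdSimplex ℝ X) (hac : ∀ x, 0 < Q x → ∀ y, W x y = 0 → V x y = 0)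
    {ρ : ℝ} (hρ : 0 ≤ ρ) :
    gallagerFun W ρ Q ≤
      (∑ x, Q x * ∑ y, V x y * Real.log (V x y / W x y)) + ρ * mutualInfo Q V ∧
    ((∃ x y, Q x * V x y ≠ tiltedJoint W ρ Q x y) → gallagerFun W ρ Q <
      (∑ x, Q x * ∑ y, V x y * Real.log (V x y / W x y)) + ρ * mutualInfo Q V) := by
  have hd := gallagerFun_decomp hW hV hQ hac hρ
  have h2 := mul_nonneg hρ (cond_gibbs hW hV hQ hac ρ)
  have hp0 : ∀ i : X × Y, 0 ≤ Q i.1 * V i.1 i.2 := fun i => mul_nonneg (hQ.1 _) (hV.nonneg _ _)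
  have ht0 : ∀ i : X × Y, 0 ≤ tiltedJoint W ρ Q i.1 i.2 := fun i =>
    div_nonneg (mul_nonneg (mul_nonneg (hQ.1 _) (Real.rpow_nonneg (hW.nonneg _ _) _))
      (Real.rpow_nonneg (tiltedOutput_nonneg hW ρ hQ.1 _) _)) (gallagerSum_pos hW ρ hQ).le
  have hpt : ∀ i : X × Y, 0 < Q i.1 * V i.1 i.2 → 0 < tiltedJoint W ρ Q i.1 i.2 := by
    rintro ⟨x, y⟩ h0
    dsimp only at h0 ⊢
    have hQx : 0 < Q x := pos_of_mul_pos_left h0 (hV.nonneg x y)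
    have hVx : 0 < V x y := pos_of_mul_pos_right h0 (hQ.1 x)
    have hWx : 0 < W x y := lt_of_le_of_ne (hW.nonneg x y) fun h => hVx.ne' (hac x hQx y h.symm)
    have hα := tiltedOutput_pos hW ρ hQ.1 hQx hWx
    have hF := gallagerSum_pos hW ρ hQ
    rw [tiltedJoint]
    positivity
  have hle : ∑ i : X × Y, tiltedJoint W ρ Q i.1 i.2 ≤ ∑ i : X × Y, Q i.1 * V i.1 i.2 := by
    rw [Fintype.sum_prod_type, Fintype.sum_prod_type]
    exact (sum_tiltedJoint W hW hρ hQ).le.trans (sum_sum_mul_channel hV hQ).ge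
  refine ⟨?_, ?_⟩
  · have h1 := sum_mul_log_div_nonneg hp0 ht0 hpt hle
    linarith
  · rintro ⟨x, y, hxy⟩
    have h1 := sum_mul_log_div_pos hp0 ht0 hpt hle ⟨(x, y), hxy⟩
    linarith

/-- Gallager symmetry in terms of permutations: any two rows differ by a permutation of the
outputs which carries each column to a permuted column. -/
theorem IsSymmetric.exists_perm [DecidableEq Y] {W : X → Y → ℝ} (h : IsSymmetric W) (x x' : X) :
    ∃ σ : Equiv.Perm Y, ∀ y, W x y = W x' (σ y) ∧
      ∃ τ : Equiv.Perm X, ∀ z, W z y = W (τ z) (σ y) := by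
  obtain ⟨P, hP⟩ := h
  choose s hs using fun (B : Finset Y) (hB : B ∈ P.parts) => (hP B hB).1 x x'
  have hmem : ∀ y, y ∈ P.part y := fun y => P.mem_part (mem_univ y)
  have hpart : ∀ y, P.part y ∈ P.parts := fun y => P.part_mem.2 (mem_univ y)
  -- The blockwise row permutations are glued. The result preserves each block, hence is injective,
  -- and the column condition inside the block supplies `τ`.
  let f : Y → Y := fun y => s (P.part y) (hpart y) ⟨y, hmem y⟩
  have hf : ∀ B (hB : B ∈ P.parts) y (hy : y ∈ B), f y = s B hB ⟨y, hy⟩ := by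
    intro B hB y hy
    have : P.part y = B := P.part_eq_of_mem hB hy
    subst this
    rfl
  have hfm : ∀ y, f y ∈ P.part y := fun y => (s (P.part y) (hpart y) ⟨y, hmem y⟩).2
  have hinj : Function.Injective f := by
    intro y y' hyy
    have e : P.part y = P.part y' := by
      rw [← P.part_eq_of_mem (hpart y) (hfm y), hyy, P.part_eq_of_mem (hpart y') (hfm y')]
    have hy' : y' ∈ P.part y := e ▸ hmem y'
    rw [hf _ (hpart y) y (hmem y), hf _ (hpart y) y' hy'] at hyy
    have := (s _ (hpart y)).injective (Subtype.ext hyy)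
    exact congrArg Subtype.val this
  refine ⟨Equiv.ofBijective f (Finite.injective_iff_bijective.1 hinj), fun y => ⟨?_, ?_⟩⟩
  · exact hs (P.part y) (hpart y) ⟨y, hmem y⟩
  · exact (hP _ (hpart y)).2 y (hmem y) (f y) (hfm y)

/-- The uniform input distribution. -/
def uniformInput (X : Type*) [Fintype X] (_ : X) : ℝ := (Fintype.card X : ℝ)⁻¹

theorem uniformInput_pos [Nonempty X] (x : X) : 0 < uniformInput X x := by
  have : (0 : ℝ) < Fintype.card X := by exact_mod_cast Fintype.card_pos
  exact inv_pos.2 this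

theorem uniformInput_mem [Nonempty X] : uniformInput X ∈ stdSimplex ℝ X := by
  refine ⟨fun x => (uniformInput_pos x).le, ?_⟩
  have : (Fintype.card X : ℝ) ≠ 0 := by exact_mod_cast Fintype.card_ne_zero
  simp [uniformInput, this]

theorem tiltedOutput_uniformInput_congr {W : X → Y → ℝ} {y y' : Y} {τ : Equiv.Perm X}
    (h : ∀ z, W z y = W (τ z) y') (ρ : ℝ) :
    tiltedOutput W ρ (uniformInput X) y = tiltedOutput W ρ (uniformInput X) y' := by
  simp only [tiltedOutput, uniformInput, h]
  exact Equiv.sum_comp τ fun x => (Fintype.card X : ℝ)⁻¹ * W x y' ^ (1 / (1 + ρ))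

/-- The permutation matching two rows carries columns to permuted columns, which have the same
tilted output under the uniform input. This is how every row statistic below becomes independent of
the row. -/
theorem IsSymmetric.row_sum_eq [DecidableEq Y] {W : X → Y → ℝ} (h : IsSymmetric W) (ρ : ℝ)
    (Φ : ℝ → ℝ → ℝ) (x x' : X) :
    ∑ y, Φ (W x y) (tiltedOutput W ρ (uniformInput X) y) =
      ∑ y, Φ (W x' y) (tiltedOutput W ρ (uniformInput X) y) := by
  obtain ⟨σ, hσ⟩ := h.exists_perm x x'
  rw [← Equiv.sum_comp σ fun y => Φ (W x' y) _]
  refine sum_congr rfl fun y _ => ?_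
  obtain ⟨h1, τ, h2⟩ := hσ y
  rw [h1, tiltedOutput_uniformInput_congr h2]

/-- Every row of a nonsingular symmetric channel has two distinct positive entries in columns that
are indistinguishable under the uniform input. -/
theorem IsSymmetric.exists_lt [DecidableEq Y] {W : X → Y → ℝ} (h : IsSymmetric W)
    (hW : IsChannel W) (hns : ¬ IsSingular W) (x : X) :
    ∃ y y', 0 < W x y ∧ W x y < W x y' ∧
      ∀ ρ, tiltedOutput W ρ (uniformInput X) y = tiltedOutput W ρ (uniformInput X) y' := by
  have key : ∃ y y', 0 < W x y ∧ 0 < W x y' ∧ W x y ≠ W x y' ∧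
      ∀ ρ, tiltedOutput W ρ (uniformInput X) y = tiltedOutput W ρ (uniformInput X) y' := by
    simp only [IsSingular, not_forall] at hns
    obtain ⟨a, b, c, hpos, hne⟩ := hns
    have ha : 0 < W a b := pos_of_mul_pos_left hpos (hW.nonneg c b)
    have hc : 0 < W c b := pos_of_mul_pos_right hpos (hW.nonneg a b)
    -- Two unequal positive entries of column `b` are carried into row `x`. Both columns reached are
    -- permutations of column `b`, so their tilted outputs agree.
    obtain ⟨σ, hσ⟩ := h.exists_perm a x
    obtain ⟨σ', hσ'⟩ := h.exists_perm c x
    obtain ⟨e1, τ, h1⟩ := hσ b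
    obtain ⟨e2, τ', h2⟩ := hσ' b
    refine ⟨σ b, σ' b, e1 ▸ ha, e2 ▸ hc, ?_, fun ρ => ?_⟩
    · rw [← e1, ← e2]; exact hne
    · rw [← tiltedOutput_uniformInput_congr h1, ← tiltedOutput_uniformInput_congr h2]
  obtain ⟨y, y', h1, h2, h3, h4⟩ := key
  rcases lt_or_gt_of_ne h3 with h | h
  · exact ⟨y, y', h1, h, h4⟩
  · exact ⟨y', y, h2, h, fun ρ => (h4 ρ).symm⟩

end ChannelCoding

/-! ### The tilted channel, tangents of Gallager's function and Legendre slopes. -/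

namespace ChannelCoding

open Finset

variable {X Y : Type*} [Fintype X] [Fintype Y]

/-- The tilted channel attaining the sphere-packing exponent of a symmetric channel. -/
def tiltedChannel (W : X → Y → ℝ) (ρ : ℝ) (x : X) (y : Y) : ℝ :=
  W x y ^ (1 / (1 + ρ)) * tiltedOutput W ρ (uniformInput X) y ^ ρ /
    gallagerSum W ρ (uniformInput X)

/-- The output law of the tilted channel under the uniform input. -/
def tiltedLaw (W : X → Y → ℝ) (ρ : ℝ) (y : Y) : ℝ :=
  tiltedOutput W ρ (uniformInput X) y ^ (1 + ρ) / gallagerSum W ρ (uniformInput X)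

/-- The rate `∂E₀/∂ρ` at which `ρ` is the optimal parameter. -/
def tiltedRate [Nonempty X] (W : X → Y → ℝ) (ρ : ℝ) : ℝ :=
  ∑ y, tiltedChannel W ρ (Classical.arbitrary X) y *
    (1 / (1 + ρ) * Real.log (W (Classical.arbitrary X) y) -
      Real.log (tiltedOutput W ρ (uniformInput X) y))

section Basic

variable [Nonempty X] {W : X → Y → ℝ}

theorem tiltedJoint_uniformInput (ρ : ℝ) (x : X) (y : Y) :
    tiltedJoint W ρ (uniformInput X) x y = uniformInput X x * tiltedChannel W ρ x y := by
  simp only [tiltedJoint, tiltedChannel]; ring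

theorem tiltedChannel_nonneg (hW : IsChannel W) (ρ : ℝ) (x : X) (y : Y) :
    0 ≤ tiltedChannel W ρ x y :=
  div_nonneg (mul_nonneg (Real.rpow_nonneg (hW.nonneg _ _) _)
    (Real.rpow_nonneg (tiltedOutput_nonneg hW ρ uniformInput_mem.1 _) _))
    (gallagerSum_pos hW ρ uniformInput_mem).le

theorem tiltedChannel_pos (hW : IsChannel W) (ρ : ℝ) {x : X} {y : Y} (h : 0 < W x y) :
    0 < tiltedChannel W ρ x y :=
  div_pos (mul_pos (Real.rpow_pos_of_pos h _)
    (Real.rpow_pos_of_pos (tiltedOutput_pos hW ρ uniformInput_mem.1 (uniformInput_pos x) h) _))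
    (gallagerSum_pos hW ρ uniformInput_mem)

theorem tiltedChannel_eq_zero {ρ : ℝ} (hρ : 0 ≤ ρ) {x : X} {y : Y} (h : W x y = 0) :
    tiltedChannel W ρ x y = 0 := by
  have : 1 / (1 + ρ) ≠ 0 := by positivity
  simp only [tiltedChannel, h, Real.zero_rpow this, zero_mul, zero_div]

variable [DecidableEq Y]

/-- By symmetry all row sums agree, and their uniform average is the total mass of `tiltedJoint`. -/
theorem isChannel_tiltedChannel (hW : IsChannel W) (hs : IsSymmetric W) {ρ : ℝ} (hρ : 0 ≤ ρ) :
    IsChannel (tiltedChannel W ρ) := by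
  refine fun x => ⟨tiltedChannel_nonneg hW ρ x, ?_⟩
  have h1 : ∀ x', ∑ y, tiltedChannel W ρ x' y = ∑ y, tiltedChannel W ρ x y := fun x' =>
    hs.row_sum_eq ρ (fun w a => w ^ (1 / (1 + ρ)) * a ^ ρ / gallagerSum W ρ (uniformInput X)) x' x
  have h2 := sum_tiltedJoint W hW hρ (uniformInput_mem (X := X))
  simp_rw [tiltedJoint_uniformInput, ← mul_sum, h1] at h2
  rwa [← sum_mul, uniformInput_mem.2, one_mul] at h2

theorem tiltedRate_eq (hs : IsSymmetric W) (ρ : ℝ) (x : X) :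
    ∑ y, tiltedChannel W ρ x y * (1 / (1 + ρ) * Real.log (W x y) -
      Real.log (tiltedOutput W ρ (uniformInput X) y)) = tiltedRate W ρ :=
  hs.row_sum_eq ρ (fun w a => w ^ (1 / (1 + ρ)) * a ^ ρ / gallagerSum W ρ (uniformInput X) *
    (1 / (1 + ρ) * Real.log w - Real.log a)) x _

theorem tiltedLaw_nonneg (hW : IsChannel W) (ρ : ℝ) (y : Y) : 0 ≤ tiltedLaw W ρ y :=
  div_nonneg (Real.rpow_nonneg (tiltedOutput_nonneg hW ρ uniformInput_mem.1 _) _)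
    (gallagerSum_pos hW ρ uniformInput_mem).le

theorem tiltedLaw_pos (hW : IsChannel W) (ρ : ℝ) {x : X} {y : Y} (h : 0 < W x y) :
    0 < tiltedLaw W ρ y :=
  div_pos (Real.rpow_pos_of_pos (tiltedOutput_pos hW ρ uniformInput_mem.1 (uniformInput_pos x) h) _)
    (gallagerSum_pos hW ρ uniformInput_mem)

theorem sum_tiltedLaw (hW : IsChannel W) (ρ : ℝ) : ∑ y, tiltedLaw W ρ y = 1 := by
  simp only [tiltedLaw]
  rw [← sum_div]
  exact div_self (gallagerSum_pos hW ρ uniformInput_mem).ne'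

theorem log_tiltedChannel_div (hW : IsChannel W) {ρ : ℝ} (hρ : 0 ≤ ρ) {x : X} {y : Y}
    (h : 0 < W x y) :
    Real.log (tiltedChannel W ρ x y / W x y) = gallagerFun W ρ (uniformInput X) -
      ρ * (1 / (1 + ρ) * Real.log (W x y) - Real.log (tiltedOutput W ρ (uniformInput X) y)) := by
  have hα := tiltedOutput_pos hW ρ uniformInput_mem.1 (uniformInput_pos x) h
  have hF := gallagerSum_pos hW ρ (uniformInput_mem (X := X))
  have hWs := Real.rpow_pos_of_pos h (1 / (1 + ρ))
  have hαs := Real.rpow_pos_of_pos hα ρ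
  rw [Real.log_div (tiltedChannel_pos hW ρ h).ne' h.ne', tiltedChannel,
    Real.log_div (by positivity) hF.ne', Real.log_mul hWs.ne' hαs.ne', Real.log_rpow h,
    Real.log_rpow hα, gallagerFun_eq]
  field_simp
  ring

theorem log_tiltedChannel_div_tiltedLaw (hW : IsChannel W) {ρ : ℝ} {x : X} {y : Y}
    (h : 0 < W x y) :
    Real.log (tiltedChannel W ρ x y / tiltedLaw W ρ y) =
      1 / (1 + ρ) * Real.log (W x y) - Real.log (tiltedOutput W ρ (uniformInput X) y) := by
  have hα := tiltedOutput_pos hW ρ uniformInput_mem.1 (uniformInput_pos x) h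
  have hF := gallagerSum_pos hW ρ (uniformInput_mem (X := X))
  have hWs := Real.rpow_pos_of_pos h (1 / (1 + ρ))
  have hαs := Real.rpow_pos_of_pos hα ρ
  have hαs' := Real.rpow_pos_of_pos hα (1 + ρ)
  rw [tiltedChannel, tiltedLaw, div_div_div_cancel_right₀ hF.ne', Real.log_div (by positivity)
    hαs'.ne', Real.log_mul hWs.ne' hαs.ne', Real.log_rpow h, Real.log_rpow hα, Real.log_rpow hα]
  ring

theorem sum_tiltedChannel_mul_log (hW : IsChannel W) (hs : IsSymmetric W) {ρ : ℝ} (hρ : 0 ≤ ρ)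
    (x : X) : ∑ y, tiltedChannel W ρ x y * Real.log (tiltedChannel W ρ x y / W x y) =
      gallagerFun W ρ (uniformInput X) - ρ * tiltedRate W ρ := by
  have hg : gallagerFun W ρ (uniformInput X) =
      ∑ y, tiltedChannel W ρ x y * gallagerFun W ρ (uniformInput X) := by
    rw [← sum_mul, (isChannel_tiltedChannel hW hs hρ).sum_eq_one x, one_mul]
  rw [← tiltedRate_eq hs ρ x, mul_sum, hg, ← sum_sub_distrib]
  refine sum_congr rfl fun y _ => ?_
  rcases (hW.nonneg x y).eq_or_lt with h | h
  · rw [tiltedChannel_eq_zero hρ h.symm]; ring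
  · rw [log_tiltedChannel_div hW hρ h]; ring

theorem divergence_tiltedChannel (hW : IsChannel W) (hs : IsSymmetric W) {ρ : ℝ} (hρ : 0 ≤ ρ)
    {Q : X → ℝ} (hQ : Q ∈ stdSimplex ℝ X) :
    ∑ x, Q x * ∑ y, tiltedChannel W ρ x y * Real.log (tiltedChannel W ρ x y / W x y) =
      gallagerFun W ρ (uniformInput X) - ρ * tiltedRate W ρ := by
  simp_rw [sum_tiltedChannel_mul_log hW hs hρ]
  rw [← sum_mul, hQ.2, one_mul]

/-- Every row of the tilted channel has divergence `tiltedRate` from `tiltedLaw`. Averaged over `Q`,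
this is the mutual information plus the divergence of the actual output law from `tiltedLaw`, and
the latter is nonnegative. -/
theorem mutualInfo_tiltedChannel_le (hW : IsChannel W) (hs : IsSymmetric W) {ρ : ℝ} (hρ : 0 ≤ ρ)
    {Q : X → ℝ} (hQ : Q ∈ stdSimplex ℝ X) :
    mutualInfo Q (tiltedChannel W ρ) ≤ tiltedRate W ρ := by
  have hV := isChannel_tiltedChannel hW hs hρ
  have hq0 : ∀ y, 0 ≤ outputDist Q (tiltedChannel W ρ) y :=
    fun y => sum_nonneg fun z _ => mul_nonneg (hQ.1 z) (hV.nonneg z y)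
  have hpos : ∀ x y, 0 < tiltedChannel W ρ x y → 0 < W x y := fun x y h =>
    lt_of_le_of_ne (hW.nonneg x y) fun h0 => h.ne' (tiltedChannel_eq_zero hρ h0.symm)
  have hg := sum_mul_log_div_nonneg (p := outputDist Q (tiltedChannel W ρ)) (t := tiltedLaw W ρ)
    hq0 (tiltedLaw_nonneg hW ρ) (by
      intro y hy
      obtain ⟨x, -, hx⟩ := exists_lt_of_sum_lt (s := univ) (f := fun _ : X => (0 : ℝ))
        (g := fun x => Q x * tiltedChannel W ρ x y) (by simpa [outputDist] using hy)
      exact tiltedLaw_pos hW ρ (hpos x y (pos_of_mul_pos_right hx (hQ.1 x))))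
    (by
      rw [sum_tiltedLaw hW]
      have := sum_sum_mul_channel hV hQ
      rw [sum_comm] at this
      exact this.ge)
  have h1 : tiltedRate W ρ = ∑ x, Q x * ∑ y, tiltedChannel W ρ x y *
      (1 / (1 + ρ) * Real.log (W x y) - Real.log (tiltedOutput W ρ (uniformInput X) y)) := by
    simp_rw [tiltedRate_eq hs]
    rw [← sum_mul, hQ.2, one_mul]
  have h2 : tiltedRate W ρ = mutualInfo Q (tiltedChannel W ρ) +
      ∑ y, outputDist Q (tiltedChannel W ρ) y *
        Real.log (outputDist Q (tiltedChannel W ρ) y / tiltedLaw W ρ y) := by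
    conv_rhs => arg 2; arg 2; ext y; arg 1; rw [outputDist]
    simp_rw [sum_mul]
    rw [sum_comm (s := (univ : Finset Y)), h1, mutualInfo, ← sum_add_distrib]
    refine sum_congr rfl fun x _ => ?_
    rw [mul_sum, ← sum_add_distrib]
    refine sum_congr rfl fun y _ => ?_
    rcases (mul_nonneg (hQ.1 x) (hV.nonneg x y)).eq_or_lt with h0 | h0
    · rw [← mul_assoc, ← h0]; ring
    · have hVx := pos_of_mul_pos_right h0 (hQ.1 x)
      have hWx := hpos x y hVx
      have hq := outputDist_pos hV hQ.1 h0
      have ht := tiltedLaw_pos hW ρ hWx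
      rw [← log_tiltedChannel_div_tiltedLaw hW hWx, Real.log_div hVx.ne' ht.ne',
        Real.log_div hVx.ne' hq.ne', Real.log_div hq.ne' ht.ne']
      ring
  linarith

theorem tilted_abs_cont {ρ : ℝ} (hρ : 0 ≤ ρ) (Q : X → ℝ) :
    ∀ x, 0 < Q x → ∀ y, W x y = 0 → tiltedChannel W ρ x y = 0 :=
  fun _ _ _ h => tiltedChannel_eq_zero hρ h

/-- Tangent line inequality, with a general input distribution on the left. -/
theorem gallagerFun_le_tangent (hW : IsChannel W) (hs : IsSymmetric W) {ρ ρ' : ℝ} (hρ : 0 ≤ ρ)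
    (hρ' : 0 ≤ ρ') {Q : X → ℝ} (hQ : Q ∈ stdSimplex ℝ X) :
    gallagerFun W ρ' Q ≤ gallagerFun W ρ (uniformInput X) + (ρ' - ρ) * tiltedRate W ρ := by
  -- The channel tilted at `ρ` is the test channel in the duality at `ρ'`.
  have h1 := (gallagerFun_le hW (isChannel_tiltedChannel hW hs hρ) hQ
    (tilted_abs_cont hρ Q) hρ').1
  rw [divergence_tiltedChannel hW hs hρ hQ] at h1
  have h2 := mul_le_mul_of_nonneg_left (mutualInfo_tiltedChannel_le hW hs hρ hQ) hρ'
  linarith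

/-- For nonsingular channels, Gallager's function lies strictly below its tangents. -/
theorem gallagerFun_lt_tangent (hW : IsChannel W) (hs : IsSymmetric W) (hns : ¬ IsSingular W)
    {ρ ρ' : ℝ} (hρ : 0 ≤ ρ) (hρ' : 0 ≤ ρ') (hne : ρ' ≠ ρ) :
    gallagerFun W ρ' (uniformInput X) <
      gallagerFun W ρ (uniformInput X) + (ρ' - ρ) * tiltedRate W ρ := by
  have hQ := uniformInput_mem (X := X)
  have h1 := (gallagerFun_le hW (isChannel_tiltedChannel hW hs hρ) hQ
    (tilted_abs_cont hρ _) hρ').2 (by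
    by_contra hcon
    push Not at hcon
    set x : X := Classical.arbitrary X
    have hV : ∀ y, tiltedChannel W ρ x y = tiltedChannel W ρ' x y := fun y => by
      have h := hcon x y
      rw [tiltedJoint_uniformInput] at h
      exact mul_left_cancel₀ (uniformInput_pos x).ne' h
    obtain ⟨y, y', hy, hlt, hα⟩ := hs.exists_lt hW hns x
    have hy' := hy.trans hlt
    -- Equality would force the channels tilted at `ρ` and `ρ'` to coincide. In two columns with
    -- equal tilted outputs the ratio of entries depends on `ρ` only through the exponent `1 / (1 +
    -- ρ)`, so it determines `ρ`.
    have hratio : ∀ ρ, Real.log (tiltedChannel W ρ x y' ) - Real.log (tiltedChannel W ρ x y) =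
        1 / (1 + ρ) * (Real.log (W x y') - Real.log (W x y)) := by
      intro ρ
      have hα1 := tiltedOutput_pos hW ρ uniformInput_mem.1 (uniformInput_pos x) hy'
      have hF := gallagerSum_pos hW ρ (uniformInput_mem (X := X))
      have hWs := Real.rpow_pos_of_pos hy (1 / (1 + ρ))
      have hWs' := Real.rpow_pos_of_pos hy' (1 / (1 + ρ))
      have hαs := Real.rpow_pos_of_pos hα1 ρ
      rw [tiltedChannel, tiltedChannel, hα, Real.log_div (by positivity) hF.ne',
        Real.log_div (by positivity) hF.ne', Real.log_mul hWs.ne' hαs.ne',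
        Real.log_mul hWs'.ne' hαs.ne', Real.log_rpow hy, Real.log_rpow hy']
      ring
    have h3 := hratio ρ
    rw [hV, hV, hratio ρ'] at h3
    have h4 : Real.log (W x y') - Real.log (W x y) ≠ 0 :=
      (sub_pos.2 (Real.log_lt_log hy hlt)).ne'
    have h5 := mul_right_cancel₀ h4 h3
    rw [div_eq_div_iff (by linarith) (by linarith)] at h5
    exact hne (by linarith))
  rw [divergence_tiltedChannel hW hs hρ hQ] at h1
  have h2 := mul_le_mul_of_nonneg_left (mutualInfo_tiltedChannel_le hW hs hρ hQ) hρ'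
  linarith

/-- Add the strict tangent inequalities at `ρ` and at `ρ'`. -/
theorem tiltedRate_strictAnti (hW : IsChannel W) (hs : IsSymmetric W) (hns : ¬ IsSingular W)
    {ρ ρ' : ℝ} (hρ : 0 ≤ ρ) (h : ρ < ρ') : tiltedRate W ρ' < tiltedRate W ρ := by
  have h1 := gallagerFun_lt_tangent hW hs hns hρ (hρ.trans h.le) h.ne'
  have h2 := gallagerFun_lt_tangent hW hs hns (hρ.trans h.le) hρ h.ne
  nlinarith

theorem continuousOn_rpow_inv {a : ℝ} : ContinuousOn (fun ρ : ℝ => a ^ (1 / (1 + ρ))) (Set.Ici 0) := by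
  refine ContinuousOn.rpow continuousOn_const ?_ fun ρ hρ => Or.inr ?_
  · refine continuousOn_const.div (by fun_prop) fun ρ hρ => ?_
    have : (0 : ℝ) ≤ ρ := hρ
    positivity
  · have : (0 : ℝ) ≤ ρ := hρ
    positivity

theorem continuousOn_tiltedOutput (y : Y) :
    ContinuousOn (fun ρ => tiltedOutput W ρ (uniformInput X) y) (Set.Ici 0) := by
  simp only [tiltedOutput]
  exact continuousOn_finsetSum _ fun x _ => continuousOn_const.mul continuousOn_rpow_inv

theorem continuousOn_tiltedRate (hW : IsChannel W) : ContinuousOn (tiltedRate W) (Set.Ici 0) := by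
  have hF : ContinuousOn (fun ρ => gallagerSum W ρ (uniformInput X)) (Set.Ici 0) := by
    simp only [gallagerSum]
    refine continuousOn_finsetSum _ fun y _ =>
      (continuousOn_tiltedOutput y).rpow (by fun_prop) fun ρ hρ => Or.inr ?_
    have : (0 : ℝ) ≤ ρ := hρ
    positivity
  unfold tiltedRate
  refine continuousOn_finsetSum _ fun y _ => ?_
  set x : X := Classical.arbitrary X
  rcases (hW.nonneg x y).eq_or_lt with h | h
  · refine (continuousOn_const (c := (0 : ℝ))).congr fun ρ hρ => ?_
    simp only
    rw [tiltedChannel_eq_zero hρ h.symm, zero_mul]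
  · have hα : ∀ ρ, tiltedOutput W ρ (uniformInput X) y ≠ 0 := fun ρ =>
      (tiltedOutput_pos hW ρ uniformInput_mem.1 (uniformInput_pos x) h).ne'
    refine ContinuousOn.mul ?_ ?_
    · simp only [tiltedChannel]
      exact (continuousOn_rpow_inv.mul ((continuousOn_tiltedOutput y).rpow continuousOn_id
        fun ρ _ => Or.inl (hα ρ))).div hF fun ρ _ => (gallagerSum_pos hW ρ uniformInput_mem).ne'
    · refine ContinuousOn.sub (ContinuousOn.mul ?_ continuousOn_const)
        ((continuousOn_tiltedOutput y).log fun ρ _ => hα ρ)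
      refine continuousOn_const.div (by fun_prop) fun ρ hρ => ?_
      have : (0 : ℝ) ≤ ρ := hρ
      positivity

end Basic

/-- A function given parametrically as a Legendre transform has slope minus the parameter. -/
theorem hasDerivAt_of_legendre {E g h : ℝ → ℝ} {a b : ℝ}
    (htan : ∀ ρ ∈ Set.Ioo a b, ∀ ρ' ∈ Set.Ioo a b, g ρ' ≤ g ρ + (ρ' - ρ) * h ρ)
    (hcont : ContinuousOn h (Set.Ioo a b)) (hanti : StrictAntiOn h (Set.Ioo a b))
    (hE : ∀ ρ ∈ Set.Ioo a b, E (h ρ) = g ρ - ρ * h ρ) {ρ : ℝ} (hρ : ρ ∈ Set.Ioo a b) :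
    HasDerivAt E (-ρ) (h ρ) := by
  rw [hasDerivAt_iff_isLittleO, Asymptotics.isLittleO_iff]
  intro ε hε
  -- Parameters within `ε` of `ρ` cover, by the intermediate value theorem, a whole neighbourhood of
  -- `h ρ`.
  set ρ₁ := max ((a + ρ) / 2) (ρ - ε) with h1
  set ρ₂ := min ((ρ + b) / 2) (ρ + ε) with h2
  have h1a : ρ₁ < ρ := max_lt (by linarith [hρ.1]) (by linarith)
  have h1b : a < ρ₁ := lt_max_of_lt_left (by linarith [hρ.1])
  have h2a : ρ < ρ₂ := lt_min (by linarith [hρ.2]) (by linarith)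
  have h2b : ρ₂ < b := min_lt_of_left_lt (by linarith [hρ.2])
  have hm1 : ρ₁ ∈ Set.Ioo a b := ⟨h1b, by linarith [hρ.2]⟩
  have hm2 : ρ₂ ∈ Set.Ioo a b := ⟨by linarith [hρ.1], h2b⟩
  have hsub : Set.Icc ρ₁ ρ₂ ⊆ Set.Ioo a b := fun z hz => ⟨h1b.trans_le hz.1, hz.2.trans_lt h2b⟩
  have hnhds : Set.Icc (h ρ₂) (h ρ₁) ∈ nhds (h ρ) :=
    Icc_mem_nhds (hanti hρ hm2 h2a) (hanti hm1 hρ h1a)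
  filter_upwards [hnhds] with r hr
  obtain ⟨ρ', hρ', rfl⟩ := intermediate_value_Icc' (h1a.trans h2a).le (hcont.mono hsub) hr
  have hm := hsub hρ'
  -- The two tangent inequalities place the remainder `E (h ρ') - E (h ρ) + ρ (h ρ' - h ρ)` between
  -- `0` and `(ρ' - ρ)(h ρ - h ρ')`.
  have t1 := htan ρ' hm ρ hρ
  have t2 := htan ρ hρ ρ' hm
  rw [hE ρ hρ, hE ρ' hm, smul_eq_mul, Real.norm_eq_abs, Real.norm_eq_abs]
  have hd : |ρ' - ρ| ≤ ε := by
    rw [abs_le]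
    constructor
    · linarith [hρ'.1, le_max_right ((a + ρ) / 2) (ρ - ε)]
    · linarith [hρ'.2, min_le_right ((ρ + b) / 2) (ρ + ε)]
  have hle : (ρ' - ρ) * (h ρ - h ρ') ≤ ε * |h ρ' - h ρ| := by
    rw [abs_sub_comm]
    calc _ ≤ |(ρ' - ρ) * (h ρ - h ρ')| := le_abs_self _
      _ = |ρ' - ρ| * |h ρ - h ρ'| := abs_mul _ _
      _ ≤ _ := by gcongr
  rw [abs_of_nonneg (by linarith)]
  linarith

end ChannelCoding

/-! ### The two exponents, the range of rates attained by a parameter, and the slopes. -/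

namespace ChannelCoding

open Finset

variable {X Y : Type*} [Fintype X] [Fintype Y] {W : X → Y → ℝ}

theorem le_spherePackingExpOf (hW : IsChannel W) {ρ : ℝ} (hρ : 0 ≤ ρ) (r : ℝ) {Q : X → ℝ}
    (hQ : Q ∈ stdSimplex ℝ X) :
    ((gallagerFun W ρ Q - ρ * r : ℝ) : EReal) ≤ spherePackingExpOf W r Q := by
  refine le_iInf₂ fun V hV => ?_
  obtain ⟨hV, hI⟩ := hV
  rw [condDiv]
  split_ifs with hac
  · rw [EReal.coe_le_coe_iff]
    have h1 := (gallagerFun_le hW hV hQ hac hρ).1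
    have h2 := mul_le_mul_of_nonneg_left hI hρ
    linarith
  · exact le_top

theorem spherePackingExp_antitone (W : X → Y → ℝ) : Antitone (spherePackingExp W) := by
  intro r r' hr
  refine iSup₂_mono fun Q _ => ?_
  exact biInf_mono fun V hV => ⟨hV.1, hV.2.trans hr⟩

variable [Nonempty X]

theorem le_spherePackingExp (hW : IsChannel W) {ρ : ℝ} (hρ : 0 ≤ ρ) (r : ℝ) :
    ((gallagerFun W ρ (uniformInput X) - ρ * r : ℝ) : EReal) ≤ spherePackingExp W r :=
  (le_spherePackingExpOf hW hρ r uniformInput_mem).trans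
    (le_iSup₂ (f := fun Q (_ : Q ∈ stdSimplex ℝ X) => spherePackingExpOf W r Q)
      (uniformInput X) uniformInput_mem)

theorem gallagerFun_zero (hW : IsChannel W) : gallagerFun W 0 (uniformInput X) = 0 := by
  have h := sum_sum_mul_channel hW (uniformInput_mem (X := X))
  rw [sum_comm] at h
  simp [gallagerFun, h]

theorem spherePackingExp_nonneg (hW : IsChannel W) (r : ℝ) : 0 ≤ spherePackingExp W r := by
  have h := le_spherePackingExp hW le_rfl r
  rw [gallagerFun_zero hW] at h
  simpa using h

variable [DecidableEq Y]

/-- The tilted channel is feasible for every input distribution simultaneously, and with the same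
divergence. -/
theorem spherePackingExp_le (hW : IsChannel W) (hs : IsSymmetric W) {ρ r : ℝ} (hρ : 0 ≤ ρ)
    (hr : tiltedRate W ρ ≤ r) :
    spherePackingExp W r ≤
      ((gallagerFun W ρ (uniformInput X) - ρ * tiltedRate W ρ : ℝ) : EReal) := by
  refine iSup₂_le fun Q hQ => ?_
  refine (iInf₂_le (f := fun V (_ : V ∈ {V : X → Y → ℝ | IsChannel V ∧ mutualInfo Q V ≤ r}) =>
    condDiv V W Q) (tiltedChannel W ρ) ⟨isChannel_tiltedChannel hW hs hρ,
      (mutualInfo_tiltedChannel_le hW hs hρ hQ).trans hr⟩).trans ?_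
  rw [condDiv, if_pos (tilted_abs_cont hρ Q), divergence_tiltedChannel hW hs hρ hQ]

theorem spherePackingExp_tiltedRate (hW : IsChannel W) (hs : IsSymmetric W) {ρ : ℝ}
    (hρ : 0 ≤ ρ) :
    spherePackingExp W (tiltedRate W ρ) =
      ((gallagerFun W ρ (uniformInput X) - ρ * tiltedRate W ρ : ℝ) : EReal) :=
  le_antisymm (spherePackingExp_le hW hs hρ le_rfl) (le_spherePackingExp hW hρ _)

theorem randomCodingExp_eq_of_tangent {ρ r : ℝ} (h0 : 0 ≤ ρ) (h1 : ρ ≤ 1)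
    (hle : ∀ Q ∈ stdSimplex ℝ X, ∀ ρ' ∈ Set.Icc (0 : ℝ) 1,
      gallagerFun W ρ' Q - ρ' * r ≤ gallagerFun W ρ (uniformInput X) - ρ * r) :
    randomCodingExp W r = gallagerFun W ρ (uniformInput X) - ρ * r := by
  have hne : ∀ Q : X → ℝ, ((fun ρ : ℝ => gallagerFun W ρ Q - ρ * r) '' Set.Icc 0 1).Nonempty :=
    fun Q => ⟨_, ⟨0, by simp, rfl⟩⟩
  have hle' : ∀ Q ∈ stdSimplex ℝ X,
      randomCodingExpOf W r Q ≤ gallagerFun W ρ (uniformInput X) - ρ * r := by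
    rintro Q hQ
    refine csSup_le (hne Q) ?_
    rintro _ ⟨ρ', hρ', rfl⟩
    exact hle Q hQ ρ' hρ'
  refine le_antisymm (csSup_le ⟨_, ⟨_, uniformInput_mem, rfl⟩⟩ ?_) ?_
  · rintro _ ⟨Q, hQ, rfl⟩
    exact hle' Q hQ
  · refine le_trans ?_ (le_csSup ⟨gallagerFun W ρ (uniformInput X) - ρ * r, ?_⟩
      ⟨_, uniformInput_mem, rfl⟩)
    · refine le_csSup ⟨gallagerFun W ρ (uniformInput X) - ρ * r, ?_⟩ ⟨ρ, ⟨h0, h1⟩, rfl⟩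
      rintro _ ⟨ρ', hρ', rfl⟩
      exact hle _ uniformInput_mem ρ' hρ'
    · rintro _ ⟨Q, hQ, rfl⟩
      exact hle' Q hQ

theorem randomCodingExp_tiltedRate (hW : IsChannel W) (hs : IsSymmetric W) {ρ : ℝ}
    (h0 : 0 ≤ ρ) (h1 : ρ ≤ 1) :
    randomCodingExp W (tiltedRate W ρ) =
      gallagerFun W ρ (uniformInput X) - ρ * tiltedRate W ρ := by
  refine randomCodingExp_eq_of_tangent h0 h1 fun Q hQ ρ' hρ' => ?_
  have := gallagerFun_le_tangent hW hs h0 hρ'.1 hQ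
  linarith

/-- At `ρ = 0` the tilting is trivial, so the bound on the mutual information applies to `W` itself.
-/
theorem capacity_le_tiltedRate_zero (hW : IsChannel W) (hs : IsSymmetric W) :
    capacity W ≤ tiltedRate W 0 := by
  have e : tiltedChannel W 0 = W := by
    funext x y
    have hF : gallagerSum W 0 (uniformInput X) = 1 := by
      have h := sum_sum_mul_channel hW (uniformInput_mem (X := X))
      rw [sum_comm] at h
      simp [gallagerSum, tiltedOutput, h]
    simp [tiltedChannel, hF]
  refine csSup_le ⟨_, ⟨_, uniformInput_mem, rfl⟩⟩ ?_
  rintro _ ⟨Q, hQ, rfl⟩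
  have := mutualInfo_tiltedChannel_le hW hs le_rfl hQ
  rwa [e] at this

/-- Without this the real supremum in `rateInfty` could be the default value `0`. -/
theorem bddAbove_infinite_rates (hW : IsChannel W) (hs : IsSymmetric W) :
    BddAbove {R : ℝ | 0 ≤ R ∧ ∀ r, 0 ≤ r → r < R → spherePackingExp W r = ⊤} := by
  refine ⟨|tiltedRate W 0|, fun R hR => ?_⟩
  by_contra hlt
  push Not at hlt
  have h1 := hR.2 _ (abs_nonneg _) hlt
  have h2 := spherePackingExp_le hW hs le_rfl (le_abs_self (tiltedRate W 0))
  rw [h1] at h2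
  exact absurd h2 (not_le.2 (EReal.coe_lt_top _))

theorem rateInfty_nonneg (hW : IsChannel W) (hs : IsSymmetric W) : 0 ≤ rateInfty W :=
  le_csSup (bddAbove_infinite_rates hW hs)
    ⟨le_rfl, fun _ h0 h1 => absurd h1 (not_lt.2 h0)⟩

theorem spherePackingExp_ne_top (hW : IsChannel W) (hs : IsSymmetric W) {r : ℝ}
    (hr : rateInfty W < r) : spherePackingExp W r ≠ ⊤ := by
  intro htop
  refine absurd hr (not_lt.2 (le_csSup (bddAbove_infinite_rates hW hs)
    ⟨(rateInfty_nonneg hW hs).trans hr.le, fun r' _ h => ?_⟩))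
  exact top_le_iff.1 (htop ▸ spherePackingExp_antitone W h.le)

theorem exists_tiltedRate_eq (hW : IsChannel W) {R b : ℝ} (hb : 0 ≤ b)
    (h0 : R < tiltedRate W 0) (h1 : tiltedRate W b < R) :
    ∃ ρ ∈ Set.Ioo 0 b, tiltedRate W ρ = R := by
  obtain ⟨ρ, hρ, h⟩ := intermediate_value_Ioo' hb
    ((continuousOn_tiltedRate hW).mono Set.Icc_subset_Ici_self) ⟨h1, h0⟩
  exact ⟨ρ, hρ, h⟩

/-- Above `R_∞` and below capacity, the rate is attained by some parameter. -/
theorem exists_param_of_rateInfty_lt (hW : IsChannel W) (hs : IsSymmetric W) {R : ℝ}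
    (h1 : rateInfty W < R) (h2 : R < capacity W) : ∃ ρ, 0 < ρ ∧ tiltedRate W ρ = R := by
  have h0 : R < tiltedRate W 0 := h2.trans_le (capacity_le_tiltedRate_zero hW hs)
  -- Otherwise the tangent at `ρ`, evaluated at `0`, gives `E₀(ρ) ≥ ρ R` for all `ρ`. The
  -- sphere-packing exponent at some `r < R` above `R_∞` would then be at least `ρ (R - r)` for
  -- every `ρ`, hence infinite.
  obtain ⟨b, hb, hbR⟩ : ∃ b : ℝ, 0 ≤ b ∧ tiltedRate W b < R := by
    by_contra hcon
    push Not at hcon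
    obtain ⟨r, hr1, hr2⟩ := exists_between h1
    have hne := spherePackingExp_ne_top hW hs hr1
    have hnb : spherePackingExp W r ≠ ⊥ :=
      (lt_of_lt_of_le EReal.bot_lt_zero (spherePackingExp_nonneg hW r)).ne'
    set G := (spherePackingExp W r).toReal with hG
    have hle : ∀ ρ : ℝ, 0 ≤ ρ → ρ * (R - r) ≤ G := by
      intro ρ hρ
      have e1 := le_spherePackingExp hW hρ r
      rw [← EReal.coe_toReal hne hnb, EReal.coe_le_coe_iff] at e1
      have e2 := gallagerFun_le_tangent hW hs hρ le_rfl (uniformInput_mem (X := X))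
      rw [gallagerFun_zero hW] at e2
      have e3 := mul_le_mul_of_nonneg_left (hcon ρ hρ) hρ
      nlinarith
    have hRr : 0 < R - r := sub_pos.2 hr2
    have := hle ((|G| + 1) / (R - r)) (by positivity)
    rw [div_mul_cancel₀ _ hRr.ne'] at this
    linarith [le_abs_self G]
  obtain ⟨ρ, hρ, h⟩ := exists_tiltedRate_eq hW hb h0 hbR
  exact ⟨ρ, hρ.1, h⟩

/-- Above the critical rate and below capacity, the rate is attained by a parameter below `1`. -/
theorem exists_param_of_criticalRate_lt (hW : IsChannel W) (hs : IsSymmetric W) {R : ℝ}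
    (h1 : criticalRate W < R) (h2 : R < capacity W) :
    ∃ ρ ∈ Set.Ioo (0 : ℝ) 1, tiltedRate W ρ = R := by
  have h0 : R < tiltedRate W 0 := h2.trans_le (capacity_le_tiltedRate_zero hW hs)
  refine exists_tiltedRate_eq hW zero_le_one h0 ?_
  by_contra hcon
  push Not at hcon
  -- Nonemptiness lets the infimum be approached by actual rates; from `tiltedRate W 0` on both
  -- exponents vanish.
  have hne : {R : ℝ | 0 ≤ R ∧ (randomCodingExp W R : EReal) = spherePackingExp W R}.Nonempty := by
    refine ⟨max 0 (tiltedRate W 0), le_max_left _ _, ?_⟩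
    have hm : tiltedRate W 0 ≤ max 0 (tiltedRate W 0) := le_max_right _ _
    have e1 : randomCodingExp W (max 0 (tiltedRate W 0)) = 0 := by
      rw [randomCodingExp_eq_of_tangent le_rfl zero_le_one, gallagerFun_zero hW, zero_mul, sub_zero]
      intro Q hQ ρ' hρ'
      have := gallagerFun_le_tangent hW hs le_rfl hρ'.1 hQ
      have := mul_le_mul_of_nonneg_left hm hρ'.1
      linarith
    have e2 := spherePackingExp_le hW hs le_rfl hm
    rw [gallagerFun_zero hW, zero_mul, sub_zero, EReal.coe_zero] at e2
    rw [e1, EReal.coe_zero]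
    exact le_antisymm (spherePackingExp_nonneg hW _) e2
  obtain ⟨r, ⟨hr0, hr⟩, hrR⟩ := exists_lt_of_csInf_lt hne h1
  have hr1 : r < tiltedRate W 1 := hrR.trans_le hcon
  -- Below `tiltedRate W 1` the optimal parameter in `[0,1]` is `1`. A parameter slightly above `1`
  -- gives a strictly larger lower bound for the sphere-packing exponent, so the two exponents
  -- cannot agree at `r`.
  have e1 : randomCodingExp W r = gallagerFun W 1 (uniformInput X) - 1 * r := by
    refine randomCodingExp_eq_of_tangent zero_le_one le_rfl fun Q hQ ρ' hρ' => ?_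
    have := gallagerFun_le_tangent hW hs zero_le_one hρ'.1 hQ
    nlinarith [hρ'.2]
  have hnear : ∃ ρ, 1 < ρ ∧ r < tiltedRate W ρ := by
    have hc : ContinuousAt (tiltedRate W) 1 :=
      (continuousOn_tiltedRate hW).continuousAt (Ici_mem_nhds zero_lt_one)
    have hev := (hc.tendsto.eventually (lt_mem_nhds hr1)).filter_mono
      (nhdsWithin_le_nhds (s := Set.Ioi 1))
    obtain ⟨ρ, h3, h4⟩ := (hev.and self_mem_nhdsWithin).exists
    exact ⟨ρ, h4, h3⟩
  obtain ⟨ρ, hρ1, hρr⟩ := hnear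
  have e2 := le_spherePackingExp hW (by linarith : 0 ≤ ρ) r
  rw [← hr, e1, EReal.coe_le_coe_iff] at e2
  have e3 := gallagerFun_le_tangent hW hs (by linarith : 0 ≤ ρ) zero_le_one
    (uniformInput_mem (X := X))
  nlinarith

theorem hasDerivAt_randomCodingExp (hW : IsChannel W) (hs : IsSymmetric W) (hns : ¬ IsSingular W)
    {ρ : ℝ} (hρ : ρ ∈ Set.Ioo (0 : ℝ) 1) :
    HasDerivAt (fun r => randomCodingExp W r) (-ρ) (tiltedRate W ρ) :=
  hasDerivAt_of_legendre (g := fun ρ => gallagerFun W ρ (uniformInput X))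
    (fun _ h _ h' => gallagerFun_le_tangent hW hs h.1.le h'.1.le uniformInput_mem)
    ((continuousOn_tiltedRate hW).mono fun _ h => h.1.le)
    (fun _ h _ _ hlt => tiltedRate_strictAnti hW hs hns h.1.le hlt)
    (fun _ h => randomCodingExp_tiltedRate hW hs h.1.le h.2.le) hρ

theorem hasDerivAt_spherePackingExp (hW : IsChannel W) (hs : IsSymmetric W)
    (hns : ¬ IsSingular W) {ρ : ℝ} (hρ : 0 < ρ) :
    HasDerivAt (fun r => (spherePackingExp W r).toReal) (-ρ) (tiltedRate W ρ) :=
  hasDerivAt_of_legendre (g := fun ρ => gallagerFun W ρ (uniformInput X)) (b := ρ + 1)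
    (fun _ h _ h' => gallagerFun_le_tangent hW hs h.1.le h'.1.le uniformInput_mem)
    ((continuousOn_tiltedRate hW).mono fun _ h => h.1.le)
    (fun _ h _ _ hlt => tiltedRate_strictAnti hW hs hns h.1.le hlt)
    (fun _ h => by rw [spherePackingExp_tiltedRate hW hs h.1.le, EReal.toReal_coe])
    ⟨hρ, by linarith⟩

end ChannelCoding

/-! ### Random coding and expurgation for an arbitrary finite likelihood. -/

namespace ChannelCoding

open Finset

section RandomCoding

variable {C O : Type*} [Fintype C] [Fintype O]

/-- The probability that a uniformly drawn word is at least as likely as `c` given the output. -/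
def pairwiseProb (P : C → O → ℝ) (c : C) (o : O) : ℝ :=
  ∑ c' : C, open Classical in (Fintype.card C : ℝ)⁻¹ * (if P c o ≤ P c' o then 1 else 0)

/-- The random coding union bound for `K` uniformly drawn words. -/
def unionBound (P : C → O → ℝ) (K : ℝ) : ℝ :=
  ∑ c, ∑ o, (Fintype.card C : ℝ)⁻¹ * (P c o * min 1 (K * pairwiseProb P c o))

theorem pairwiseProb_nonneg (P : C → O → ℝ) (c : C) (o : O) : 0 ≤ pairwiseProb P c o :=
  sum_nonneg fun _ _ => mul_nonneg (by positivity) (by split_ifs <;> norm_num)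

theorem unionBound_nonneg {P : C → O → ℝ} (hP : ∀ c o, 0 ≤ P c o) {K : ℝ} (hK : 0 ≤ K) :
    0 ≤ unionBound P K :=
  sum_nonneg fun c _ => sum_nonneg fun o _ => mul_nonneg (by positivity)
    (mul_nonneg (hP c o) (le_min zero_le_one (mul_nonneg hK (pairwiseProb_nonneg P c o))))

open Classical in
/-- Some codebook with maximum likelihood decoding has total error at most the union bound. -/
theorem exists_codebook [Nonempty C] {P : C → O → ℝ} (hP : ∀ c o, 0 ≤ P c o) {K : ℕ}
    (hK : 0 < K) : ∃ (e : Fin K → C) (d : O → Fin K),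
      ∑ m, ∑ o with d o ≠ m, P (e m) o ≤ K * unionBound P K := by
  have : Nonempty (Fin K) := ⟨⟨0, hK⟩⟩
  have hML : ∀ e : Fin K → C, ∀ o, ∃ m, ∀ m', P (e m') o ≤ P (e m) o := fun e o =>
    Finite.exists_max fun m => P (e m) o
  choose d hd using hML
  -- The two branches of `min 1 (K p)`: where the union bound is useless (`a = 1`) the error is
  -- charged in full; elsewhere `b` counts competitors that are at least as likely. An error always
  -- produces one of the two.
  set a : C → O → ℝ := fun c o => if 1 ≤ K * pairwiseProb P c o then 1 else 0 with ha
  set b : C → C → O → ℝ := fun c c' o => if 1 ≤ K * pairwiseProb P c o then 0 else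
    if P c o ≤ P c' o then 1 else 0 with hb
  have ha0 : ∀ c o, 0 ≤ a c o := fun c o => by simp only [ha]; split_ifs <;> norm_num
  have hb0 : ∀ c c' o, 0 ≤ b c c' o := fun c c' o => by simp only [hb]; split_ifs <;> norm_num
  set u : Fin K → C → ℝ := fun _ _ => (Fintype.card C : ℝ)⁻¹ with hu
  have hCard : (Fintype.card C : ℝ) ≠ 0 := by exact_mod_cast Fintype.card_ne_zero
  have hu1 : ∀ i, ∑ c, u i c = 1 := fun i => by simp [hu, hCard]
  have herr : ∀ e m, ∑ o with d e o ≠ m, P (e m) o ≤ (∑ o, P (e m) o * a (e m) o) +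
      ∑ m' ∈ univ.erase m, ∑ o, P (e m) o * b (e m) (e m') o := by
    intro e m
    rw [sum_comm, ← sum_add_distrib, sum_filter]
    refine sum_le_sum fun o _ => ?_
    rw [← mul_sum, ← mul_add]
    have hS : 0 ≤ ∑ m' ∈ univ.erase m, b (e m) (e m') o := sum_nonneg fun _ _ => hb0 _ _ _
    split_ifs with h
    · refine le_mul_of_one_le_right (hP _ _) ?_
      by_cases hc : 1 ≤ K * pairwiseProb P (e m) o
      · have : a (e m) o = 1 := if_pos hc
        linarith
      · have h1 : b (e m) (e (d e o)) o = 1 := by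
          simp only [hb, if_neg hc, if_pos (hd e o m)]
        have h2 := single_le_sum (f := fun m' => b (e m) (e m') o) (fun _ _ => hb0 _ _ _)
          (mem_erase.2 ⟨h, mem_univ (d e o)⟩)
        have := ha0 (e m) o
        simp only [h1] at h2
        linarith
    · exact mul_nonneg (hP _ _) (add_nonneg (ha0 _ _) hS)
  have hmean : ∀ m, ∑ e : Fin K → C, (∏ i, u i (e i)) * ((∑ o, P (e m) o * a (e m) o) +
      ∑ m' ∈ univ.erase m, ∑ o, P (e m) o * b (e m) (e m') o) ≤ unionBound P K := by
    intro m
    simp_rw [mul_add, mul_sum (univ.erase m)]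
    rw [sum_add_distrib, sum_comm (s := (univ : Finset (Fin K → C)))]
    rw [ProductLaw.sum_prod_mul_single hu1 m fun c => ∑ o, P c o * a c o]
    have h1 : ∀ m' ∈ univ.erase m, ∑ e : Fin K → C, (∏ i, u i (e i)) *
        ∑ o, P (e m) o * b (e m) (e m') o =
        ∑ c, ∑ o, (Fintype.card C : ℝ)⁻¹ * (P c o * ((1 - a c o) * pairwiseProb P c o)) := by
      intro m' hm'
      rw [ProductLaw.sum_prod_mul_pair hu1 (mem_erase.1 hm').1.symm
        fun c c' => ∑ o, P c o * b c c' o]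
      refine sum_congr rfl fun c _ => ?_
      simp_rw [mul_sum]
      rw [sum_comm]
      refine sum_congr rfl fun o _ => ?_
      rw [pairwiseProb, mul_sum, mul_sum, mul_sum]
      refine sum_congr rfl fun c' _ => ?_
      simp only [hu, ha, hb]
      split_ifs <;> ring
    rw [sum_congr rfl h1, sum_const, card_erase_of_mem (mem_univ m), card_univ, Fintype.card_fin,
      nsmul_eq_mul, unionBound, mul_sum, ← sum_add_distrib]
    refine sum_le_sum fun c _ => ?_
    simp only [hu]
    rw [mul_sum, mul_sum, ← sum_add_distrib]
    refine sum_le_sum fun o _ => ?_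
    have hK1 : ((K - 1 : ℕ) : ℝ) ≤ K := by exact_mod_cast Nat.sub_le K 1
    have hpw := pairwiseProb_nonneg P c o
    have key : a c o + ((K - 1 : ℕ) : ℝ) * ((1 - a c o) * pairwiseProb P c o) ≤
        min 1 (K * pairwiseProb P c o) := by
      simp only [ha]
      split_ifs with hc
      · rw [min_eq_left hc]; simp
      · rw [min_eq_right (not_le.1 hc).le]
        have := mul_le_mul_of_nonneg_right hK1 hpw
        linarith
    have h2 := mul_le_mul_of_nonneg_left key (mul_nonneg (inv_nonneg.2 (Nat.cast_nonneg
      (Fintype.card C))) (hP c o) : (0 : ℝ) ≤ (Fintype.card C : ℝ)⁻¹ * P c o)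
    linarith
  have htot : ∑ e : Fin K → C, (∏ i, u i (e i)) * ∑ m, ∑ o with d e o ≠ m, P (e m) o ≤
      ∑ e : Fin K → C, (∏ i, u i (e i)) * (K * unionBound P K) := by
    rw [← sum_mul, ProductLaw.sum_prod_eq_one hu1, one_mul]
    calc _ ≤ ∑ e : Fin K → C, (∏ i, u i (e i)) * ∑ m, ((∑ o, P (e m) o * a (e m) o) +
          ∑ m' ∈ univ.erase m, ∑ o, P (e m) o * b (e m) (e m') o) :=
          sum_le_sum fun e _ => mul_le_mul_of_nonneg_left (sum_le_sum fun m _ => herr e m)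
            (prod_nonneg fun i _ => by simp only [hu]; positivity)
      _ = ∑ m, ∑ e : Fin K → C, (∏ i, u i (e i)) * ((∑ o, P (e m) o * a (e m) o) +
          ∑ m' ∈ univ.erase m, ∑ o, P (e m) o * b (e m) (e m') o) := by
          simp_rw [mul_sum univ]
          exact sum_comm
      _ ≤ ∑ m : Fin K, unionBound P K := sum_le_sum fun m _ => hmean m
      _ = _ := by simp
  obtain ⟨e, -, he⟩ := exists_le_of_sum_le univ_nonempty htot
  refine ⟨e, d e, le_of_mul_le_mul_left he (prod_pos fun i _ => ?_)⟩
  simp only [hu]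
  positivity

open Classical in
/-- Expurgated random coding: the maximal error is at most twice the union bound for
twice as many words. -/
theorem exists_code_maxError_le [Nonempty C] {P : C → O → ℝ} (hP : ∀ c o, 0 ≤ P c o) {M : ℕ}
    (hM : 0 < M) : ∃ (e : Fin M → C) (d : O → Fin M),
      ∀ m, ∑ o with d o ≠ m, P (e m) o ≤ 2 * unionBound P (2 * M) := by
  -- Among `2 M` words, by Markov's inequality, at least `M` have error at most twice the average
  -- bound.
  obtain ⟨e, d, h⟩ := exists_codebook hP (K := 2 * M) (by omega)
  push_cast at h
  set ε := unionBound P (2 * M) with hε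
  have hε0 : 0 ≤ ε := unionBound_nonneg hP (by positivity)
  set err : Fin (2 * M) → ℝ := fun m => ∑ o with d o ≠ m, P (e m) o with herr
  have herr0 : ∀ m, 0 ≤ err m := fun m => sum_nonneg fun o _ => hP _ _
  set good : Finset (Fin (2 * M)) := {m | err m ≤ 2 * ε} with hgood
  have hcard : M ≤ #good := by
    by_contra hlt
    have hc : #good + #({m | ¬ err m ≤ 2 * ε} : Finset (Fin (2 * M))) = 2 * M := by
      rw [hgood, card_filter_add_card_filter_not, card_univ, Fintype.card_fin]
    have hbad : M + 1 ≤ #({m | ¬ err m ≤ 2 * ε} : Finset (Fin (2 * M))) := by omega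
    have hbad' : ((M : ℝ) + 1) ≤ #({m | ¬ err m ≤ 2 * ε} : Finset (Fin (2 * M))) := by
      exact_mod_cast hbad
    have h1 : ∑ m ∈ ({m | ¬ err m ≤ 2 * ε} : Finset (Fin (2 * M))), 2 * ε <
        ∑ m ∈ ({m | ¬ err m ≤ 2 * ε} : Finset (Fin (2 * M))), err m :=
      sum_lt_sum_of_nonempty (card_pos.1 (by omega)) fun m hm => not_le.1 (mem_filter.1 hm).2
    have h2 : ∑ m ∈ ({m | ¬ err m ≤ 2 * ε} : Finset (Fin (2 * M))), err m ≤ ∑ m, err m :=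
      sum_le_sum_of_subset_of_nonneg (filter_subset _ _) fun m _ _ => herr0 m
    rw [sum_const, nsmul_eq_mul] at h1
    have h3 : ((M : ℝ) + 1) * (2 * ε) ≤
      #({m | ¬ err m ≤ 2 * ε} : Finset (Fin (2 * M))) * (2 * ε) := by gcongr
    nlinarith
  have : Nonempty (Fin M) := ⟨⟨0, hM⟩⟩
  set j := good.orderEmbOfCardLe hcard with hj
  -- Outputs decoded to a discarded word receive an arbitrary message. They were already errors for
  -- every kept word.
  refine ⟨fun m => e (j m), fun o => Function.invFun j (d o), fun m => ?_⟩
  have hm : err (j m) ≤ 2 * ε := (mem_filter.1 (good.orderEmbOfCardLe_mem hcard m)).2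
  refine le_trans (sum_le_sum_of_subset_of_nonneg ?_ fun o _ _ => hP _ _) hm
  intro o ho
  simp only [mem_filter, mem_univ, true_and] at ho ⊢
  intro hd
  apply ho
  rw [hd]
  exact Function.leftInverse_invFun j.injective m

end RandomCoding

end ChannelCoding

/-! ### Achievability: the union bound with its polynomial prefactor. -/

namespace ChannelCoding

open Finset

variable {X Y : Type*} [Fintype X] [Fintype Y] [Nonempty X] {W : X → Y → ℝ}

open Classical in
/-- The backward channel of the tilted joint law (uniform where the output is unreachable). -/
def backwardLaw (W : X → Y → ℝ) (ρ : ℝ) (y : Y) (x : X) : ℝ :=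
  if tiltedOutput W ρ (uniformInput X) y = 0 then uniformInput X x
  else uniformInput X x * W x y ^ (1 / (1 + ρ)) / tiltedOutput W ρ (uniformInput X) y

theorem backwardLaw_nonneg (hW : IsChannel W) (ρ : ℝ) (y : Y) (x : X) :
    0 ≤ backwardLaw W ρ y x := by
  rw [backwardLaw]
  split_ifs
  · exact (uniformInput_pos x).le
  · exact div_nonneg (mul_nonneg (uniformInput_pos x).le (Real.rpow_nonneg (hW.nonneg _ _) _))
      (tiltedOutput_nonneg hW ρ uniformInput_mem.1 y)

theorem sum_backwardLaw (ρ : ℝ) (y : Y) : ∑ x, backwardLaw W ρ y x = 1 := by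
  simp only [backwardLaw]
  split_ifs with h
  · exact uniformInput_mem.2
  · rw [← sum_div]; exact div_self h

theorem backwardLaw_pos (hW : IsChannel W) (ρ : ℝ) {x : X} {y : Y} (h : 0 < W x y) :
    0 < backwardLaw W ρ y x := by
  have hα := tiltedOutput_pos hW ρ uniformInput_mem.1 (uniformInput_pos x) h
  rw [backwardLaw, if_neg hα.ne']
  exact div_pos (mul_pos (uniformInput_pos x) (Real.rpow_pos_of_pos h _)) hα

theorem uniformInput_mul_rpow (hW : IsChannel W) (ρ : ℝ) {x : X} {y : Y} (h : 0 < W x y) :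
    uniformInput X x * W x y ^ (1 / (1 + ρ)) =
      backwardLaw W ρ y x * tiltedOutput W ρ (uniformInput X) y := by
  have hα := tiltedOutput_pos hW ρ uniformInput_mem.1 (uniformInput_pos x) h
  rw [backwardLaw, if_neg hα.ne', div_mul_cancel₀ _ hα.ne']

open Classical in
/-- For a nonsingular channel the log-likelihood has, under the backward law, exponential moments
of the order of the concentration function. -/
theorem exists_expMoment_backwardLaw_le (hW : IsChannel W) {x₁ x₂ : X} {b : Y}
    (h₁ : 0 < W x₁ b) (hlt : W x₁ b < W x₂ b) (ρ : ℝ) {a : ℝ} (ha : 0 < a) :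
    ∃ K : ℝ, 0 < K ∧ ∀ (N : ℕ) (o : Fin N → Y) (t : ℝ),
      ∑ c : Fin N → X, (∏ n, backwardLaw W ρ (o n) (c n)) *
        Real.exp (-a * |∑ n, Real.log (W (c n) (o n)) - t|) ≤
      K * (1 + (#{n | o n = b} : ℝ)) ^ (-(1 / 2) : ℝ) := by
  have h₂ := h₁.trans hlt
  set Δ := Real.log (W x₂ b) - Real.log (W x₁ b) with hΔdef
  have hΔ : 0 < Δ := sub_pos.2 (Real.log_lt_log h₁ hlt)
  -- The cap `1 / 2` is what the window bound requires.
  set δ := min (min (backwardLaw W ρ b x₁) (backwardLaw W ρ b x₂)) (1 / 2) with hδdef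
  have hδ : 0 < δ := lt_min (lt_min (backwardLaw_pos hW ρ h₁) (backwardLaw_pos hW ρ h₂))
    (by norm_num)
  set J := Real.exp (a * Δ) * ∑' j : ℤ, Real.exp (-(a * Δ) * |(j : ℝ)|) with hJ
  have hJ0 : 0 < J := mul_pos (Real.exp_pos _)
    ((ProductLaw.summable_exp_neg_abs (mul_pos ha hΔ)).tsum_pos (fun _ => (Real.exp_pos _).le) 0
      (Real.exp_pos _))
  refine ⟨(3 / δ) ^ (1 / 2 : ℝ) * J, by positivity, fun N o t => ?_⟩
  have hz : x₁ ≠ x₂ := by rintro rfl; exact lt_irrefl _ hlt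
  have hwin := ProductLaw.sum_prod_window_le (ι := Fin N) (p := fun n => backwardLaw W ρ (o n))
    (fun n => backwardLaw_nonneg hW ρ (o n)) (fun n => sum_backwardLaw ρ (o n))
    (fun n x => Real.log (W x (o n))) hz hΔ hδ (min_le_right _ _) ({n | o n = b} : Finset (Fin N))
    (fun n hn => by
      rw [(mem_filter.1 hn).2]; exact (min_le_left _ _).trans (min_le_left _ _))
    (fun n hn => by
      rw [(mem_filter.1 hn).2]; exact (min_le_left _ _).trans (min_le_right _ _))
    (fun n hn => by rw [(mem_filter.1 hn).2, hΔdef]; ring)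
  have h := ProductLaw.sum_mul_exp_neg_abs_le
    (p := fun c : Fin N → X => ∏ n, backwardLaw W ρ (o n) (c n))
    (fun c => prod_nonneg fun n _ => backwardLaw_nonneg hW ρ (o n) (c n))
    (fun c => ∑ n, Real.log (W (c n) (o n))) hΔ ha (fun t => by convert hwin t) t
  refine h.trans (le_of_eq ?_)
  rw [← hJ]
  ring

/-- The likelihood of an output word under the memoryless channel. -/
def wordProb (W : X → Y → ℝ) {N : ℕ} (c : Fin N → X) (o : Fin N → Y) : ℝ := ∏ n, W (c n) (o n)

theorem wordProb_pos_iff (hW : IsChannel W) {N : ℕ} {c : Fin N → X} {o : Fin N → Y} :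
    0 < wordProb W c o ↔ ∀ n, 0 < W (c n) (o n) := by
  refine ⟨fun h n => ?_, fun h => prod_pos fun n _ => h n⟩
  refine lt_of_le_of_ne (hW.nonneg _ _) fun h0 => h.ne' ?_
  exact prod_eq_zero (mem_univ n) h0.symm

theorem wordProb_nonneg (hW : IsChannel W) {N : ℕ} (c : Fin N → X) (o : Fin N → Y) :
    0 ≤ wordProb W c o := prod_nonneg fun _ _ => hW.nonneg _ _

theorem log_wordProb {N : ℕ} {c : Fin N → X} {o : Fin N → Y}
    (h : ∀ n, 0 < W (c n) (o n)) :
    Real.log (wordProb W c o) = ∑ n, Real.log (W (c n) (o n)) :=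
  Real.log_prod fun n _ => (h n).ne'

/-- Exponential tilting of the uniform law on input words. -/
theorem inv_card_mul_rpow (hW : IsChannel W) (ρ : ℝ) {N : ℕ} {c : Fin N → X} {o : Fin N → Y}
    (h : ∀ n, 0 < W (c n) (o n)) :
    (Fintype.card (Fin N → X) : ℝ)⁻¹ * wordProb W c o ^ (1 / (1 + ρ)) =
      (∏ n, backwardLaw W ρ (o n) (c n)) * ∏ n, tiltedOutput W ρ (uniformInput X) (o n) := by
  rw [wordProb, ← Real.finsetProd_rpow _ _ fun n _ => hW.nonneg _ _, ← prod_mul_distrib]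
  have e : (Fintype.card (Fin N → X) : ℝ)⁻¹ = ∏ n, uniformInput X (c n) := by
    simp [uniformInput]
  rw [e, ← prod_mul_distrib]
  exact prod_congr rfl fun n _ => uniformInput_mul_rpow hW ρ (h n)

open Classical in
/-- The pairwise error probability bound with its polynomial prefactor. -/
theorem pairwiseProb_le (hW : IsChannel W) {ρ : ℝ} (hρ : 0 ≤ ρ) {N : ℕ} {c : Fin N → X}
    {o : Fin N → Y} (h : ∀ n, 0 < W (c n) (o n)) {κ : ℝ}
    (hκ : ∀ t, ∑ c : Fin N → X, (∏ n, backwardLaw W ρ (o n) (c n)) *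
        Real.exp (-(1 / (1 + ρ)) * |∑ n, Real.log (W (c n) (o n)) - t|) ≤ κ) :
    pairwiseProb (wordProb W) c o ≤ (∏ n, tiltedOutput W ρ (uniformInput X) (o n)) *
      wordProb W c o ^ (-(1 / (1 + ρ))) * κ := by
  have hP := (wordProb_pos_iff hW).2 h
  have hA0 : 0 ≤ ∏ n, tiltedOutput W ρ (uniformInput X) (o n) :=
    prod_nonneg fun n _ => tiltedOutput_nonneg hW ρ uniformInput_mem.1 _
  refine le_trans ?_ (mul_le_mul_of_nonneg_left (hκ (∑ n, Real.log (W (c n) (o n))))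
    (mul_nonneg hA0 (Real.rpow_nonneg hP.le _)))
  rw [pairwiseProb, mul_sum]
  refine sum_le_sum fun c' _ => ?_
  split_ifs with hle
  · have hP' := hP.trans_le hle
    have h' := (wordProb_pos_iff hW).1 hP'
    -- For a competitor at least as likely as `c` the absolute value can be dropped. Writing the
    -- uniform weight through the backward law then gives an equality of terms.
    have hlog : ∑ n, Real.log (W (c n) (o n)) ≤ ∑ n, Real.log (W (c' n) (o n)) := by
      rw [← log_wordProb h, ← log_wordProb h']
      exact Real.log_le_log hP hle
    rw [abs_of_nonneg (sub_nonneg.2 hlog), ← log_wordProb h, ← log_wordProb h']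
    have hs : 0 < 1 / (1 + ρ) := by positivity
    have e1 : Real.exp (-(1 / (1 + ρ)) *
        (Real.log (wordProb W c' o) - Real.log (wordProb W c o))) =
        wordProb W c' o ^ (-(1 / (1 + ρ))) * wordProb W c o ^ (1 / (1 + ρ)) := by
      rw [Real.rpow_def_of_pos hP', Real.rpow_def_of_pos hP, ← Real.exp_add]
      congr 1; ring
    have e2 := inv_card_mul_rpow hW ρ h'
    have e3 : wordProb W c o ^ (-(1 / (1 + ρ))) * wordProb W c o ^ (1 / (1 + ρ)) = 1 := by
      rw [← Real.rpow_add hP]; simp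
    have e4 : wordProb W c' o ^ (1 / (1 + ρ)) * wordProb W c' o ^ (-(1 / (1 + ρ))) = 1 := by
      rw [← Real.rpow_add hP']; simp
    rw [e1, mul_one]
    refine le_of_eq ?_
    calc (Fintype.card (Fin N → X) : ℝ)⁻¹
        = (Fintype.card (Fin N → X) : ℝ)⁻¹ * wordProb W c' o ^ (1 / (1 + ρ)) *
          wordProb W c' o ^ (-(1 / (1 + ρ))) := by rw [mul_assoc, e4, mul_one]
      _ = _ := by
        rw [e2]
        linear_combination (-(∏ n, backwardLaw W ρ (o n) (c' n)) *
          (∏ n, tiltedOutput W ρ (uniformInput X) (o n)) * wordProb W c' o ^ (-(1 / (1 + ρ)))) * e3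
  · rw [mul_zero]
    exact mul_nonneg (mul_nonneg hA0 (Real.rpow_nonneg hP.le _))
      (mul_nonneg (prod_nonneg fun n _ => backwardLaw_nonneg hW ρ _ _) (Real.exp_pos _).le)

/-- Gallager's bound `min 1 u ≤ u ^ ρ` is sharp only near `u = 1`: its slack is `exp (-ρ |log u|)`
above `1` and `exp (-(1-ρ) |log u|)` below. Keeping the slack gains a further factor `N^(-1/2)`. -/
theorem min_one_le_rpow_mul_exp (ρ : ℝ) {u : ℝ} (hu : 0 < u) :
    min 1 u ≤ u ^ ρ * Real.exp (-(min ρ (1 - ρ)) * |Real.log u|) := by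
  rw [Real.rpow_def_of_pos hu, ← Real.exp_add]
  rcases le_total 1 u with h | h
  · have hl := Real.log_nonneg h
    rw [min_eq_left h, abs_of_nonneg hl]
    refine Real.one_le_exp ?_
    nlinarith [min_le_left ρ (1 - ρ)]
  · have hl := Real.log_nonpos hu.le h
    rw [min_eq_right h, abs_of_nonpos hl]
    conv_lhs => rw [← Real.exp_log hu]
    refine Real.exp_le_exp.2 ?_
    nlinarith [min_le_right ρ (1 - ρ)]

open Classical in
/-- The refined bound on the random coding union bound. -/
theorem exists_unionBound_le (hW : IsChannel W) (hns : ¬ IsSingular W) {ρ : ℝ}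
    (hρ : ρ ∈ Set.Ioo (0 : ℝ) 1) : ∃ C : ℝ, 0 < C ∧ ∀ (N : ℕ) (L : ℝ), 1 ≤ N → 0 < L →
      unionBound (wordProb (N := N) W) L ≤
        C * L ^ ρ * gallagerSum W ρ (uniformInput X) ^ N / (N : ℝ) ^ ((1 / 2 : ℝ) * (1 + ρ)) := by
  obtain ⟨hρ0, hρ1⟩ := hρ
  obtain ⟨x₁, x₂, b, h₁, hlt⟩ : ∃ x₁ x₂ b, 0 < W x₁ b ∧ W x₁ b < W x₂ b := by
    simp only [IsSingular, not_forall] at hns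
    obtain ⟨x, b, z, hpos, hne⟩ := hns
    have hx : 0 < W x b := pos_of_mul_pos_left hpos (hW.nonneg z b)
    have hz : 0 < W z b := pos_of_mul_pos_right hpos (hW.nonneg x b)
    rcases lt_or_gt_of_ne hne with h | h
    · exact ⟨x, z, b, hx, h⟩
    · exact ⟨z, x, b, hz, h⟩
  set s := 1 / (1 + ρ) with hs
  have hs0 : 0 < s := by positivity
  set a := min ρ (1 - ρ) with ha
  have ha0 : 0 < a := lt_min hρ0 (by linarith)
  obtain ⟨K₁, hK₁, hm₁⟩ := exists_expMoment_backwardLaw_le hW h₁ hlt ρ hs0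
  obtain ⟨K₂, hK₂, hm₂⟩ := exists_expMoment_backwardLaw_le hW h₁ hlt ρ (mul_pos ha0 hs0)
  set F := gallagerSum W ρ (uniformInput X) with hF
  have hF0 : 0 < F := gallagerSum_pos hW ρ uniformInput_mem
  set π := tiltedLaw W ρ b with hπ
  have hπ0 : 0 < π := tiltedLaw_pos hW ρ h₁
  set θ := (1 / 2 : ℝ) * (1 + ρ) with hθ
  have hθ0 : 0 < θ := by positivity
  have hθ1 : θ ≤ 1 := by rw [hθ]; linarith
  refine ⟨K₁ ^ ρ * K₂ * (6 / π) ^ θ, by positivity, fun N L hN hL => ?_⟩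
  have hN0 : (0 : ℝ) < N := by exact_mod_cast hN
  set κ : (Fin N → Y) → ℝ := fun o => (1 + (#{n | o n = b} : ℝ)) ^ (-(1 / 2) : ℝ) with hκ
  have hκ0 : ∀ o, 0 < κ o := fun o => by simp only [hκ]; positivity
  set A : (Fin N → Y) → ℝ := fun o => ∏ n, tiltedOutput W ρ (uniformInput X) (o n) with hA
  have hA0 : ∀ o, 0 ≤ A o := fun o =>
    prod_nonneg fun n _ => tiltedOutput_nonneg hW ρ uniformInput_mem.1 _
  have hinner : ∀ o, ∑ c, (Fintype.card (Fin N → X) : ℝ)⁻¹ *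
      (wordProb W c o * min 1 (L * pairwiseProb (wordProb W) c o)) ≤
      (L * K₁) ^ ρ * K₂ * (A o ^ (1 + ρ) * κ o ^ (1 + ρ)) := by
    intro o
    -- The centre for which `|log u| = s |∑ log W - t|`. If `A o = 0` its value is irrelevant,
    -- because no word then has positive likelihood.
    set t := Real.log (L * K₁ * A o * κ o) / s with ht
    have hterm : ∀ c, (Fintype.card (Fin N → X) : ℝ)⁻¹ *
        (wordProb W c o * min 1 (L * pairwiseProb (wordProb W) c o)) ≤
        (L * K₁) ^ ρ * A o ^ (1 + ρ) * κ o ^ ρ * ((∏ n, backwardLaw W ρ (o n) (c n)) *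
          Real.exp (-(a * s) * |∑ n, Real.log (W (c n) (o n)) - t|)) := by
      intro c
      have hrhs : 0 ≤ (L * K₁) ^ ρ * A o ^ (1 + ρ) * κ o ^ ρ *
          ((∏ n, backwardLaw W ρ (o n) (c n)) *
          Real.exp (-(a * s) * |∑ n, Real.log (W (c n) (o n)) - t|)) := by
        have h1 := Real.rpow_nonneg (hA0 o) (1 + ρ)
        have h2 := Real.rpow_nonneg (hκ0 o).le ρ
        have h3 : 0 ≤ ∏ n, backwardLaw W ρ (o n) (c n) :=
          prod_nonneg fun n _ => backwardLaw_nonneg hW ρ _ _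
        positivity
      rcases (wordProb_nonneg hW c o).eq_or_lt with h0 | hP
      · rw [← h0]; simpa using hrhs
      have h := (wordProb_pos_iff hW).1 hP
      have hApos : 0 < A o := prod_pos fun n _ =>
        tiltedOutput_pos hW ρ uniformInput_mem.1 (uniformInput_pos (c n)) (h n)
      have hpw := pairwiseProb_le hW hρ0.le h (hm₁ N o)
      set P := wordProb W c o with hPdef
      set u := L * K₁ * A o * κ o * P ^ (-s) with hu
      have hu0 : 0 < u := by
        have := hκ0 o
        have := Real.rpow_pos_of_pos hP (-s)
        positivity
      have hmin : min 1 (L * pairwiseProb (wordProb W) c o) ≤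
          u ^ ρ * Real.exp (-a * |Real.log u|) := by
        refine le_trans (min_le_min le_rfl ?_) (min_one_le_rpow_mul_exp ρ hu0)
        have := mul_le_mul_of_nonneg_left hpw hL.le
        refine this.trans (le_of_eq ?_)
        rw [hu]
        ring
      have hlogu : |Real.log u| = s * |∑ n, Real.log (W (c n) (o n)) - t| := by
        have hpos : L * K₁ * A o * κ o ≠ 0 := by
          have := hκ0 o
          positivity
        rw [hu, Real.log_mul hpos (Real.rpow_pos_of_pos hP _).ne', Real.log_rpow hP,
          hPdef, log_wordProb h, ht, abs_sub_comm, ← abs_of_pos hs0, ← abs_mul, abs_of_pos hs0]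
        congr 1
        field_simp
        ring
      have hurho : u ^ ρ = (L * K₁) ^ ρ * A o ^ ρ * κ o ^ ρ * P ^ (-s * ρ) := by
        rw [hu, Real.mul_rpow (by have := hκ0 o; positivity) (Real.rpow_nonneg hP.le _),
          Real.mul_rpow (by positivity) (hκ0 o).le, Real.mul_rpow (by positivity) (hA0 o),
          Real.rpow_mul hP.le]
      -- Since `s (1 + ρ) = 1`, the remaining power is exactly the one that tilts the uniform law to
      -- the backward law.
      have hPs : P * P ^ (-s * ρ) = P ^ s := by
        conv_lhs => rw [← Real.rpow_one P]
        rw [← Real.rpow_mul hP.le, ← Real.rpow_add hP]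
        congr 1
        rw [hs]
        field_simp
        ring
      have htilt := inv_card_mul_rpow hW ρ h
      calc (Fintype.card (Fin N → X) : ℝ)⁻¹ *
            (P * min 1 (L * pairwiseProb (wordProb W) c o))
          ≤ (Fintype.card (Fin N → X) : ℝ)⁻¹ * (P * (u ^ ρ * Real.exp (-a * |Real.log u|))) := by
            gcongr
        _ = (L * K₁) ^ ρ * A o ^ ρ * κ o ^ ρ *
            ((Fintype.card (Fin N → X) : ℝ)⁻¹ * (P * P ^ (-s * ρ))) *
              Real.exp (-a * |Real.log u|) := by rw [hurho]; ring
        _ = _ := by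
            rw [hPs, hPdef, hs, htilt, ← hs, hlogu, ← rpow_mul_self (hA0 o) hρ0.le]
            rw [show -a * (s * |∑ n, Real.log (W (c n) (o n)) - t|) =
              -(a * s) * |∑ n, Real.log (W (c n) (o n)) - t| by ring]
            ring
    refine (sum_le_sum fun c _ => hterm c).trans ?_
    rw [← mul_sum]
    have h1 := Real.rpow_nonneg (hA0 o) (1 + ρ)
    have h2 := Real.rpow_nonneg (hκ0 o).le ρ
    refine (mul_le_mul_of_nonneg_left (hm₂ N o t) (by positivity)).trans (le_of_eq ?_)
    rw [← rpow_mul_self (hκ0 o).le hρ0.le]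
    ring
  have hlaw : ∀ o : Fin N → Y, A o ^ (1 + ρ) = F ^ N * ∏ n, tiltedLaw W ρ (o n) := by
    intro o
    simp only [hA, tiltedLaw]
    rw [← Real.finsetProd_rpow _ _ fun n _ => tiltedOutput_nonneg hW ρ uniformInput_mem.1 _,
      prod_div_distrib, prod_const, card_univ, Fintype.card_fin, mul_div_cancel₀ _ (by positivity)]
  have hκθ : ∀ o : Fin N → Y, κ o ^ (1 + ρ) =
      (1 + ∑ n, if o n = b then (1 : ℝ) else 0) ^ (-θ) := by
    intro o
    simp only [hκ]
    rw [← Real.rpow_mul (by positivity), card_filter]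
    push_cast
    congr 1
    rw [hθ]; ring
  -- Under the tilted output law the number of occurrences of `b` has mean `N π`. The exponent `θ =
  -- (1 + ρ) / 2` is at most `1`, as Jensen's inequality requires.
  have hmom := ProductLaw.sum_prod_mul_rpow_neg_le (ι := Fin N) (p := fun _ => tiltedLaw W ρ)
    (fun _ => tiltedLaw_nonneg hW ρ) (fun _ => sum_tiltedLaw hW ρ)
    (χ := fun _ y => if y = b then 1 else 0)
    (fun i c => by split_ifs <;> norm_num) (fun i c => by split_ifs <;> norm_num) hθ0.le hθ1
  simp only [mul_ite, mul_one, mul_zero, sum_ite_eq', mem_univ, if_true, sum_const, card_univ,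
    Fintype.card_fin, nsmul_eq_mul] at hmom
  calc unionBound (wordProb (N := N) W) L
      = ∑ o, ∑ c, (Fintype.card (Fin N → X) : ℝ)⁻¹ *
        (wordProb W c o * min 1 (L * pairwiseProb (wordProb W) c o)) := sum_comm
    _ ≤ ∑ o, (L * K₁) ^ ρ * K₂ * (A o ^ (1 + ρ) * κ o ^ (1 + ρ)) :=
        sum_le_sum fun o _ => hinner o
    _ = (L * K₁) ^ ρ * K₂ * F ^ N * ∑ o : Fin N → Y, (∏ n, tiltedLaw W ρ (o n)) *
          (1 + ∑ n, if o n = b then (1 : ℝ) else 0) ^ (-θ) := by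
        rw [mul_sum]
        refine sum_congr rfl fun o _ => ?_
        rw [hlaw, hκθ]; ring
    _ ≤ (L * K₁) ^ ρ * K₂ * F ^ N * (6 / (1 + N * π)) ^ θ := by
        gcongr
    _ ≤ (L * K₁) ^ ρ * K₂ * F ^ N * (6 / π / N) ^ θ := by
        have h6 : 6 / (1 + N * π) ≤ 6 / π / N := by
          rw [div_div, mul_comm π]
          gcongr
          linarith
        gcongr
    _ = _ := by
        rw [Real.div_rpow (by positivity) hN0.le, Real.mul_rpow hL.le hK₁.le]
        ring

theorem numMessages_pos (N : ℕ) (R : ℝ) : 0 < numMessages N R :=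
  Nat.ceil_pos.2 (Real.exp_pos _)

theorem numMessages_le {N : ℕ} {R : ℝ} (hR : 0 ≤ R) :
    (numMessages N R : ℝ) ≤ 2 * Real.exp (N * R) := by
  have h1 := (Nat.ceil_lt_add_one (Real.exp_pos (N * R)).le).le
  have h2 : 1 ≤ Real.exp (N * R) := Real.one_le_exp (by positivity)
  rw [numMessages]
  linarith

/-- Achievability: the refined random coding bound for the minimal maximal error probability. -/
theorem exists_minMaxError_le (hW : IsChannel W) (hns : ¬ IsSingular W) {ρ : ℝ}
    (hρ : ρ ∈ Set.Ioo (0 : ℝ) 1) {R : ℝ} (hR : 0 ≤ R) : ∃ K : ℝ, 0 < K ∧ ∀ N : ℕ, 1 ≤ N →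
      minMaxError W N R ≤ K / (N : ℝ) ^ ((1 / 2 : ℝ) * (1 + ρ)) *
        Real.exp (-(N : ℝ) * (gallagerFun W ρ (uniformInput X) - ρ * R)) := by
  classical
  obtain ⟨C, hC, hbound⟩ := exists_unionBound_le hW hns hρ
  have hρ0 := hρ.1
  -- The factor `2` is the cost of expurgation; `4 ^ ρ` comes from using `2 M ≤ 4 exp (N R)` words.
  refine ⟨2 * C * 4 ^ ρ, by positivity, fun N hN => ?_⟩
  have hM := numMessages_pos N R
  set M := numMessages N R with hMdef
  have hM0 : (0 : ℝ) < M := by exact_mod_cast hM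
  have : Nonempty (Fin M) := ⟨⟨0, hM⟩⟩
  obtain ⟨e, d, hed⟩ := exists_code_maxError_le (C := Fin N → X) (P := wordProb (N := N) W)
    (fun c o => wordProb_nonneg hW c o) hM
  have hF0 := gallagerSum_pos hW ρ (uniformInput_mem (X := X))
  have hle : minMaxError W N R ≤ 2 * unionBound (wordProb (N := N) W) (2 * M) := by
    refine (ciInf_le ⟨0, ?_⟩ (⟨e, d⟩ : Code X Y N M)).trans (ciSup_le fun m => ?_)
    · rintro _ ⟨c, rfl⟩
      exact Real.iSup_nonneg fun m => sum_nonneg fun o _ => prod_nonneg fun n _ => hW.nonneg _ _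
    · refine le_trans (le_of_eq ?_) (hed m)
      simp only [Code.errorProb, wordProb]
  have hb := hbound N (2 * M) hN (by positivity)
  have hMρ : (2 * (M : ℝ)) ^ ρ ≤ 4 ^ ρ * Real.exp (N * R * ρ) := by
    calc (2 * (M : ℝ)) ^ ρ ≤ (4 * Real.exp (N * R)) ^ ρ := by
          refine Real.rpow_le_rpow (by positivity) ?_ hρ0.le
          have := numMessages_le (N := N) hR
          linarith
      _ = _ := by rw [Real.mul_rpow (by norm_num) (Real.exp_pos _).le, ← Real.exp_mul]
  have hexp : Real.exp (-(N : ℝ) * (gallagerFun W ρ (uniformInput X) - ρ * R)) =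
      Real.exp (N * R * ρ) * gallagerSum W ρ (uniformInput X) ^ N := by
    have hFN : gallagerSum W ρ (uniformInput X) ^ N =
        Real.exp (N * Real.log (gallagerSum W ρ (uniformInput X))) := by
      rw [Real.exp_nat_mul, Real.exp_log hF0]
    rw [hFN, ← Real.exp_add, gallagerFun_eq]
    congr 1; ring
  rw [hexp]
  calc minMaxError W N R ≤ 2 * unionBound (wordProb (N := N) W) (2 * M) := hle
    _ ≤ 2 * (C * (2 * (M : ℝ)) ^ ρ * gallagerSum W ρ (uniformInput X) ^ N /
        (N : ℝ) ^ ((1 / 2 : ℝ) * (1 + ρ))) := by gcongr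
    _ ≤ 2 * (C * (4 ^ ρ * Real.exp (N * R * ρ)) * gallagerSum W ρ (uniformInput X) ^ N /
        (N : ℝ) ^ ((1 / 2 : ℝ) * (1 + ρ))) := by gcongr
    _ = _ := by ring

end ChannelCoding

/-! ### Converse with feedback, through a binary hypothesis test. -/

namespace ChannelCoding

open Finset

variable {X Y : Type*} [Fintype X] [Fintype Y] [Nonempty X] [DecidableEq Y] {W : X → Y → ℝ}

/-- Trade-off of the two error probabilities for testing a fixed input word against the product of
the tilted output law. -/
def testSum (W : X → Y → ℝ) (ρ : ℝ) (N : ℕ) (γ : ℝ) : ℝ :=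
  ∑ o : Fin N → Y, min (wordProb W (fun _ => Classical.arbitrary X) o)
    (γ * ∏ n, tiltedLaw W ρ (o n))

/-- For symmetric channels, feedback does not change the law of the information density. -/
theorem sum_min_outputProb_eq (hs : IsSymmetric W) (ρ : ℝ) {N M : ℕ} (c : FeedbackCode X Y N M)
    (m : Fin M) (γ : ℝ) :
    ∑ o, min (c.outputProb W m o) (γ * ∏ n, tiltedLaw W ρ (o n)) = testSum W ρ N γ := by
  choose σ hσ using fun x => hs.exists_perm x (Classical.arbitrary X)
  have hlaw : ∀ x y, tiltedLaw W ρ y = tiltedLaw W ρ (σ x y) := fun x y => by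
    obtain ⟨-, τ, h⟩ := hσ x y
    rw [tiltedLaw, tiltedLaw, tiltedOutput_uniformInput_congr h]
  -- Each output is relabelled by the permutation taking the row in use to the reference row. The
  -- row depends only on earlier outputs, so these can be recovered one at a time and the map is
  -- injective. It preserves the tilted output law.
  let Φ : (Fin N → Y) → Fin N → Y := fun o n =>
    σ (c.enc n m fun i => o (Fin.castLE n.isLt.le i)) (o n)
  have hinj : Function.Injective Φ := by
    intro o o' h
    have key : ∀ k : ℕ, ∀ hk : k < N, o ⟨k, hk⟩ = o' ⟨k, hk⟩ := by
      intro k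
      induction k using Nat.strong_induction_on with
      | _ k ih =>
        intro hk
        have h1 := congrFun h ⟨k, hk⟩
        have h2 : (fun i : Fin k => o (Fin.castLE hk.le i)) = fun i => o' (Fin.castLE hk.le i) :=
          funext fun i => ih i i.isLt _
        simp only [Φ] at h1
        rw [h2] at h1
        exact (σ _).injective h1
    exact funext fun n => key n n.isLt
  refine Fintype.sum_equiv (Equiv.ofBijective Φ (Finite.injective_iff_bijective.1 hinj)) _ _
    fun o => ?_
  have h1 : c.outputProb W m o = wordProb W (fun _ => Classical.arbitrary X) (Φ o) :=
    prod_congr rfl fun n _ => (hσ _ (o n)).1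
  have h2 : ∏ n, tiltedLaw W ρ (o n) = ∏ n, tiltedLaw W ρ (Φ o n) :=
    prod_congr rfl fun n _ => hlaw _ (o n)
  rw [h1, h2]
  rfl

/-- Converse for codes with feedback in terms of the binary hypothesis test. -/
theorem testSum_sub_le_avgErrorProb (hW : IsChannel W) (hs : IsSymmetric W) (ρ : ℝ) {N M : ℕ}
    (hM : 0 < M) (c : FeedbackCode X Y N M) (γ : ℝ) :
    testSum W ρ N γ - γ / M ≤ c.avgErrorProb W := by
  set Q : (Fin N → Y) → ℝ := fun o => ∏ n, tiltedLaw W ρ (o n) with hQ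
  have hQ1 : ∑ o, Q o = 1 := ProductLaw.sum_prod_eq_one fun _ => sum_tiltedLaw hW ρ
  -- The minimum is bounded by `γ Q` on the decoding region and by the true law off it. The regions
  -- partition the outputs, so over all messages the subtracted terms add up to `γ`.
  have h1 : ∀ m, testSum W ρ N γ - γ * ∑ o with c.dec o = m, Q o ≤
      ∑ o with c.dec o ≠ m, c.outputProb W m o := by
    intro m
    rw [← sum_min_outputProb_eq hs ρ c m γ, ← sum_filter_add_sum_filter_not univ
      (fun o => c.dec o = m), mul_sum]
    have h2 : ∑ o with c.dec o = m, min (c.outputProb W m o) (γ * Q o) ≤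
        ∑ o with c.dec o = m, γ * Q o := sum_le_sum fun o _ => min_le_right _ _
    have h3 : ∑ o with ¬ c.dec o = m, min (c.outputProb W m o) (γ * Q o) ≤
        ∑ o with c.dec o ≠ m, c.outputProb W m o := sum_le_sum fun o _ => min_le_left _ _
    linarith
  have h4 := sum_le_sum fun m (_ : m ∈ univ) => h1 m
  rw [sum_sub_distrib, ← mul_sum, sum_fiberwise univ c.dec Q, hQ1, sum_const, card_univ,
    Fintype.card_fin, nsmul_eq_mul, mul_one] at h4
  have hM0 : (0 : ℝ) < M := by exact_mod_cast hM
  rw [FeedbackCode.avgErrorProb, one_div, inv_mul_eq_div, le_div_iff₀ hM0, sub_mul,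
    div_mul_cancel₀ _ hM0.ne']
  linarith

theorem testSum_sub_le_minAvgErrorFeedback (hW : IsChannel W) (hs : IsSymmetric W) (ρ : ℝ)
    (N : ℕ) (R : ℝ) {γ : ℝ} (hγ : 0 ≤ γ) :
    testSum W ρ N γ - γ * Real.exp (-(N * R)) ≤ minAvgErrorFeedback W N R := by
  have hM := numMessages_pos N R
  have : Nonempty (FeedbackCode X Y N (numMessages N R)) :=
    ⟨⟨fun _ _ _ => Classical.arbitrary X, fun _ => ⟨0, hM⟩⟩⟩
  refine le_ciInf fun c => le_trans ?_ (testSum_sub_le_avgErrorProb hW hs ρ hM c γ)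
  have h1 : Real.exp (N * R) ≤ numMessages N R := Nat.le_ceil _
  have h2 : γ / numMessages N R ≤ γ * Real.exp (-(N * R)) := by
    rw [Real.exp_neg, ← div_eq_mul_inv]
    exact div_le_div_of_nonneg_left hγ (Real.exp_pos _) h1
  linarith

open Classical in
theorem le_testSum (hW : IsChannel W) (ρ : ℝ) (N : ℕ) {γ : ℝ} (hγ : 0 ≤ γ) :
    γ * ∑ o : Fin N → Y, (∏ n, tiltedLaw W ρ (o n)) * (if γ * ∏ n, tiltedLaw W ρ (o n) ≤
      wordProb W (fun _ => Classical.arbitrary X) o then 1 else 0) ≤ testSum W ρ N γ := by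
  rw [testSum, mul_sum]
  refine sum_le_sum fun o _ => ?_
  have h0 : 0 ≤ ∏ n, tiltedLaw W ρ (o n) := prod_nonneg fun n _ => tiltedLaw_nonneg hW ρ _
  split_ifs with h
  · rw [mul_one, min_eq_right h]
  · rw [mul_zero, mul_zero]
    exact le_min (wordProb_nonneg hW _ _) (mul_nonneg hγ h0)

open Classical in
/-- The support of a row has tilted output probability larger than `exp (-R)`. -/
theorem exp_neg_tiltedRate_lt (hW : IsChannel W) (hs : IsSymmetric W) (hns : ¬ IsSingular W)
    {ρ : ℝ} (hρ : 0 ≤ ρ) (x : X) :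
    Real.exp (-tiltedRate W ρ) < ∑ y with 0 < W x y, tiltedLaw W ρ y := by
  obtain ⟨y₁, y₂, hy₁, hlt, hα⟩ := hs.exists_lt hW hns x
  have hy₂ := hy₁.trans hlt
  set q := ∑ y with 0 < W x y, tiltedLaw W ρ y with hq
  have hq0 : 0 < q := sum_pos (fun y hy => tiltedLaw_pos hW ρ (mem_filter.1 hy).2)
    ⟨y₁, by simpa using hy₁⟩
  have hV := isChannel_tiltedChannel hW hs hρ
  have hpos : ∀ y, 0 < tiltedChannel W ρ x y → 0 < W x y := fun y h =>
    lt_of_le_of_ne (hW.nonneg x y) fun h0 => h.ne' (tiltedChannel_eq_zero hρ h0.symm)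
  -- The reference is the tilted output law conditioned on the support of the row; the divergence
  -- from it is `tiltedRate + log q`. It is positive because the reference gives `y₁` and `y₂` equal
  -- mass while the tilted channel does not.
  have hg := sum_mul_log_div_pos (p := tiltedChannel W ρ x)
    (t := fun y => (if 0 < W x y then tiltedLaw W ρ y else 0) / q) (hV.nonneg x)
    (fun y => div_nonneg (by split_ifs; exacts [tiltedLaw_nonneg hW ρ y, le_rfl]) hq0.le)
    (fun y hy => by
      simp only [if_pos (hpos y hy)]
      exact div_pos (tiltedLaw_pos hW ρ (hpos y hy)) hq0)
    (by rw [← sum_div, ← sum_filter, ← hq, div_self hq0.ne', hV.sum_eq_one]) (by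
      by_contra hcon
      push Not at hcon
      have h1 := hcon y₁
      have h2 := hcon y₂
      simp only [if_pos hy₁, if_pos hy₂] at h1 h2
      have h3 : tiltedLaw W ρ y₁ = tiltedLaw W ρ y₂ := by rw [tiltedLaw, tiltedLaw, hα]
      have h4 : tiltedChannel W ρ x y₁ < tiltedChannel W ρ x y₂ := by
        have hα₂ := tiltedOutput_pos hW ρ uniformInput_mem.1 (uniformInput_pos x) hy₂
        have hF := gallagerSum_pos hW ρ (uniformInput_mem (X := X))
        rw [tiltedChannel, tiltedChannel, hα]
        have := Real.rpow_lt_rpow hy₁.le hlt (by positivity : 0 < 1 / (1 + ρ))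
        gcongr
      rw [h1, h2, h3] at h4
      exact lt_irrefl _ h4)
  have e : ∑ y, tiltedChannel W ρ x y * Real.log (tiltedChannel W ρ x y /
      ((if 0 < W x y then tiltedLaw W ρ y else 0) / q)) = tiltedRate W ρ + Real.log q := by
    have h1 : Real.log q = ∑ y, tiltedChannel W ρ x y * Real.log q := by
      rw [← sum_mul, hV.sum_eq_one, one_mul]
    rw [← tiltedRate_eq hs ρ x, h1, ← sum_add_distrib]
    refine sum_congr rfl fun y _ => ?_
    rcases (hV.nonneg x y).eq_or_lt with h0 | h0
    · rw [← h0]; ring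
    · have hw := hpos y h0
      have ht := tiltedLaw_pos hW ρ hw
      rw [← log_tiltedChannel_div_tiltedLaw hW hw, if_pos hw, div_div_eq_mul_div,
        Real.log_div (mul_pos h0 hq0).ne' ht.ne', Real.log_mul h0.ne' hq0.ne',
        Real.log_div h0.ne' ht.ne']
      ring
  rw [e] at hg
  rw [← Real.exp_log hq0]
  exact Real.exp_lt_exp.2 (by linarith)

/-- Needed for the finitely many block lengths not covered asymptotically. For small `γ` the test
sum is at least `γ q ^ N`, where `q` is the tilted output mass of the support of a row, and `q > exp
(-R)`. -/
theorem minAvgErrorFeedback_pos (hW : IsChannel W) (hs : IsSymmetric W) (hns : ¬ IsSingular W)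
    {ρ : ℝ} (hρ : 0 ≤ ρ) {N : ℕ} (hN : 1 ≤ N) :
    0 < minAvgErrorFeedback W N (tiltedRate W ρ) := by
  classical
  set x : X := Classical.arbitrary X with hx
  set P : (Fin N → Y) → ℝ := wordProb W fun _ => x with hP
  set Q : (Fin N → Y) → ℝ := fun o => ∏ n, tiltedLaw W ρ (o n) with hQ
  have hQ0 : ∀ o, 0 ≤ Q o := fun o => prod_nonneg fun n _ => tiltedLaw_nonneg hW ρ _
  obtain ⟨γ, hγ, hle⟩ : ∃ γ : ℝ, 0 < γ ∧ ∀ o, 0 < P o → γ * Q o ≤ P o := by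
    have hfin : ∀ o, ∃ γ : ℝ, 0 < γ ∧ ∀ γ' : ℝ, 0 ≤ γ' → γ' ≤ γ → 0 < P o → γ' * Q o ≤ P o := by
      intro o
      by_cases h : 0 < P o
      · refine ⟨P o / (Q o + 1), div_pos h (by linarith [hQ0 o]), fun γ' h0 h1 _ => ?_⟩
        rw [le_div_iff₀ (by linarith [hQ0 o])] at h1
        nlinarith
      · exact ⟨1, one_pos, fun _ _ _ h' => absurd h' h⟩
    choose γ hγ hγ' using hfin
    by_cases hne : Nonempty (Fin N → Y)
    · obtain ⟨o₀, ho₀⟩ := Finite.exists_min γ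
      exact ⟨γ o₀, hγ o₀, fun o => hγ' o _ (hγ o₀).le (ho₀ o)⟩
    · exact ⟨1, one_pos, fun o => absurd ⟨o⟩ hne⟩
  refine lt_of_lt_of_le ?_
    (testSum_sub_le_minAvgErrorFeedback hW hs ρ N (tiltedRate W ρ) hγ.le)
  have h1 := le_testSum hW ρ N hγ.le
  set q := ∑ y with 0 < W x y, tiltedLaw W ρ y with hq
  have hqN : q ^ N ≤ ∑ o : Fin N → Y, (∏ n, tiltedLaw W ρ (o n)) *
      (if γ * ∏ n, tiltedLaw W ρ (o n) ≤ wordProb W (fun _ => x) o then 1 else 0) := by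
    have e : q ^ N = ∑ o : Fin N → Y, (∏ n, tiltedLaw W ρ (o n)) *
        ∏ n, (if 0 < W x (o n) then (1 : ℝ) else 0) := by
      rw [ProductLaw.sum_prod_mul_prod (fun _ => tiltedLaw W ρ)
        (fun _ y => if 0 < W x y then (1 : ℝ) else 0)]
      simp only [mul_ite, mul_one, mul_zero, ← sum_filter, prod_const, card_univ,
        Fintype.card_fin, ← hq]
    rw [e]
    refine sum_le_sum fun o _ => mul_le_mul_of_nonneg_left ?_ (hQ0 o)
    by_cases h : ∀ n, 0 < W x (o n)
    · rw [if_pos (hle o (prod_pos fun n _ => h n))]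
      simp [h]
    · push Not at h
      obtain ⟨n, hn⟩ := h
      rw [prod_eq_zero (mem_univ n) (if_neg (not_lt.2 hn))]
      split_ifs <;> norm_num
  have h2 : Real.exp (-(N * tiltedRate W ρ)) < q ^ N := by
    rw [← mul_neg, Real.exp_nat_mul]
    exact pow_lt_pow_left₀ (exp_neg_tiltedRate_lt hW hs hns hρ x) (Real.exp_pos _).le (by omega)
  have h3 := mul_lt_mul_of_pos_left (h2.trans_le hqN) hγ
  linarith

/-- Change of measure between the tilted channel and the tilted output law. -/
theorem tiltedChannel_eq_mul_exp (hW : IsChannel W) {ρ : ℝ} (hρ : 0 ≤ ρ) {x : X} {y : Y}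
    (h : 0 < W x y) :
    tiltedChannel W ρ x y = tiltedLaw W ρ y *
      Real.exp (1 / (1 + ρ) * (Real.log (W x y) - Real.log (tiltedLaw W ρ y)) -
        1 / (1 + ρ) * Real.log (gallagerSum W ρ (uniformInput X))) := by
  have hV := tiltedChannel_pos hW ρ h
  have ht := tiltedLaw_pos hW ρ h
  have hα := tiltedOutput_pos hW ρ uniformInput_mem.1 (uniformInput_pos x) h
  have hF := gallagerSum_pos hW ρ (uniformInput_mem (X := X))
  have h1 := log_tiltedChannel_div_tiltedLaw hW (ρ := ρ) h
  have h2 : Real.log (tiltedLaw W ρ y) = (1 + ρ) *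
      Real.log (tiltedOutput W ρ (uniformInput X) y) -
      Real.log (gallagerSum W ρ (uniformInput X)) := by
    rw [tiltedLaw, Real.log_div (Real.rpow_pos_of_pos hα _).ne' hF.ne', Real.log_rpow hα]
  have h3 : 1 / (1 + ρ) * (Real.log (W x y) - Real.log (tiltedLaw W ρ y)) -
      1 / (1 + ρ) * Real.log (gallagerSum W ρ (uniformInput X)) =
      Real.log (tiltedChannel W ρ x y / tiltedLaw W ρ y) := by
    rw [h1, h2]; field_simp; ring
  rw [h3, Real.exp_log (div_pos hV ht), mul_div_cancel₀ _ ht.ne']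

/-- The mean of the log-likelihood ratio under the tilted channel, around which the threshold of the
test is placed. -/
theorem sum_tiltedChannel_mul_density (hW : IsChannel W) (hs : IsSymmetric W) {ρ : ℝ}
    (hρ : 0 ≤ ρ) (x : X) :
    ∑ y, tiltedChannel W ρ x y * (Real.log (W x y) - Real.log (tiltedLaw W ρ y)) =
      (1 + ρ) * tiltedRate W ρ + Real.log (gallagerSum W ρ (uniformInput X)) := by
  have h1 : Real.log (gallagerSum W ρ (uniformInput X)) =
      ∑ y, tiltedChannel W ρ x y * Real.log (gallagerSum W ρ (uniformInput X)) := by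
    rw [← sum_mul, (isChannel_tiltedChannel hW hs hρ).sum_eq_one, one_mul]
  rw [← tiltedRate_eq hs ρ x, h1, mul_sum, ← sum_add_distrib]
  refine sum_congr rfl fun y _ => ?_
  rcases (hW.nonneg x y).eq_or_lt with h | h
  · rw [tiltedChannel_eq_zero hρ h.symm]; ring
  · have hα := tiltedOutput_pos hW ρ uniformInput_mem.1 (uniformInput_pos x) h
    have hF := gallagerSum_pos hW ρ (uniformInput_mem (X := X))
    rw [tiltedLaw, Real.log_div (Real.rpow_pos_of_pos hα _).ne' hF.ne', Real.log_rpow hα]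
    field_simp
    ring

open Classical in
/-- The refined sphere-packing bound for large block lengths. -/
theorem exists_le_minAvgErrorFeedback_of_large (hW : IsChannel W) (hs : IsSymmetric W)
    (hns : ¬ IsSingular W) {ρ : ℝ} (hρ : 0 ≤ ρ) :
    ∃ K : ℝ, 0 < K ∧ ∃ N₀ : ℕ, ∀ N : ℕ, N₀ ≤ N → 1 ≤ N →
      K / (N : ℝ) ^ ((1 / 2 : ℝ) * (1 + ρ)) * Real.exp (-(N : ℝ) *
        (gallagerFun W ρ (uniformInput X) - ρ * tiltedRate W ρ)) ≤
      minAvgErrorFeedback W N (tiltedRate W ρ) := by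
  set x : X := Classical.arbitrary X with hx
  set R := tiltedRate W ρ with hR
  set F := gallagerSum W ρ (uniformInput X) with hF
  have hF0 : 0 < F := gallagerSum_pos hW ρ uniformInput_mem
  set s := 1 / (1 + ρ) with hsdef
  have hs0 : 0 < s := by positivity
  set θ := (1 / 2 : ℝ) * (1 + ρ) with hθ
  have hθ0 : 0 < θ := by positivity
  have hsθ : s * θ = 1 / 2 := by rw [hsdef, hθ]; field_simp
  set f : Y → ℝ := fun y => Real.log (W x y) - Real.log (tiltedLaw W ρ y) with hf
  obtain ⟨y₁, y₂, hy₁, hlt, hα⟩ := hs.exists_lt hW hns x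
  have hy₂ := hy₁.trans hlt
  set Δ := Real.log (W x y₂) - Real.log (W x y₁) with hΔdef
  have hΔ : 0 < Δ := sub_pos.2 (Real.log_lt_log hy₁ hlt)
  have hV := isChannel_tiltedChannel hW hs hρ
  have hfy : f y₂ = f y₁ + Δ := by
    have : tiltedLaw W ρ y₁ = tiltedLaw W ρ y₂ := by rw [tiltedLaw, tiltedLaw, hα]
    simp only [hf, this, hΔdef]
    ring
  obtain ⟨c, hc, N₀, hwin⟩ := ProductLaw.exists_window_ge (hV.nonneg x) (hV.sum_eq_one x) f hΔ
    hfy (tiltedChannel_pos hW ρ hy₁) (tiltedChannel_pos hW ρ hy₂)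
    -- The threshold is off the mean by `l - θ log N`, with `|l| ≤ √N` and `|log N| ≤ 2 √N`.
    (B := 2 * θ + 1) (by positivity)
  have hmean : ∑ y, tiltedChannel W ρ x y * f y = (1 + ρ) * R + Real.log F :=
    sum_tiltedChannel_mul_density hW hs hρ x
  rw [hmean] at hwin
  -- Chosen so that `exp (s (l + Δ)) = c / 2`, which yields the factor `2` in `hSlow`.
  set l := (Real.log (c / 2) - s * Δ) / s with hl
  refine ⟨Real.exp l, Real.exp_pos _, max N₀ ⌈l ^ 2⌉₊, fun N hN hN1 => ?_⟩
  have hNpos : (0 : ℝ) < N := by exact_mod_cast hN1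
  have hlN : |l| ≤ √(N : ℝ) := by
    rw [← Real.sqrt_sq_eq_abs]
    refine Real.sqrt_le_sqrt ((Nat.le_ceil _).trans ?_)
    exact_mod_cast (le_max_right _ _).trans hN
  have hlogN : |Real.log N| ≤ 2 * √(N : ℝ) := by
    have h0 : 0 ≤ Real.log N := Real.log_nonneg (by exact_mod_cast hN1)
    rw [abs_of_nonneg h0]
    have h1 := Real.log_le_sub_one_of_pos (Real.sqrt_pos.2 hNpos)
    rw [Real.log_sqrt hNpos.le] at h1
    linarith
  -- Because `s θ = 1 / 2`, the shift by `θ log N` cancels the `1 / √N` of the window probability;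
  -- in `γ = exp t` it becomes the prefactor `N ^ (-θ)`.
  set t := N * ((1 + ρ) * R + Real.log F) + l - θ * Real.log N with ht
  have hw := hwin N ((le_max_left _ _).trans hN) t (by
    have e : t - N * ((1 + ρ) * R + Real.log F) = l - θ * Real.log N := by rw [ht]; ring
    rw [e]
    calc |l - θ * Real.log N| ≤ |l| + |θ * Real.log N| := abs_sub _ _
      _ = |l| + θ * |Real.log N| := by rw [abs_mul, abs_of_pos hθ0]
      _ ≤ √(N : ℝ) + θ * (2 * √(N : ℝ)) := by gcongr
      _ = _ := by ring)
  set γ := Real.exp t with hγ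
  have hγ0 : 0 < γ := Real.exp_pos _
  set S := ∑ o : Fin N → Y, (∏ n, tiltedLaw W ρ (o n)) * (if γ * ∏ n, tiltedLaw W ρ (o n) ≤
      wordProb W (fun _ => x) o then (1 : ℝ) else 0) with hS
  -- On the window the density of the tilted channel with respect to the tilted output law is at
  -- most its value at the right end `t + Δ`, and the left end places the output in the test region.
  have hchange : ∑ o : Fin N → Y, (∏ n, tiltedChannel W ρ x (o n)) *
      (if t < ∑ n, f (o n) ∧ ∑ n, f (o n) ≤ t + Δ then (1 : ℝ) else 0) ≤
      Real.exp (s * (t + Δ) - N * (s * Real.log F)) * S := by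
    rw [hS, mul_sum]
    refine sum_le_sum fun o _ => ?_
    have hQ0 : 0 ≤ ∏ n, tiltedLaw W ρ (o n) := prod_nonneg fun n _ => tiltedLaw_nonneg hW ρ _
    have hrhs : 0 ≤ Real.exp (s * (t + Δ) - N * (s * Real.log F)) *
        ((∏ n, tiltedLaw W ρ (o n)) * (if γ * ∏ n, tiltedLaw W ρ (o n) ≤
        wordProb W (fun _ => x) o then (1 : ℝ) else 0)) :=
      mul_nonneg (Real.exp_pos _).le (mul_nonneg hQ0 (by split_ifs <;> norm_num))
    by_cases hpos : ∀ n, 0 < W x (o n)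
    · split_ifs with h1 h2
      · rw [mul_one, mul_one]
        have e1 : ∏ n, tiltedChannel W ρ x (o n) = (∏ n, tiltedLaw W ρ (o n)) *
            Real.exp (s * (∑ n, f (o n)) - N * (s * Real.log F)) := by
          rw [prod_congr rfl fun n _ => tiltedChannel_eq_mul_exp hW hρ (hpos n),
            prod_mul_distrib, ← Real.exp_sum, sum_sub_distrib, ← mul_sum, sum_const, card_univ,
            Fintype.card_fin, nsmul_eq_mul]
        rw [e1, mul_comm]
        gcongr
        exact h1.2
      · exfalso
        apply h2
        have hQpos : 0 < ∏ n, tiltedLaw W ρ (o n) :=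
          prod_pos fun n _ => tiltedLaw_pos hW ρ (hpos n)
        have hPpos : 0 < wordProb W (fun _ => x) o := (wordProb_pos_iff hW).2 hpos
        rw [← Real.log_le_log_iff (by positivity) hPpos, Real.log_mul hγ0.ne' hQpos.ne', hγ,
          Real.log_exp, log_wordProb hpos, Real.log_prod fun n _ => (tiltedLaw_pos hW ρ (hpos n)).ne']
        have := h1.1
        simp only [hf, sum_sub_distrib] at this
        linarith
      · rw [mul_zero]; positivity
      · simp
    · push Not at hpos
      obtain ⟨n, hn⟩ := hpos
      have h0 : tiltedChannel W ρ x (o n) = 0 :=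
        tiltedChannel_eq_zero hρ (le_antisymm hn (hW.nonneg _ _))
      rw [prod_eq_zero (mem_univ n) h0, zero_mul]
      exact hrhs
  -- Twice the subtracted term `exp (-(N R))` is needed, so that one copy is left over.
  have hSlow : 2 * Real.exp (-(N * R)) ≤ S := by
    have h1 := hw.trans hchange
    have e2 : Real.exp (s * (t + Δ) - N * (s * Real.log F)) =
        c / 2 * Real.exp (N * R) / √(N : ℝ) := by
      have hs1 : s * (1 + ρ) = 1 := by rw [hsdef]; field_simp
      have hsl : s * l = Real.log (c / 2) - s * Δ := by rw [hl]; field_simp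
      have : s * (t + Δ) - N * (s * Real.log F) =
          Real.log (c / 2) + N * R - Real.log √(N : ℝ) := by
        rw [Real.log_sqrt hNpos.le, ht]
        linear_combination N * R * hs1 + hsl - Real.log N * hsθ
      rw [this, Real.exp_sub, Real.exp_add, Real.exp_log (by positivity),
        Real.exp_log (Real.sqrt_pos.2 hNpos)]
    rw [e2, div_mul_eq_mul_div, div_le_div_iff_of_pos_right (Real.sqrt_pos.2 hNpos)] at h1
    rw [Real.exp_neg, ← div_eq_mul_inv, div_le_iff₀ (Real.exp_pos _)]
    nlinarith
  refine le_trans ?_ (testSum_sub_le_minAvgErrorFeedback hW hs ρ N R hγ0.le)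
  have h2 := le_testSum hW ρ N hγ0.le
  have h3 : γ * (2 * Real.exp (-(N * R))) ≤ testSum W ρ N γ :=
    (mul_le_mul_of_nonneg_left hSlow hγ0.le).trans h2
  have h4 : Real.exp l / (N : ℝ) ^ θ * Real.exp (-(N : ℝ) *
      (gallagerFun W ρ (uniformInput X) - ρ * R)) = γ * Real.exp (-(N * R)) := by
    rw [Real.rpow_def_of_pos hNpos, ← Real.exp_sub, ← Real.exp_add, hγ, ← Real.exp_add, ht,
      gallagerFun_eq]
    congr 1
    ring
  rw [h4]
  linarith

/-- The threshold is lowered one step at a time, shrinking the constant by the ratio at the new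
index. -/
theorem exists_forall_le_of_large {a f : ℕ → ℝ} (ha : ∀ N, 1 ≤ N → 0 < a N)
    (hf : ∀ N, 1 ≤ N → 0 < f N) {K : ℝ} (hK : 0 < K) {N₀ : ℕ}
    (h : ∀ N, N₀ ≤ N → 1 ≤ N → K * a N ≤ f N) :
    ∃ K' : ℝ, 0 < K' ∧ ∀ N, 1 ≤ N → K' * a N ≤ f N := by
  induction N₀ generalizing K with
  | zero => exact ⟨K, hK, fun N hN => h N (Nat.zero_le _) hN⟩
  | succ n ih =>
    by_cases hn : 1 ≤ n
    · refine ih (K := min K (f n / a n)) (lt_min hK (div_pos (hf n hn) (ha n hn))) ?_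
      intro N hN hN1
      rcases hN.eq_or_lt with rfl | hlt
      · rw [← le_div_iff₀ (ha n hn)]; exact min_le_right _ _
      · exact (mul_le_mul_of_nonneg_right (min_le_left _ _) (ha N hN1).le).trans (h N hlt hN1)
    · exact ih hK fun N _ hN1 => h N (by omega) hN1

/-- Converse: the refined sphere-packing bound for codes with feedback. -/
theorem exists_le_minAvgErrorFeedback (hW : IsChannel W) (hs : IsSymmetric W)
    (hns : ¬ IsSingular W) {ρ : ℝ} (hρ : 0 ≤ ρ) :
    ∃ K : ℝ, 0 < K ∧ ∀ N : ℕ, 1 ≤ N →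
      K / (N : ℝ) ^ ((1 / 2 : ℝ) * (1 + ρ)) * Real.exp (-(N : ℝ) *
        (gallagerFun W ρ (uniformInput X) - ρ * tiltedRate W ρ)) ≤
      minAvgErrorFeedback W N (tiltedRate W ρ) := by
  obtain ⟨K, hK, N₀, h⟩ := exists_le_minAvgErrorFeedback_of_large hW hs hns hρ
  obtain ⟨K', hK', h'⟩ := exists_forall_le_of_large
    (a := fun N : ℕ => ((N : ℝ) ^ ((1 / 2 : ℝ) * (1 + ρ)))⁻¹ * Real.exp (-(N : ℝ) *
        (gallagerFun W ρ (uniformInput X) - ρ * tiltedRate W ρ)))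
    (f := fun N => minAvgErrorFeedback W N (tiltedRate W ρ))
    (fun N hN => by
      have : (0 : ℝ) < N := by exact_mod_cast hN
      positivity)
    (fun N hN => minAvgErrorFeedback_pos hW hs hns hρ hN) hK
    (fun N hN hN1 => by
      have := h N hN hN1
      rwa [div_eq_mul_inv, mul_assoc] at this)
  refine ⟨K', hK', fun N hN => ?_⟩
  have := h' N hN
  rwa [div_eq_mul_inv, mul_assoc]

end ChannelCoding

end

/-! ### Assembly: the rate is replaced by its parameter and the slope by minus that parameter. -/

theorem theorem1 {X Y : Type*} [Fintype X] [Nonempty X] [Fintype Y] [DecidableEq Y]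
    (W : X → Y → ℝ) (hW : IsChannel W) (hsym : IsSymmetric W) (hns : ¬ IsSingular W)
    (hcr : criticalRate W < capacity W) :
    (∀ R : ℝ, criticalRate W < R → R < capacity W →
      DifferentiableAt ℝ (fun r => randomCodingExp W r) R ∧
      ∃ K : ℝ, 0 < K ∧ ∀ N : ℕ, 1 ≤ N →
        minMaxError W N R ≤
          K / (N : ℝ) ^ ((1 / 2 : ℝ) * (1 + |randomCodingSlope W R|)) *
            Real.exp (-(N : ℝ) * randomCodingExp W R)) ∧
    (∀ R : ℝ, rateInfty W < R → R < capacity W →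
      (∀ r : ℝ, rateInfty W < r → spherePackingExp W r ≠ ⊥ ∧ spherePackingExp W r ≠ ⊤) ∧
      DifferentiableAt ℝ (fun r => (spherePackingExp W r).toReal) R ∧
      ∃ K : ℝ, 0 < K ∧ ∀ N : ℕ, 1 ≤ N →
        K / (N : ℝ) ^ ((1 / 2 : ℝ) * (1 + |spherePackingSlope W R|)) *
            Real.exp (-(N : ℝ) * (spherePackingExp W R).toReal) ≤
          minAvgErrorFeedback W N R) := by
  refine ⟨fun R h1 h2 => ?_, fun R h1 h2 => ⟨fun r hr => ⟨?_, spherePackingExp_ne_top hW hsym hr⟩,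
    ?_⟩⟩
  · obtain ⟨ρ, hρ, rfl⟩ := exists_param_of_criticalRate_lt hW hsym h1 h2
    have hd := hasDerivAt_randomCodingExp hW hsym hns hρ
    -- Nonnegativity of the rate is what bounds the rounded-up number of messages by `2 exp (N R)`.
    have hR : 0 ≤ tiltedRate W ρ :=
      (Real.sInf_nonneg fun _ h => h.1 : 0 ≤ criticalRate W).trans h1.le
    refine ⟨hd.differentiableAt, ?_⟩
    rw [randomCodingSlope, hd.deriv, abs_neg, abs_of_pos hρ.1,
      randomCodingExp_tiltedRate hW hsym hρ.1.le hρ.2.le]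
    exact exists_minMaxError_le hW hns hρ hR
  · exact (lt_of_lt_of_le EReal.bot_lt_zero (spherePackingExp_nonneg hW r)).ne'
  · obtain ⟨ρ, hρ, rfl⟩ := exists_param_of_rateInfty_lt hW hsym h1 h2
    have hd := hasDerivAt_spherePackingExp hW hsym hns hρ
    refine ⟨hd.differentiableAt, ?_⟩
    rw [spherePackingSlope, hd.deriv, abs_neg, abs_of_pos hρ,
      spherePackingExp_tiltedRate hW hsym hρ.le, EReal.toReal_coe]
    exact exists_le_minAvgErrorFeedback hW hsym hns hρ.le
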